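/- Let $\Omega\subset\mathbb R^2$ be a bounded domain with $C^\infty$ boundary, $T>0$, $Q_T=\Omega\times(0,T)$, $\nu_1>0$, $\nu_1+\nu_2\ge 0$. Let $\varrho_0\in L^\infty(\Omega)$ with $\varrho_0>\mathrm{const}>0$, $\mathbf u_0\in L^\infty(\Omega)\cap W^{1,2}_0(\Omega)$ and $\mathbf f\in L^\infty(Q_T)$, and put $\mathbb S(\mathbf u)=\nu_1(\nabla\mathbf u+\nabla\mathbf u^\top)+\nu_2\,\mathrm{div}\,\mathbf u\,\mathbb I$ and $p(\varrho)=\varrho+\varepsilon\varrho^\gamma$ with $\varepsilon\in(0,1]$, $\gamma\ge 6$. A solution of the regularized problem with energy at most $E_0$ is a pair $\varrho\ge 0$, $\mathbf u\in L^2(0,T;W^{1,2}_0(\Omega))$ such that (i) $\displaystyle \operatorname*{ess\,sup}_{t\in(0,T)}\int_\Omega\{\varrho|\mathbf u|^2+\varrho\ln(1+\varrho)+\varepsilon\varrho^\gamma\}(x,t)\,dx+\int_{Q_T}|\nabla\mathbf u|^2\,dxdt\le E_0$; (ii) $\displaystyle \int_{Q_T}\varrho\mathbf u\cdot\partial_t\boldsymbol\xi\,dxdt+\int_{Q_T}\big(\varrho\mathbf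 u\otimes\mathbf u+p(\varrho)\mathbb I-\mathbb S(\mathbf u)\big):\nabla\boldsymbol\xi\,dxdt+\int_{Q_T}\varrho\mathbf f\cdot\boldsymbol\xi\,dxdt+\int_\Omega\varrho_0\mathbf u_0\cdot\boldsymbol\xi(x,0)\,dx=0$ for all smooth vector fields $\boldsymbol\xi$ with $\boldsymbol\xi(x,T)=0$ in $\Omega$ and $\boldsymbol\xi=0$ on $\partial\Omega\times(0,T)$; (iii) $\displaystyle \int_{Q_T}\Big(\varphi(\varrho)\partial_t\psi+\varphi(\varrho)\mathbf u\cdot\nabla\psi-\psi\big(\varphi'(\varrho)\varrho-\varphi(\varrho)\big)\mathrm{div}\,\mathbf u\Big)dxdt+\int_\Omega\psi(x,0)\varphi(\varrho_0)\,dx=0$ for all smooth $\psi$ vanishing near $t=T$ and all $\varphi\in C^2[0,\infty)$ with $|\varphi(r)|+|\varphi'(r)r|+|\varphi''(r)r^2|\le C(1+r^2)$ for some $C$. Let $\zeta\in C^\infty_0(\mathbb R^2)$ be nonnegative with compact support contained in $\Omega$, and let $s>1/2$. With $\|g\|_{H^\sigma(\mathbb R^2)}=\|(1+|\xi|^2)^{\sigma/2}\,\mathfrak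 F g\|_{L^2(\mathbb R^2)}$, $\mathfrak Fg(\xi)=\frac1{2\pi}\int_{\mathbb R^2} e^{-ix\cdot\xi}g(x)\,dx$, and with $\varrho,\mathbf u$ extended by $0$ to $\mathbb R^2\times(0,T)$, every such solution satisfies $$\|\zeta\varrho\|_{L^2(0,T;H^{-1/2}(\mathbb R^2))}\le c(\zeta)\,E,\qquad \|\zeta\varrho\mathbf u\|_{L^1(0,T;H^{-s}(\mathbb R^2))}\le c(\zeta)\,c(s)\,E .$$ Here $c(\zeta)$ depends only on $\zeta$, $c(s)$ depends only on $s$, and $E$ depends only on $\Omega$, $T$, $\nu_1$, $\nu_2$, on upper bounds for $\|\varrho_0\|_{L^\infty(\Omega)}$, $\|\mathbf u_0\|_{L^2(\Omega)}$, $\|\mathbf f\|_{L^\infty(Q_T)}$, and on $E_0$ (itself a constant determined by these quantities for the solutions of interest); in particular none of the constants depends on $\varepsilon$ or $\gamma$. -/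

import Mathlib

open MeasureTheory Set Filter Topology
open scoped ENNReal NNReal ContDiff SchwartzMap

noncomputable section

/-- The plane `ℝ²` with its Euclidean norm. -/
abbrev Plane : Type := EuclideanSpace ℝ (Fin 2)

/-- The space `ℂ²` with its Hermitian norm. -/
abbrev CPlane : Type := EuclideanSpace ℂ (Fin 2)

/-- The vector of `ℂ²` with the same (real) coordinates as `v`. -/
def complexify (v : Plane) : CPlane := WithLp.toLp 2 (fun i => ((v i : ℝ) : ℂ))

/-- The space-time cylinder `Q_T`; the first coordinate is the time. -/
def spaceTime (Ω : Set Plane) (T : ℝ) : Set (ℝ × Plane) := Ioo 0 T ×ˢ Ω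

/-- The partial derivative in the direction of the `j`-th coordinate vector. -/
def pderiv (j : Fin 2) (v : Plane → ℝ) (x : Plane) : ℝ :=
  fderiv ℝ v x (EuclideanSpace.single j 1)

/-! ### The flow domain -/

/-- The boundary of `Ω` is `C^∞`: near each of its points, `Ω` is the sublevel set of a smooth
function with non-vanishing differential. -/
def HasSmoothBoundary (Ω : Set Plane) : Prop :=
  ∀ x ∈ frontier Ω, ∃ (U : Set Plane) (g : Plane → ℝ), IsOpen U ∧ x ∈ U ∧
    ContDiffOn ℝ ∞ g U ∧ fderiv ℝ g x ≠ 0 ∧ Ω ∩ U = {y | y ∈ U ∧ g y < 0}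

/-- A bounded domain (open, connected, non-empty) of the plane with `C^∞` boundary. -/
structure IsFlowDomain (Ω : Set Plane) : Prop where
  isOpen : IsOpen Ω
  isConnected : IsConnected Ω
  isBounded : Bornology.IsBounded Ω
  smooth : HasSmoothBoundary Ω

/-! ### The space `W^{1,2}_0(Ω)` -/

/-- `v` belongs to `W^{1,2}_0(Ω)`, the closure of `C_0^∞(Ω)` in `W^{1,2}(Ω)`, and its weak
partial derivatives in `Ω` are `Dv 0` and `Dv 1`. -/
def MemW120 (Ω : Set Plane) (v : Plane → ℝ) (Dv : Fin 2 → Plane → ℝ) : Prop :=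
  MemLp v 2 (volume.restrict Ω) ∧ (∀ j, MemLp (Dv j) 2 (volume.restrict Ω)) ∧
  ∃ φ : ℕ → Plane → ℝ,
    (∀ n, ContDiff ℝ ∞ (φ n) ∧ HasCompactSupport (φ n) ∧ tsupport (φ n) ⊆ Ω) ∧
    Tendsto (fun n => eLpNorm (fun x => v x - φ n x) 2 (volume.restrict Ω)) atTop (𝓝 0) ∧
    ∀ j, Tendsto (fun n => eLpNorm (fun x => Dv j x - pderiv j (φ n) x) 2 (volume.restrict Ω))
      atTop (𝓝 0)

/-! ### The data -/

/-- The conditions on the initial density `ρ₀`, the initial velocity `u₀` and the mass force `f`. -/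
structure IsFlowData (Ω : Set Plane) (T : ℝ) (ρ₀ : Plane → ℝ) (u₀ : Plane → Plane)
    (f : ℝ → Plane → Plane) : Prop where
  density_bounded : MemLp ρ₀ ∞ (volume.restrict Ω)
  density_pos : ∃ c : ℝ, 0 < c ∧ ∀ᵐ x ∂(volume.restrict Ω), c < ρ₀ x
  velocity_bounded : MemLp u₀ ∞ (volume.restrict Ω)
  velocity_sobolev : ∃ Du₀ : Fin 2 → Fin 2 → Plane → ℝ,
    ∀ i, MemW120 Ω (fun x => u₀ x i) (Du₀ i)
  force_bounded : MemLp (fun z : ℝ × Plane => f z.1 z.2) ∞ (volume.restrict (spaceTime Ω T))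

/-! ### The regularized equations -/

/-- The artificial pressure `p(ϱ) = ϱ + ε ϱ^γ`. -/
def pressure (ε γ r : ℝ) : ℝ := r + ε * r ^ γ

/-- The viscous stress tensor as a function of the velocity gradient `D` (`D i j = ∂_j u_i`). -/
def stress (ν₁ ν₂ : ℝ) (D : Fin 2 → Fin 2 → ℝ) (i j : Fin 2) : ℝ :=
  ν₁ * (D i j + D j i) + ν₂ * (D 0 0 + D 1 1) * (if i = j then 1 else 0)

/-- The total energy `ess sup_t ∫_Ω (ϱ|u|² + ϱ ln (1 + ϱ) + ε ϱ^γ) dx + ∫_{Q_T} |∇u|² dx dt`. -/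
def energy (Ω : Set Plane) (T ε γ : ℝ) (ρ : ℝ → Plane → ℝ) (u : ℝ → Plane → Plane)
    (Du : ℝ → Plane → Fin 2 → Fin 2 → ℝ) : ℝ≥0∞ :=
  essSup (fun t => ∫⁻ x in Ω, ENNReal.ofReal
      (ρ t x * ‖u t x‖ ^ 2 + ρ t x * Real.log (1 + ρ t x) + ε * ρ t x ^ γ))
    (volume.restrict (Ioo 0 T)) +
  ∫⁻ z in spaceTime Ω T, ENNReal.ofReal (∑ i, ∑ j, Du z.1 z.2 i j ^ 2)

/-- Admissible test fields of the momentum balance: smooth, zero at `t = T`, and zero on the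
lateral boundary. -/
structure IsMomentumTest (Ω : Set Plane) (T : ℝ) (ξ : ℝ → Plane → Plane) : Prop where
  smooth : ContDiff ℝ ∞ (fun z : ℝ × Plane => ξ z.1 z.2)
  top : ∀ x ∈ Ω, ξ T x = 0
  lateral : ∀ t ∈ Ioo 0 T, ∀ x ∈ frontier Ω, ξ t x = 0

/-- Admissible test functions of the mass balance: smooth, zero near `t = T`. -/
structure IsMassTest (Ω : Set Plane) (T : ℝ) (ψ : ℝ → Plane → ℝ) : Prop where
  smooth : ContDiff ℝ ∞ (fun z : ℝ × Plane => ψ z.1 z.2)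
  top : ∃ δ > 0, ∀ t ∈ Ioc (T - δ) T, ∀ x ∈ Ω, ψ t x = 0

/-- The functions `φ ∈ C²[0,∞)` admitted in the renormalized mass balance, with
`|φ(r)| + |φ'(r) r| + |φ''(r) r²| ≤ C (1 + r²)`. -/
structure IsRenormalization (φ : ℝ → ℝ) : Prop where
  smooth : ContDiffOn ℝ 2 φ (Ici 0)
  growth : ∃ C : ℝ, ∀ r : ℝ, 0 ≤ r →
    |φ r| + |derivWithin φ (Ici 0) r * r| + |iteratedDerivWithin 2 φ (Ici 0) r * r ^ 2|
      ≤ C * (1 + r ^ 2)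

/-- The weak form of the momentum balance
`∂_t(ϱu) + div(ϱu⊗u) + ∇p(ϱ) = div S(u) + ϱf`, `(ϱu)(0) = ϱ₀u₀`. -/
def MomentumBalance (Ω : Set Plane) (T ν₁ ν₂ ε γ : ℝ) (ρ₀ : Plane → ℝ) (u₀ : Plane → Plane)
    (f : ℝ → Plane → Plane) (ρ : ℝ → Plane → ℝ) (u : ℝ → Plane → Plane)
    (Du : ℝ → Plane → Fin 2 → Fin 2 → ℝ) : Prop :=
  ∀ ξ : ℝ → Plane → Plane, IsMomentumTest Ω T ξ →
    (∫ z in spaceTime Ω T, ρ z.1 z.2 * inner ℝ (u z.1 z.2) (deriv (fun τ => ξ τ z.2) z.1)) +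
    (∫ z in spaceTime Ω T, ∑ i, ∑ j,
      (ρ z.1 z.2 * u z.1 z.2 i * u z.1 z.2 j
        + pressure ε γ (ρ z.1 z.2) * (if i = j then 1 else 0)
        - stress ν₁ ν₂ (Du z.1 z.2) i j) * pderiv j (fun y => ξ z.1 y i) z.2) +
    (∫ z in spaceTime Ω T, ρ z.1 z.2 * inner ℝ (f z.1 z.2) (ξ z.1 z.2)) +
    (∫ x in Ω, ρ₀ x * inner ℝ (u₀ x) (ξ 0 x)) = 0

/-- The weak form of the renormalized mass balance
`∂_t φ(ϱ) + div(φ(ϱ)u) + (φ'(ϱ)ϱ - φ(ϱ)) div u = 0`, `φ(ϱ)(0) = φ(ϱ₀)`. -/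
def RenormalizedMassBalance (Ω : Set Plane) (T : ℝ) (ρ₀ : Plane → ℝ) (ρ : ℝ → Plane → ℝ)
    (u : ℝ → Plane → Plane) (Du : ℝ → Plane → Fin 2 → Fin 2 → ℝ) : Prop :=
  ∀ ψ : ℝ → Plane → ℝ, IsMassTest Ω T ψ → ∀ φ : ℝ → ℝ, IsRenormalization φ →
    (∫ z in spaceTime Ω T,
      (φ (ρ z.1 z.2) * deriv (fun τ => ψ τ z.2) z.1
        + φ (ρ z.1 z.2) * ∑ j, u z.1 z.2 j * pderiv j (ψ z.1) z.2
        - ψ z.1 z.2 * (derivWithin φ (Ici 0) (ρ z.1 z.2) * ρ z.1 z.2 - φ (ρ z.1 z.2))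
            * (Du z.1 z.2 0 0 + Du z.1 z.2 1 1))) +
    (∫ x in Ω, ψ 0 x * φ (ρ₀ x)) = 0

/-- `(ρ, u)` is a renormalized weak solution of the regularized problem in `Q_T` whose energy is
at most `E₀`; `Du t x i j` is the weak derivative `∂_j u_i`. Values outside `Q_T` are
irrelevant. -/
structure IsRegularizedSolution (Ω : Set Plane) (T ν₁ ν₂ ε γ : ℝ) (ρ₀ : Plane → ℝ)
    (u₀ : Plane → Plane) (f : ℝ → Plane → Plane) (E₀ : ℝ≥0)
    (ρ : ℝ → Plane → ℝ) (u : ℝ → Plane → Plane)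
    (Du : ℝ → Plane → Fin 2 → Fin 2 → ℝ) : Prop where
  density_measurable : AEStronglyMeasurable (fun z : ℝ × Plane => ρ z.1 z.2)
    (volume.restrict (spaceTime Ω T))
  density_nonneg : ∀ᵐ z ∂(volume.restrict (spaceTime Ω T)), 0 ≤ ρ z.1 z.2
  velocity_memLp : MemLp (fun z : ℝ × Plane => u z.1 z.2) 2 (volume.restrict (spaceTime Ω T))
  gradient_memLp : ∀ i j, MemLp (fun z : ℝ × Plane => Du z.1 z.2 i j) 2
    (volume.restrict (spaceTime Ω T))
  velocity_sobolev : ∀ᵐ t ∂(volume.restrict (Ioo 0 T)), ∀ i,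
    MemW120 Ω (fun x => u t x i) (fun j x => Du t x i j)
  energy_le : energy Ω T ε γ ρ u Du ≤ E₀
  momentum : MomentumBalance Ω T ν₁ ν₂ ε γ ρ₀ u₀ f ρ u Du
  mass : RenormalizedMassBalance Ω T ρ₀ ρ u Du

/-! ### Cutoffs and Sobolev norms of real order -/

/-- Nonnegative functions of class `C_0^∞(ℝ²)` with support in `Ω`. -/
structure IsCutoff (Ω : Set Plane) (ζ : Plane → ℝ) : Prop where
  smooth : ContDiff ℝ ∞ ζ
  compact : HasCompactSupport ζ
  support : tsupport ζ ⊆ Ω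
  nonneg : ∀ x, 0 ≤ ζ x

variable {V : Type*} [NormedAddCommGroup V] [NormedSpace ℂ V]

/-- The unitary Fourier transform `(2π)⁻¹ ∫ e^{-i x·ξ} g(x) dx` on the plane. -/
def planeFourier (g : Plane → V) (ξ : Plane) : V :=
  ((2 * Real.pi : ℝ) : ℂ)⁻¹ •
    ∫ x : Plane, Complex.exp (-(Complex.I * ((inner ℝ x ξ : ℝ) : ℂ))) • g x

open Classical in
/-- The norm `‖(1 + |ξ|²)^{σ/2} 𝔉g‖_{L²}` of `H^σ(ℝ²)`, for integrable `g` (whose Fourier transform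
is given by the integral above); it is infinite if `g` is not in `H^σ(ℝ²)`. The value is set to
infinity if `g` is not integrable. -/
def sobolevNorm (σ : ℝ) (g : Plane → V) : ℝ≥0∞ :=
  if Integrable g then
    eLpNorm (fun ξ : Plane => (((1 + ‖ξ‖ ^ 2) ^ (σ / 2) : ℝ) : ℂ) • planeFourier g ξ) 2 volume
  else ∞

open Classical in
/-- The norm of `L^p(0,T; H^σ(ℝ²))`. Measurability in `t` is required in the weak form, against
Schwartz functions, which for the separable spaces `H^σ` is the same as strong measurability;
the value is infinity if it fails. -/
def bochnerSobolevNorm (p : ℝ≥0∞) (T σ : ℝ) (g : ℝ → Plane → V) : ℝ≥0∞ :=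
  if ∀ φ : 𝓢(Plane, ℂ), AEStronglyMeasurable (fun t => ∫ x : Plane, φ x • g t x)
      (volume.restrict (Ioo 0 T)) then
    eLpNorm (fun t => sobolevNorm σ (g t)) p (volume.restrict (Ioo 0 T))
  else ∞

end

/-!
The estimate rests on an interaction identity in one direction at a time. Fix a unit vector `e`,
and let `a`, `m`, `q` be the components `ζ ϱ`, `ζ ϱ u · e` and
`ζ (ϱ u ⊗ u + p(ϱ) I - S(u)) : e ⊗ e` of the localized density, momentum and momentum flux. The
momentum balance is tested with `χ(t) ζ(x) Φ(t, x) e`, where `Φ` is the convolution of `ζ ϱ` with a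
bounded primitive, in the direction `e`, of a Gaussian strip kernel `k(x) = gaussKernel b ⟪e, x⟫`.
Differentiation of `Φ` in space gives back `k * a`, and the mass balance shows that `∂_t Φ` is
`-k * m` up to a bounded error. Hence, with `⟨f, g⟩ = ∬ f(x) g(y) k(x - y) dx dy` (`dirForm`),

  `∫ χ (⟨q, a⟩ - ⟨m, m⟩) dt ≤ C`,

with a constant depending only on the energy, the data and `ζ`. This is
`AprioriBound.mollified_flux_sub_momentum_le` for a convolution in time as well, which makes the
test functions smooth, and `AprioriBound.flux_sub_momentum_le` in the limit.

The transport part of the left-hand side is nonnegative, because `⟨ϱ v², ϱ⟩ - ⟨ϱ v, ϱ v⟩` equals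
`½ ∬ ϱ(x) ϱ(y) (v(x) - v(y))² k(x - y)` (`dirForm_momentum_le`). The pressure is at least `ϱ`, so
its contribution is at least `⟨a, a⟩`; this part does not see `ε` or `γ`. The form is positive
definite, since the Gaussian has a positive Fourier transform, and bounded on `L²` functions
supported in a fixed ball (`dirForm_self_le`), so the viscous stress, which is in `L²(Q_T)`, is
absorbed. The result is a bound of `∫ ⟨a, a⟩ dt` uniform in the width of the strip and in `e`
(`AprioriBound.lintegral_dirForm_cutDensity_le`).

By Plancherel's theorem `⟨a, a⟩` is a Gaussian-weighted integral of `|𝔉 a|²` over the line `ℝ e`.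
As the strip shrinks to a line the weight tends to `1`, so `∫∫ |𝔉 a(t)(r e)|² dr dt ≤ C` for each
`e`; integration over all directions in polar coordinates, where the Jacobian `r` is compensated by
the weight `(1 + r²)^{-1/2}`, is the first estimate
(`AprioriBound.lintegral_sobolevNorm_cutDensity_le`). The second one follows from the first by the
product estimate `H^{-1/2} · W^{1,2}_0 ⊆ H^{-s}`, `s > 1/2` (`sobolevNorm_mul_sq_le`), applied at
almost every time to `ζ ϱ` and the components of `u`.
-/

/-! ### Gaussian interaction energies along a direction -/

/-- The Gaussian probability density of variance `1 / (2 b)`. -/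
noncomputable def gaussKernel (b τ : ℝ) : ℝ := √(b / Real.pi) * Real.exp (-b * τ ^ 2)

lemma gaussKernel_nonneg (b τ : ℝ) : 0 ≤ gaussKernel b τ := by
  unfold gaussKernel; positivity

lemma gaussKernel_neg (b τ : ℝ) : gaussKernel b (-τ) = gaussKernel b τ := by
  simp [gaussKernel]

lemma gaussKernel_le {b : ℝ} (hb : 0 < b) (τ : ℝ) : gaussKernel b τ ≤ √(b / Real.pi) := by
  unfold gaussKernel
  refine mul_le_of_le_one_right (Real.sqrt_nonneg _) (Real.exp_le_one_iff.2 ?_)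
  have := mul_nonneg hb.le (sq_nonneg τ)
  linarith

lemma contDiff_gaussKernel (b : ℝ) : ContDiff ℝ ∞ (gaussKernel b) := by
  unfold gaussKernel
  fun_prop

lemma continuous_gaussKernel (b : ℝ) : Continuous (gaussKernel b) :=
  (contDiff_gaussKernel b).continuous

lemma integrable_gaussKernel {b : ℝ} (hb : 0 < b) : Integrable (gaussKernel b) :=
  (integrable_exp_neg_mul_sq hb).const_mul _

lemma integral_gaussKernel {b : ℝ} (hb : 0 < b) : ∫ τ, gaussKernel b τ = 1 := by
  have hπ := Real.pi_pos
  unfold gaussKernel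
  rw [integral_const_mul, integral_gaussian, ← Real.sqrt_mul (by positivity)]
  rw [div_mul_div_comm, mul_comm b, div_self (by positivity), Real.sqrt_one]

/-- The Gaussian kernel is the Fourier transform of a positive Gaussian. -/
lemma integral_exp_mul_cexp {b : ℝ} (hb : 0 < b) (τ : ℝ) :
    ∫ r : ℝ, (Real.exp (-r ^ 2 / (4 * b)) : ℂ) * Complex.exp (Complex.I * (r * τ : ℝ))
      = (2 * Real.pi * gaussKernel b τ : ℝ) := by
  have hπ := Real.pi_pos
  have hc : (0 : ℝ) < ((1 / (4 * b) : ℝ) : ℂ).re := by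
    rw [Complex.ofReal_re]; positivity
  have h := fourierIntegral_gaussian hc (τ : ℂ)
  have h1 : (((Real.pi : ℂ) / ((1 / (4 * b) : ℝ) : ℂ)) ^ (1 / 2 : ℂ))
      = ((√(Real.pi * (4 * b)) : ℝ) : ℂ) := by
    rw [Real.sqrt_eq_rpow, Complex.ofReal_cpow (by positivity)]
    congr 1
    · push_cast; field_simp
    · push_cast; rfl
  rw [h1] at h
  have h2 : Complex.exp (-(τ : ℂ) ^ 2 / (4 * ((1 / (4 * b) : ℝ) : ℂ)))
      = (Real.exp (-b * τ ^ 2) : ℂ) := by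
    push_cast; congr 1
    have : (b : ℂ) ≠ 0 := by exact_mod_cast hb.ne'
    field_simp
  rw [h2] at h
  calc _ = ∫ r : ℝ, Complex.exp (Complex.I * τ * r)
        * Complex.exp (-((1 / (4 * b) : ℝ) : ℂ) * r ^ 2) := by
        congr 1; ext r
        rw [mul_comm]
        push_cast
        congr 2
        · ring
        · have : (b : ℂ) ≠ 0 := by exact_mod_cast hb.ne'
          field_simp
    _ = _ := by
        have hs : √(Real.pi * (4 * b)) = 2 * Real.pi * √(b / Real.pi) := by
          have : (2 * Real.pi) = √((2 * Real.pi) ^ 2) := by rw [Real.sqrt_sq (by positivity)]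
          rw [this, ← Real.sqrt_mul (by positivity)]
          congr 1
          field_simp; ring
        rw [h, gaussKernel, ← Complex.ofReal_mul, hs, mul_assoc]

/-- The potential of the density `g` for the kernel `gaussKernel b ⟪e, x - y⟫`, that is,
the smoothed integral of `g` over the line through `x` orthogonal to `e`. -/
noncomputable def dirPot (b : ℝ) (e : Plane) (g : Plane → ℝ) (x : Plane) : ℝ :=
  ∫ y, g y * gaussKernel b (inner ℝ e (x - y))

/-- The interaction energy of the densities `f` and `g` for the kernel
`gaussKernel b ⟪e, x - y⟫`. -/
noncomputable def dirForm (b : ℝ) (e : Plane) (f g : Plane → ℝ) : ℝ :=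
  ∫ z : Plane × Plane, f z.1 * g z.2 * gaussKernel b (inner ℝ e (z.1 - z.2))

section DirForm

variable {b : ℝ} {e : Plane} {f g h : Plane → ℝ}

lemma integrable_mul_gaussKernel (hb : 0 < b) (hg : Integrable g) (x : Plane) :
    Integrable (fun y => g y * gaussKernel b (inner ℝ e (x - y))) := by
  refine hg.mul_bdd (c := √(b / Real.pi))
    ((continuous_gaussKernel b).comp (by fun_prop)).aestronglyMeasurable (ae_of_all _ fun y => ?_)
  rw [Real.norm_of_nonneg (gaussKernel_nonneg _ _)]
  exact gaussKernel_le hb _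

lemma abs_dirPot_le (hb : 0 < b) (hg : Integrable g) (x : Plane) :
    |dirPot b e g x| ≤ √(b / Real.pi) * ∫ y, |g y| := by
  rw [dirPot, ← integral_const_mul]
  refine (abs_integral_le_integral_abs).trans (integral_mono
    (integrable_mul_gaussKernel hb hg x).abs (hg.abs.const_mul _) fun y => ?_)
  dsimp only
  rw [abs_mul, abs_of_nonneg (gaussKernel_nonneg _ _), mul_comm]
  exact mul_le_mul_of_nonneg_right (gaussKernel_le hb _) (abs_nonneg _)

lemma integrable_dirForm (hb : 0 < b) (hf : Integrable f) (hg : Integrable g) :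
    Integrable (fun z : Plane × Plane =>
      f z.1 * g z.2 * gaussKernel b (inner ℝ e (z.1 - z.2))) := by
  refine (hf.mul_prod hg).mul_bdd (c := √(b / Real.pi))
    ((continuous_gaussKernel b).comp (by fun_prop)).aestronglyMeasurable (ae_of_all _ fun y => ?_)
  rw [Real.norm_of_nonneg (gaussKernel_nonneg _ _)]
  exact gaussKernel_le hb _

lemma dirForm_eq_integral (hb : 0 < b) (hf : Integrable f) (hg : Integrable g) :
    dirForm b e f g = ∫ x, f x * dirPot b e g x := by
  rw [dirForm, Measure.volume_eq_prod, integral_prod _ (integrable_dirForm hb hf hg)]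
  congr 1; ext x
  rw [dirPot, ← integral_const_mul]
  congr 1; ext y; ring

lemma dirForm_comm : dirForm b e f g = dirForm b e g f := by
  unfold dirForm
  rw [Measure.volume_eq_prod, ← integral_prod_swap]
  congr 1; ext z
  simp only [Prod.fst_swap, Prod.snd_swap]
  rw [← gaussKernel_neg, ← inner_neg_right, neg_sub]
  ring

lemma dirForm_sub_left (hb : 0 < b) (hf : Integrable f) (hg : Integrable g) (hh : Integrable h) :
    dirForm b e (fun x => f x - g x) h = dirForm b e f h - dirForm b e g h := by
  unfold dirForm
  rw [← integral_sub (integrable_dirForm hb hf hh) (integrable_dirForm hb hg hh)]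
  congr 1; ext z; ring

lemma dirForm_add_left (hb : 0 < b) (hf : Integrable f) (hg : Integrable g) (hh : Integrable h) :
    dirForm b e (fun x => f x + g x) h = dirForm b e f h + dirForm b e g h := by
  unfold dirForm
  rw [← integral_add (integrable_dirForm hb hf hh) (integrable_dirForm hb hg hh)]
  congr 1; ext z; ring

lemma dirForm_mono_left (hb : 0 < b) (hf : Integrable f) (hg : Integrable g) (hh : Integrable h)
    (hfg : ∀ᵐ x, f x ≤ g x) (h0 : ∀ᵐ x, 0 ≤ h x) :
    dirForm b e f h ≤ dirForm b e g h := by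
  rw [← sub_nonneg, ← dirForm_sub_left hb hg hf hh, dirForm]
  refine integral_nonneg_of_ae ?_
  rw [Measure.volume_eq_prod]
  have h1 := Measure.quasiMeasurePreserving_fst (μ := (volume : Measure Plane))
    (ν := (volume : Measure Plane)) |>.ae hfg
  have h2 := Measure.quasiMeasurePreserving_snd (μ := (volume : Measure Plane))
    (ν := (volume : Measure Plane)) |>.ae h0
  filter_upwards [h1, h2] with z hz1 hz2
  exact mul_nonneg (mul_nonneg (sub_nonneg.2 hz1) hz2) (gaussKernel_nonneg _ _)

/-- Convexity of the transport term: the interaction energy of the mass with the kinetic energy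
dominates the self-interaction of the momentum. The difference is
`½ ∬ f(x) f(y) (v(x) - v(y))² k(x - y)`. -/
lemma dirForm_momentum_le (hb : 0 < b) {v : Plane → ℝ} (hf : Integrable f)
    (hfv : Integrable (fun x => f x * v x)) (hfv2 : Integrable (fun x => f x * v x ^ 2))
    (h0 : ∀ᵐ x, 0 ≤ f x) :
    dirForm b e (fun x => f x * v x) (fun x => f x * v x)
      ≤ dirForm b e (fun x => f x * v x ^ 2) f := by
  have key : 0 ≤ dirForm b e (fun x => f x * v x ^ 2) f
      + dirForm b e f (fun x => f x * v x ^ 2)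
      - 2 * dirForm b e (fun x => f x * v x) (fun x => f x * v x) := by
    unfold dirForm
    rw [← integral_const_mul, ← integral_add (integrable_dirForm hb hfv2 hf)
      (integrable_dirForm hb hf hfv2), ← integral_sub]
    rotate_left
    · exact (integrable_dirForm hb hfv2 hf).add (integrable_dirForm hb hf hfv2)
    · exact (integrable_dirForm hb hfv hfv).const_mul 2
    refine integral_nonneg_of_ae ?_
    rw [Measure.volume_eq_prod]
    have h1 := Measure.quasiMeasurePreserving_fst (μ := (volume : Measure Plane))
      (ν := (volume : Measure Plane)) |>.ae h0
    have h2 := Measure.quasiMeasurePreserving_snd (μ := (volume : Measure Plane))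
      (ν := (volume : Measure Plane)) |>.ae h0
    filter_upwards [h1, h2] with z hz1 hz2
    have : (0 : ℝ) ≤ f z.1 * f z.2 * (v z.1 - v z.2) ^ 2
        * gaussKernel b (inner ℝ e (z.1 - z.2)) :=
      mul_nonneg (mul_nonneg (mul_nonneg hz1 hz2) (sq_nonneg _)) (gaussKernel_nonneg _ _)
    simp only [Pi.zero_apply]
    linarith
  rw [dirForm_comm (f := f)] at key
  linarith

end DirForm

/-! ### The Fourier transform on the plane -/

section PlaneFourier

open scoped FourierTransform

variable {V : Type*} [NormedAddCommGroup V] [NormedSpace ℂ V]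

lemma planeFourier_eq_fourier (g : Plane → V) (ξ : Plane) :
    planeFourier g ξ = ((2 * Real.pi : ℝ) : ℂ)⁻¹ • 𝓕 g ((2 * Real.pi)⁻¹ • ξ) := by
  rw [planeFourier, Real.fourier_eq']
  congr 2; ext x
  congr 2
  rw [real_inner_smul_right]
  have : (Real.pi : ℂ) ≠ 0 := by exact_mod_cast Real.pi_ne_zero
  push_cast
  field_simp

lemma continuous_planeFourier {g : Plane → V} (hg : Integrable g) :
    Continuous (planeFourier g) := by
  have h : Continuous (𝓕 g) := VectorFourier.fourierIntegral_continuous Real.continuous_fourierChar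
    continuous_inner hg
  have : planeFourier g
      = fun ξ => ((2 * Real.pi : ℝ) : ℂ)⁻¹ • 𝓕 g ((2 * Real.pi)⁻¹ • ξ) := by
    ext ξ; exact planeFourier_eq_fourier g ξ
  rw [this]
  fun_prop

lemma norm_planeFourier_le (g : Plane → V) (ξ : Plane) :
    ‖planeFourier g ξ‖ ≤ (2 * Real.pi)⁻¹ * ∫ x, ‖g x‖ := by
  have hπ := Real.pi_pos
  rw [planeFourier, norm_smul, norm_inv, Complex.norm_real, Real.norm_of_nonneg (by positivity)]
  gcongr
  refine (norm_integral_le_integral_norm _).trans_eq ?_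
  congr 1; ext x
  rw [norm_smul, show -(Complex.I * ((inner ℝ x ξ : ℝ) : ℂ)) = ((-inner ℝ x ξ : ℝ) : ℂ) * Complex.I by
    push_cast; ring, Complex.norm_exp_ofReal_mul_I, one_mul]

end PlaneFourier

section DirFormFourier

variable {b : ℝ} {e : Plane} {f g : Plane → ℝ}

/-- Plancherel's theorem for the interaction energy: it is a Gaussian average of the squared Fourier
transform over the line spanned by `e`. -/
lemma dirForm_self_eq (hb : 0 < b) (hf : Integrable f) :
    dirForm b e f f = 2 * Real.pi * ∫ r : ℝ, Real.exp (-r ^ 2 / (4 * b))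
      * ‖planeFourier (fun x => (f x : ℂ)) (r • e)‖ ^ 2 := by
  have hπ := Real.pi_pos
  set A : ℝ → ℂ := fun r => ∫ y, Complex.exp (-(Complex.I * ((inner ℝ y (r • e) : ℝ) : ℂ))) • (f y : ℂ)
    with hA
  have hpF : ∀ r, ‖planeFourier (fun x => (f x : ℂ)) (r • e)‖ ^ 2
      = ((2 * Real.pi) ^ 2)⁻¹ * ‖A r‖ ^ 2 := fun r => by
    rw [planeFourier, norm_smul, norm_inv, Complex.norm_real, Real.norm_of_nonneg (by positivity),
      mul_pow, inv_pow]
  have hgauss : Integrable (fun r : ℝ => ((Real.exp (-r ^ 2 / (4 * b)) : ℝ) : ℂ)) := by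
    have := (integrable_exp_neg_mul_sq (b := 1 / (4 * b)) (by positivity)).ofReal (𝕜 := ℂ)
    refine this.congr (ae_of_all _ fun r => ?_)
    dsimp only
    congr 2; field_simp
  set G : Plane × Plane → ℝ → ℂ := fun z r => ((f z.1 : ℂ) * (f z.2 : ℂ))
    * ((Real.exp (-r ^ 2 / (4 * b)) : ℝ) : ℂ)
    * Complex.exp (Complex.I * (r * inner ℝ e (z.1 - z.2) : ℝ)) with hG
  have hGint : Integrable (Function.uncurry G) ((volume : Measure (Plane × Plane)).prod volume) := by
    have h1 : Integrable (fun z : Plane × Plane => (f z.1 : ℂ) * (f z.2 : ℂ)) :=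
      (hf.ofReal (𝕜 := ℂ)).mul_prod (hf.ofReal (𝕜 := ℂ))
    refine (h1.mul_prod hgauss).mul_bdd (c := 1)
      (Continuous.aestronglyMeasurable (by fun_prop)) (ae_of_all _ fun p => ?_)
    rw [mul_comm Complex.I, Complex.norm_exp_ofReal_mul_I]
  have hswap := integral_integral_swap hGint
  have hleft : ∫ z, ∫ r, G z r = ((2 * Real.pi * dirForm b e f f : ℝ) : ℂ) := by
    rw [dirForm, ← integral_const_mul, ← integral_complex_ofReal]
    congr 1; ext z
    simp only [hG, mul_assoc]
    rw [integral_const_mul, integral_const_mul, integral_exp_mul_cexp hb]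
    push_cast; ring
  have hright : ∫ r, ∫ z, G z r
      = ((∫ r : ℝ, Real.exp (-r ^ 2 / (4 * b)) * ‖A r‖ ^ 2 : ℝ) : ℂ) := by
    rw [← integral_complex_ofReal]
    congr 1; ext r
    have h1 : ∀ z : Plane × Plane, G z r = ((Real.exp (-r ^ 2 / (4 * b)) : ℝ) : ℂ)
        * ((Complex.exp (Complex.I * ((inner ℝ z.1 (r • e) : ℝ) : ℂ)) • (f z.1 : ℂ))
          * (Complex.exp (-(Complex.I * ((inner ℝ z.2 (r • e) : ℝ) : ℂ))) • (f z.2 : ℂ))) := by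
      intro z
      simp only [hG, smul_eq_mul]
      have : Complex.exp (Complex.I * (r * inner ℝ e (z.1 - z.2) : ℝ))
          = Complex.exp (Complex.I * ((inner ℝ z.1 (r • e) : ℝ) : ℂ))
          * Complex.exp (-(Complex.I * ((inner ℝ z.2 (r • e) : ℝ) : ℂ))) := by
        rw [← Complex.exp_add, real_inner_smul_right, real_inner_smul_right, inner_sub_right,
          real_inner_comm e z.1, real_inner_comm e z.2]
        congr 1; push_cast; ring
      rw [this]; ring
    simp_rw [h1]
    rw [integral_const_mul, Measure.volume_eq_prod, integral_prod_mul
      (fun x => Complex.exp (Complex.I * ((inner ℝ x (r • e) : ℝ) : ℂ)) • (f x : ℂ))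
      (fun x => Complex.exp (-(Complex.I * ((inner ℝ x (r • e) : ℝ) : ℂ))) • (f x : ℂ))]
    have h2 : ∫ x, Complex.exp (Complex.I * ((inner ℝ x (r • e) : ℝ) : ℂ)) • (f x : ℂ)
        = (starRingEnd ℂ) (A r) := by
      rw [hA, ← integral_conj]
      congr 1; ext x
      simp only [smul_eq_mul, map_mul, Complex.conj_ofReal, ← Complex.exp_conj, map_neg,
        Complex.conj_I, neg_mul, neg_neg]
    rw [h2, Complex.conj_mul']
    push_cast; ring
  rw [hleft, hright] at hswap
  have hre : 2 * Real.pi * dirForm b e f f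
      = ∫ r : ℝ, Real.exp (-r ^ 2 / (4 * b)) * ‖A r‖ ^ 2 := by exact_mod_cast hswap
  have h3 : ∀ r : ℝ, Real.exp (-r ^ 2 / (4 * b))
      * ‖planeFourier (fun x => (f x : ℂ)) (r • e)‖ ^ 2
      = ((2 * Real.pi) ^ 2)⁻¹ * (Real.exp (-r ^ 2 / (4 * b)) * ‖A r‖ ^ 2) := fun r => by
    rw [hpF]; ring
  simp_rw [h3]
  rw [integral_const_mul, ← hre]
  field_simp

lemma dirForm_self_nonneg (hb : 0 < b) (hf : Integrable f) : 0 ≤ dirForm b e f f := by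
  rw [dirForm_self_eq hb hf]
  have := Real.pi_pos
  refine mul_nonneg (by positivity) (integral_nonneg fun r => by positivity)

/-- The Cauchy-Schwarz inequality for the positive semidefinite form `dirForm b e`. -/
lemma two_mul_dirForm_le (hb : 0 < b) (hf : Integrable f) (hg : Integrable g) :
    2 * dirForm b e f g ≤ dirForm b e f f + dirForm b e g g := by
  have h := dirForm_self_nonneg (e := e) hb (hf.sub hg)
  have h1 : dirForm b e (f - g) (f - g)
      = dirForm b e f f - dirForm b e f g - (dirForm b e g f - dirForm b e g g) := by
    have hfg : Integrable (fun x => f x - g x) := hf.sub hg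
    rw [show f - g = fun x => f x - g x from rfl, dirForm_sub_left hb hf hg hfg,
      dirForm_comm (f := f) (g := fun x => f x - g x),
      dirForm_comm (f := g) (g := fun x => f x - g x), dirForm_sub_left hb hf hg hf,
      dirForm_sub_left hb hf hg hg, dirForm_comm (f := g) (g := f)]
  rw [h1, dirForm_comm (f := g) (g := f)] at h
  linarith

/-- `dirForm_self_eq` as an identity of integrals in `[0, ∞]`. -/
lemma lintegral_gauss_mul_planeFourier (hb : 0 < b) (hf : Integrable f) :
    ∫⁻ r : ℝ, ENNReal.ofReal (Real.exp (-r ^ 2 / (4 * b)))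
      * ‖planeFourier (fun x => (f x : ℂ)) (r • e)‖ₑ ^ 2
      = ENNReal.ofReal ((2 * Real.pi)⁻¹ * dirForm b e f f) := by
  have hπ := Real.pi_pos
  have hcont := continuous_planeFourier (hf.ofReal (𝕜 := ℂ))
  rw [dirForm_self_eq hb hf, ← mul_assoc, inv_mul_cancel₀ (by positivity), one_mul,
    ofReal_integral_eq_lintegral_ofReal]
  · refine lintegral_congr fun r => ?_
    rw [ENNReal.ofReal_mul (Real.exp_nonneg _), ENNReal.ofReal_pow (norm_nonneg _),
      ofReal_norm]
  · have h1 : Integrable (fun r : ℝ => Real.exp (-r ^ 2 / (4 * b))) := by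
      refine (integrable_exp_neg_mul_sq (b := 1 / (4 * b)) (by positivity)).congr
        (ae_of_all _ fun r => ?_)
      dsimp only
      congr 1; field_simp
    refine h1.mul_bdd (c := ((2 * Real.pi)⁻¹ * ∫ x, ‖(f x : ℂ)‖) ^ 2)
      (Continuous.aestronglyMeasurable ?_) (ae_of_all _ fun r => ?_)
    · exact (hcont.comp (by fun_prop)).norm.pow 2
    · rw [Real.norm_of_nonneg (by positivity)]
      gcongr
      exact norm_planeFourier_le _ _
  · exact ae_of_all _ fun r => by positivity

end DirFormFourier

/-! ### Integration in rotated and polar coordinates -/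

/-- The unit vector with polar angle `θ`. -/
noncomputable def dir (θ : ℝ) : Plane := !₂[Real.cos θ, Real.sin θ]

lemma norm_dir (θ : ℝ) : ‖dir θ‖ = 1 := by
  simp [dir, EuclideanSpace.norm_eq]

lemma continuous_dir : Continuous dir := by
  unfold dir
  fun_prop

lemma lintegral_plane (F : Plane → ℝ≥0∞) :
    ∫⁻ ξ, F ξ = ∫⁻ p : ℝ × ℝ, F !₂[p.1, p.2] := by
  have h1 := (PiLp.volume_preserving_toLp (Fin 2)).lintegral_comp_emb
    (MeasurableEquiv.toLp 2 (Fin 2 → ℝ)).measurableEmbedding F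
  have h2 := (volume_preserving_finTwoArrow ℝ).symm.lintegral_comp_emb
    (MeasurableEquiv.finTwoArrow.symm).measurableEmbedding (fun v => F (WithLp.toLp 2 v))
  rw [← h1, ← h2]
  rfl

/-- Integration in polar coordinates: the weight of `H^{-1/2}` compensates the Jacobian. -/
lemma lintegral_bracket_rpow_le (F : Plane → ℝ≥0∞) (hF : Measurable F) :
    ∫⁻ ξ, ENNReal.ofReal ((1 + ‖ξ‖ ^ 2) ^ (-(1 / 2) : ℝ)) * F ξ
      ≤ ∫⁻ θ in Ioo (-Real.pi) Real.pi, ∫⁻ r : ℝ, F (r • dir θ) := by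
  rw [lintegral_plane, ← lintegral_comp_polarCoord_symm]
  have hpt : ∀ p : ℝ × ℝ, !₂[(polarCoord.symm p).1, (polarCoord.symm p).2] = p.1 • dir p.2 := by
    intro p
    ext i
    fin_cases i <;> simp [polarCoord, dir]
  have hmeas : Measurable (fun p : ℝ × ℝ => F (p.1 • dir p.2)) :=
    hF.comp (measurable_fst.smul (continuous_dir.measurable.comp measurable_snd))
  calc _ ≤ ∫⁻ p in Ioi (0 : ℝ) ×ˢ Ioo (-Real.pi) Real.pi, F (p.1 • dir p.2) := by
        refine setLIntegral_mono hmeas fun p hp => ?_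
        have hp1 : 0 < p.1 := hp.1
        rw [hpt, smul_eq_mul, ← mul_assoc, ← ENNReal.ofReal_mul hp1.le]
        refine mul_le_of_le_one_left zero_le (ENNReal.ofReal_le_one.2 ?_)
        rw [norm_smul, norm_dir, mul_one, Real.norm_of_nonneg hp1.le,
          Real.rpow_neg (by positivity), ← Real.sqrt_eq_rpow, ← div_eq_mul_inv]
        rw [div_le_one (by positivity)]
        exact Real.le_sqrt_of_sq_le (by linarith)
    _ ≤ ∫⁻ p in univ ×ˢ Ioo (-Real.pi) Real.pi, F (p.1 • dir p.2) :=
        lintegral_mono_set (prod_mono_left (subset_univ _))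
    _ = _ := by
        rw [Measure.volume_eq_prod, ← Measure.prod_restrict, Measure.restrict_univ,
          lintegral_prod_symm _ hmeas.aemeasurable]

/-- The Gaussian strip of unit mass orthogonal to `e` meets a ball of radius `R` in mass at most
`2 R`: the sections of the ball by the lines orthogonal to `e` have length at most `2 R`. -/
lemma setLIntegral_gaussKernel_le {b : ℝ} (hb : 0 < b) {e : Plane} (he : ‖e‖ = 1) (R : ℝ)
    (x : Plane) :
    ∫⁻ y in Metric.closedBall (0 : Plane) R, ENNReal.ofReal (gaussKernel b (inner ℝ e (x - y)))
      ≤ ENNReal.ofReal (2 * R) := by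
  have hon : Orthonormal ℝ (({0} : Set (Fin 2)).domRestrict fun _ : Fin 2 => e) :=
    ⟨fun _ => he, fun i j hij => absurd (Subsingleton.elim i j) hij⟩
  obtain ⟨B, hB⟩ := hon.exists_orthonormalBasis_extension_of_card_eq (by simp)
  have hB0 : B 0 = e := hB 0 rfl
  set G : Plane → ℝ≥0∞ := (Metric.closedBall (0 : Plane) R).indicator
    fun y => ENNReal.ofReal (gaussKernel b (inner ℝ e (x - y))) with hG
  rw [← lintegral_indicator Metric.isClosed_closedBall.measurableSet,
    ← B.measurePreserving_repr_symm.lintegral_comp_emb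
      B.repr.symm.toHomeomorph.measurableEmbedding, lintegral_plane]
  set c := inner ℝ e x
  have hle : ∀ p : ℝ × ℝ, G (B.repr.symm !₂[p.1, p.2])
      ≤ ENNReal.ofReal (gaussKernel b (c - p.1)) * (Icc (-R) R).indicator 1 p.2 := by
    intro p
    by_cases h : B.repr.symm !₂[p.1, p.2] ∈ Metric.closedBall (0 : Plane) R
    · rw [hG, indicator_of_mem h]
      have h1 : inner ℝ e (x - B.repr.symm !₂[p.1, p.2]) = c - p.1 := by
        rw [inner_sub_right, ← hB0, ← B.repr_apply_apply (B.repr.symm _)]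
        simp [c, hB0]
      have h2 : p.2 ∈ Icc (-R) R := by
        rw [mem_closedBall_zero_iff, LinearIsometryEquiv.norm_map] at h
        have h3 := (PiLp.norm_apply_le (!₂[p.1, p.2] : Plane) 1).trans h
        rw [Real.norm_eq_abs] at h3
        exact abs_le.1 h3
      rw [h1, indicator_of_mem h2, Pi.one_apply, mul_one]
    · rw [hG, indicator_of_notMem h]
      exact zero_le
  refine (lintegral_mono hle).trans ?_
  rw [Measure.volume_eq_prod, lintegral_prod_mul
    (f := fun τ => ENNReal.ofReal (gaussKernel b (c - τ))) (g := (Icc (-R) R).indicator 1)]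
  · have h1 : ∫⁻ τ, ENNReal.ofReal (gaussKernel b (c - τ)) = 1 := by
      rw [lintegral_sub_left_eq_self (fun τ => ENNReal.ofReal (gaussKernel b τ)),
        ← ofReal_integral_eq_lintegral_ofReal (integrable_gaussKernel hb)
          (ae_of_all _ fun _ => gaussKernel_nonneg _ _), integral_gaussKernel hb,
        ENNReal.ofReal_one]
    rw [h1, one_mul, lintegral_indicator_one measurableSet_Icc, Real.volume_Icc]
    exact ENNReal.ofReal_le_ofReal (by linarith)
  · exact ((continuous_gaussKernel b).comp (by fun_prop)).measurable.ennreal_ofReal.aemeasurable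
  · exact (measurable_one.indicator measurableSet_Icc).aemeasurable

/-- Schur's test for the strip kernel: on functions supported in a ball, the energy is bounded by the
`L²` norm, uniformly in the width of the strip. -/
lemma dirForm_self_le {b : ℝ} (hb : 0 < b) {e : Plane} (he : ‖e‖ = 1) {R : ℝ} (hR : 0 ≤ R)
    {f : Plane → ℝ} (hf : Integrable f) (hf2 : Integrable fun x => f x ^ 2)
    (hsupp : ∀ x, x ∉ Metric.closedBall (0 : Plane) R → f x = 0) :
    dirForm b e f f ≤ 2 * R * ∫ x, f x ^ 2 := by
  set B := Metric.closedBall (0 : Plane) R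
  have hBm : MeasurableSet B := Metric.isClosed_closedBall.measurableSet
  have h1B : Integrable (B.indicator (1 : Plane → ℝ)) :=
    (integrable_indicator_iff hBm).2
      (integrableOn_const (measure_closedBall_lt_top (x := (0 : Plane)) (r := R)).ne)
  have hle : dirForm b e f f ≤ dirForm b e (fun x => f x ^ 2) (B.indicator 1) := by
    -- `2 f(x) f(y) ≤ f(x)² + f(y)²` on the square of the ball
    have hsum : dirForm b e f f ≤ (1 / 2) * (dirForm b e (fun x => f x ^ 2) (B.indicator 1)
        + dirForm b e (B.indicator 1) (fun x => f x ^ 2)) := by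
      unfold dirForm
      rw [← integral_add (integrable_dirForm hb hf2 h1B) (integrable_dirForm hb h1B hf2),
        ← integral_const_mul]
      refine integral_mono (integrable_dirForm hb hf hf)
        (((integrable_dirForm hb hf2 h1B).add (integrable_dirForm hb h1B hf2)).const_mul _)
        fun z => ?_
      have hk := gaussKernel_nonneg b (inner ℝ e (z.1 - z.2))
      have h1' : ∀ x, (0 : ℝ) ≤ B.indicator 1 x := indicator_nonneg fun _ _ => zero_le_one
      by_cases h1 : z.1 ∈ B
      · by_cases h2 : z.2 ∈ B
        · simp only [indicator_of_mem h1, indicator_of_mem h2, Pi.one_apply]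
          nlinarith [mul_nonneg (sq_nonneg (f z.1 - f z.2)) hk]
        · simp only [hsupp _ h2]
          have := mul_nonneg (mul_nonneg (sq_nonneg (f z.1)) (h1' z.2)) hk
          linarith
      · simp only [hsupp _ h1]
        have := mul_nonneg (mul_nonneg (h1' z.1) (sq_nonneg (f z.2))) hk
        linarith
    rw [dirForm_comm (f := B.indicator 1)] at hsum
    linarith
  refine hle.trans ?_
  rw [dirForm_eq_integral hb hf2 h1B, ← integral_const_mul]
  have hpot : ∀ x, dirPot b e (B.indicator 1) x ≤ 2 * R := by
    intro x
    have : dirPot b e (B.indicator 1) x = ∫ y in B, gaussKernel b (inner ℝ e (x - y)) := by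
      rw [dirPot, ← integral_indicator hBm]
      congr 1; ext y
      by_cases hy : y ∈ B <;> simp [hy]
    rw [this, integral_eq_lintegral_of_nonneg_ae (ae_of_all _ fun _ => gaussKernel_nonneg _ _)
      ((continuous_gaussKernel b).comp (by fun_prop)).aestronglyMeasurable]
    exact ENNReal.toReal_le_of_le_ofReal (by positivity) (setLIntegral_gaussKernel_le hb he R x)
  have hmeas : Integrable (fun x => f x ^ 2 * dirPot b e (B.indicator 1) x) := by
    have := (integrable_dirForm (e := e) hb hf2 h1B).integral_prod_left
    refine this.congr (ae_of_all _ fun x => ?_)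
    dsimp only
    rw [dirPot, ← integral_const_mul]
    congr 1; ext y; ring
  refine integral_mono hmeas (hf2.const_mul _) fun x => ?_
  dsimp only
  rw [mul_comm]
  exact mul_le_mul_of_nonneg_right (hpot x) (sq_nonneg _)

/-! ### Schwartz functions: inversion, Plancherel, products -/

section SchwartzFourier

open scoped FourierTransform

lemma integral_comp_inv_two_pi_smul {E : Type*} [NormedAddCommGroup E] [NormedSpace ℝ E]
    (f : Plane → E) :
    ∫ ξ, f ((2 * Real.pi)⁻¹ • ξ) = ((2 * Real.pi) ^ 2) • ∫ ξ, f ξ := by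
  rw [Measure.integral_comp_smul]
  congr 1
  have := Real.pi_pos
  simp only [finrank_euclideanSpace, Fintype.card_fin]
  rw [abs_of_pos (by positivity), inv_pow, inv_inv]

lemma integrable_planeFourier (φ : 𝓢(Plane, ℂ)) : Integrable (planeFourier φ) := by
  have h : Integrable (fun ξ : Plane => 𝓕 (φ : Plane → ℂ) ((2 * Real.pi)⁻¹ • ξ)) :=
    ((𝓕 φ).integrable (μ := volume)).comp_smul (inv_ne_zero (by positivity))
  refine (h.smul (((2 * Real.pi : ℝ) : ℂ)⁻¹)).congr (ae_of_all _ fun ξ => ?_)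
  exact (planeFourier_eq_fourier _ ξ).symm

/-- Fourier inversion in the unitary normalization. -/
lemma planeFourier_inversion (φ : 𝓢(Plane, ℂ)) (x : Plane) :
    φ x = ((2 * Real.pi : ℝ) : ℂ)⁻¹ * ∫ η, planeFourier φ η
      * Complex.exp (Complex.I * ((inner ℝ x η : ℝ) : ℂ)) := by
  have hπ : (Real.pi : ℂ) ≠ 0 := by exact_mod_cast Real.pi_ne_zero
  have h : φ x = 𝓕⁻ (𝓕 (φ : Plane → ℂ)) x := by
    rw [φ.continuous.fourierInv_fourier_eq φ.integrable (𝓕 φ).integrable]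
  set G : Plane → ℂ := fun v => Complex.exp ((2 * Real.pi * inner ℝ v x : ℝ) * Complex.I)
    • 𝓕 (φ : Plane → ℂ) v with hG
  have h2 : ∀ η, planeFourier φ η * Complex.exp (Complex.I * ((inner ℝ x η : ℝ) : ℂ))
      = ((2 * Real.pi : ℝ) : ℂ)⁻¹ * G ((2 * Real.pi)⁻¹ • η) := by
    intro η
    rw [planeFourier_eq_fourier, hG, smul_eq_mul, mul_assoc]
    dsimp only
    rw [real_inner_smul_left, ← mul_assoc (2 * Real.pi), mul_inv_cancel₀ (by positivity), one_mul,
      real_inner_comm, smul_eq_mul, mul_comm Complex.I]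
    ring
  rw [Real.fourierInv_eq'] at h
  rw [h]
  simp_rw [h2]
  have hG' : ∫ v, Complex.exp ((2 * Real.pi * inner ℝ v x : ℝ) * Complex.I)
    • 𝓕 (φ : Plane → ℂ) v = ∫ v, G v := rfl
  rw [integral_const_mul, integral_comp_inv_two_pi_smul G, Complex.real_smul, hG']
  push_cast
  field_simp

/-- The Fourier transform of a product is the convolution of the Fourier transforms. -/
lemma planeFourier_mul {f : Plane → ℂ} (hf : Integrable f) (φ : 𝓢(Plane, ℂ)) (ξ : Plane) :
    planeFourier (fun x => f x * φ x) ξ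
      = ((2 * Real.pi : ℝ) : ℂ)⁻¹ * ∫ η, planeFourier φ η * planeFourier f (ξ - η) := by
  set c : ℂ := ((2 * Real.pi : ℝ) : ℂ)⁻¹ with hc
  have hint : Integrable (Function.uncurry fun (x η : Plane) =>
      Complex.exp (-(Complex.I * ((inner ℝ x (ξ - η) : ℝ) : ℂ))) * (f x * planeFourier φ η))
      (volume.prod volume) := by
    refine (hf.mul_prod (integrable_planeFourier φ)).bdd_mul (c := 1)
      (Continuous.aestronglyMeasurable (by fun_prop)) (ae_of_all _ fun p => ?_)
    rw [show -(Complex.I * ((inner ℝ p.1 (ξ - p.2) : ℝ) : ℂ))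
      = ((-inner ℝ p.1 (ξ - p.2) : ℝ) : ℂ) * Complex.I by push_cast; ring,
      Complex.norm_exp_ofReal_mul_I]
  have hswap := integral_integral_swap hint
  calc planeFourier (fun x => f x * φ x) ξ
      = c * ∫ x, c * ∫ η, Complex.exp (-(Complex.I * ((inner ℝ x (ξ - η) : ℝ) : ℂ)))
          * (f x * planeFourier φ η) := by
        rw [planeFourier, smul_eq_mul]
        congr 2; ext x
        rw [smul_eq_mul, planeFourier_inversion φ x, ← hc, ← mul_assoc, mul_left_comm _ c]
        congr 1
        rw [← integral_const_mul]
        congr 1; ext η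
        rw [inner_sub_right]
        have : Complex.exp (-(Complex.I * ((inner ℝ x ξ - inner ℝ x η : ℝ) : ℂ)))
            = Complex.exp (-(Complex.I * ((inner ℝ x ξ : ℝ) : ℂ)))
              * Complex.exp (Complex.I * ((inner ℝ x η : ℝ) : ℂ)) := by
          rw [← Complex.exp_add]; congr 1; push_cast; ring
        rw [this]; ring
    _ = c * ∫ η, planeFourier φ η * planeFourier f (ξ - η) := by
        rw [integral_const_mul, hswap, ← integral_const_mul]
        congr 2; ext η
        have : planeFourier f (ξ - η) = c * ∫ x,
            Complex.exp (-(Complex.I * ((inner ℝ x (ξ - η) : ℝ) : ℂ))) • f x := rfl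
        rw [this, mul_left_comm]
        congr 1
        rw [← integral_const_mul]
        congr 1; ext x
        rw [smul_eq_mul]; ring

/-- Plancherel's theorem in the unitary normalization. -/
lemma lintegral_planeFourier_sq (φ : 𝓢(Plane, ℂ)) :
    ∫⁻ ξ, ‖planeFourier φ ξ‖ₑ ^ 2 = ∫⁻ x, ‖φ x‖ₑ ^ 2 := by
  have hπ := Real.pi_pos
  have hconv : ∀ (f : Plane → ℂ), Integrable (fun x => ‖f x‖ ^ 2) →
      ∫⁻ x, ‖f x‖ₑ ^ 2 = ENNReal.ofReal (∫ x, ‖f x‖ ^ 2) := by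
    intro f hf
    rw [ofReal_integral_eq_lintegral_ofReal hf (ae_of_all _ fun x => by positivity)]
    refine lintegral_congr fun x => ?_
    rw [ENNReal.ofReal_pow (norm_nonneg _), ofReal_norm]
  have hsq : ∀ ψ : 𝓢(Plane, ℂ), Integrable (fun x => ‖ψ x‖ ^ 2) := fun ψ =>
    (memLp_two_iff_integrable_sq_norm ψ.continuous.aestronglyMeasurable).1 (ψ.memLp 2)
  have hpt : ∀ ξ, ‖planeFourier φ ξ‖ ^ 2
      = ((2 * Real.pi) ^ 2)⁻¹ * ‖(𝓕 φ : 𝓢(Plane, ℂ)) ((2 * Real.pi)⁻¹ • ξ)‖ ^ 2 := by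
    intro ξ
    rw [planeFourier_eq_fourier, norm_smul, norm_inv, Complex.norm_real,
      Real.norm_of_nonneg (by positivity), mul_pow, inv_pow]
    rfl
  rw [hconv _ (hsq φ), hconv, ← SchwartzMap.integral_norm_sq_fourier φ]
  · simp_rw [hpt]
    rw [integral_const_mul, integral_comp_inv_two_pi_smul (fun ξ => ‖(𝓕 φ : 𝓢(Plane, ℂ)) ξ‖ ^ 2), smul_eq_mul,
      ← mul_assoc, inv_mul_cancel₀ (by positivity), one_mul]
  · simp_rw [hpt]
    exact ((hsq (𝓕 φ)).comp_smul (inv_ne_zero (by positivity))).const_mul _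

open LineDeriv in
lemma planeFourier_lineDeriv (φ : 𝓢(Plane, ℂ)) (m ξ : Plane) :
    planeFourier (∂_{m} φ : 𝓢(Plane, ℂ)) ξ = Complex.I * (inner ℝ ξ m : ℝ) * planeFourier φ ξ := by
  have hπ : (Real.pi : ℂ) ≠ 0 := by exact_mod_cast Real.pi_ne_zero
  rw [planeFourier_eq_fourier, planeFourier_eq_fourier]
  have h := SchwartzMap.fourier_lineDerivOp_eq φ m
  have hT : (inner ℝ · m : Plane → ℝ).HasTemperateGrowth :=
    ((innerSL ℝ).flip m).hasTemperateGrowth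
  have h2 : 𝓕 (((∂_{m} φ : 𝓢(Plane, ℂ)) : Plane → ℂ)) ((2 * Real.pi)⁻¹ • ξ)
      = (2 * Real.pi * Complex.I) * ((inner ℝ ((2 * Real.pi)⁻¹ • ξ) m : ℝ)
        * 𝓕 (φ : Plane → ℂ) ((2 * Real.pi)⁻¹ • ξ)) := by
    have h3 := congrArg (fun ψ : 𝓢(Plane, ℂ) => ψ ((2 * Real.pi)⁻¹ • ξ)) h
    simp only [smul_apply, SchwartzMap.smulLeftCLM_apply_apply hT, smul_eq_mul,
      Complex.real_smul] at h3
    exact h3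
  rw [h2, real_inner_smul_left]
  simp only [smul_eq_mul]
  push_cast
  field_simp

open LineDeriv in
/-- The `H^1` norm of a Schwartz function in Fourier variables. -/
lemma lintegral_bracket_mul_planeFourier_sq (φ : 𝓢(Plane, ℂ)) :
    ∫⁻ ξ, ENNReal.ofReal (1 + ‖ξ‖ ^ 2) * ‖planeFourier φ ξ‖ₑ ^ 2
      = (∫⁻ x, ‖φ x‖ₑ ^ 2)
        + ∑ j : Fin 2, ∫⁻ x, ‖(∂_{(EuclideanSpace.single j (1 : ℝ) : Plane)} φ : 𝓢(Plane, ℂ)) x‖ₑ ^ 2 := by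
  simp_rw [← lintegral_planeFourier_sq, planeFourier_lineDeriv]
  have hc := continuous_planeFourier (φ.integrable (μ := volume))
  have hm : Measurable (fun ξ => ‖planeFourier φ ξ‖ₑ ^ 2) :=
    (continuous_planeFourier φ.integrable).enorm.measurable.pow_const 2
  rw [Fin.sum_univ_two, ← lintegral_add_left' , ← lintegral_add_left hm]
  · refine lintegral_congr fun ξ => ?_
    rw [EuclideanSpace.real_norm_sq_eq, Fin.sum_univ_two, ENNReal.ofReal_add zero_le_one
      (by positivity), ENNReal.ofReal_add (by positivity) (by positivity), ENNReal.ofReal_one,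
      add_mul, add_mul, one_mul]
    congr 1
    simp only [enorm_mul, mul_pow]
    congr 2 <;>
    · rw [← ofReal_norm, ← ofReal_norm, ← ENNReal.ofReal_pow (by positivity),
        ← ENNReal.ofReal_pow (by positivity), ← ENNReal.ofReal_mul (by positivity)]
      congr 1
      simp [EuclideanSpace.inner_single_right]
  · refine Measurable.aemeasurable ((Continuous.measurable ?_).pow_const 2)
    exact Continuous.enorm (by fun_prop)

end SchwartzFourier

/-! ### Products in Sobolev spaces of negative order -/

/-- The Cauchy-Schwarz inequality for integrals in `[0, ∞]`. -/
lemma lintegral_mul_sq_le {α : Type*} [MeasurableSpace α] (μ : Measure α) {f g : α → ℝ≥0∞}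
    (hf : AEMeasurable f μ) (hg : AEMeasurable g μ) :
    (∫⁻ x, f x * g x ∂μ) ^ 2 ≤ (∫⁻ x, f x ^ 2 ∂μ) * ∫⁻ x, g x ^ 2 ∂μ := by
  have h := ENNReal.lintegral_mul_le_Lp_mul_Lq μ Real.HolderConjugate.two_two hf hg
  have h2 := pow_le_pow_left' h 2
  refine h2.trans_eq ?_
  rw [mul_pow, ← ENNReal.rpow_natCast, ← ENNReal.rpow_natCast, ← ENNReal.rpow_mul,
    ← ENNReal.rpow_mul]
  norm_num

/-- The Japanese bracket `(1 + |ξ|²)^{σ/2}`. -/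
noncomputable def bracket (σ : ℝ) (ξ : Plane) : ℝ := (1 + ‖ξ‖ ^ 2) ^ (σ / 2)

lemma bracket_pos (σ : ℝ) (ξ : Plane) : 0 < bracket σ ξ := by
  unfold bracket; positivity

lemma continuous_bracket (σ : ℝ) : Continuous (bracket σ) := by
  unfold bracket
  exact Continuous.rpow_const (by fun_prop) fun x => Or.inl (by positivity)

lemma bracket_mul (σ τ : ℝ) (ξ : Plane) : bracket σ ξ * bracket τ ξ = bracket (σ + τ) ξ := by
  unfold bracket
  rw [← Real.rpow_add (by positivity)]
  congr 1; ring

lemma bracket_zero (ξ : Plane) : bracket 0 ξ = 1 := by simp [bracket]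

lemma bracket_sq (σ : ℝ) (ξ : Plane) : bracket σ ξ ^ 2 = bracket (2 * σ) ξ := by
  rw [sq, bracket_mul]; congr 1; ring

lemma bracket_le_of_nonneg {σ : ℝ} (hσ : 0 ≤ σ) {ξ η : Plane} {M : ℝ}
    (h : 1 + ‖ξ‖ ^ 2 ≤ M * (1 + ‖η‖ ^ 2)) (hM : 0 ≤ M) :
    bracket σ ξ ≤ M ^ (σ / 2) * bracket σ η := by
  unfold bracket
  rw [← Real.mul_rpow hM (by positivity)]
  exact Real.rpow_le_rpow (by positivity) h (by positivity)

/-- The convolution kernel of the product estimate is dominated by a square integrable function of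
one variable: of `ξ - η` if the frequency `ξ - η` is at most `ξ`, and of `ξ` otherwise. -/
lemma bracket_kernel_le {s : ℝ} (hs : 1 / 2 < s) (ξ η : Plane) :
    bracket (-s) ξ * bracket (1 / 2) η * bracket (-1) (ξ - η)
      ≤ 2 * (bracket (-(s + 1 / 2)) (ξ - η) + bracket (-(s + 1 / 2)) ξ) := by
  have hη : ‖η‖ ^ 2 ≤ 2 * ‖ξ‖ ^ 2 + 2 * ‖ξ - η‖ ^ 2 := by
    have h1 : ‖η‖ ≤ ‖ξ‖ + ‖ξ - η‖ := by
      calc ‖η‖ = ‖ξ - (ξ - η)‖ := by congr 1; abel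
        _ ≤ _ := norm_sub_le _ _
    nlinarith [norm_nonneg η, norm_nonneg ξ, norm_nonneg (ξ - η), sq_nonneg (‖ξ‖ - ‖ξ - η‖)]
  have h4 : (4 : ℝ) ^ ((1 / 2 : ℝ) / 2) ≤ 2 := by
    calc (4 : ℝ) ^ ((1 / 2 : ℝ) / 2) ≤ (4 : ℝ) ^ (1 / 2 : ℝ) :=
          Real.rpow_le_rpow_of_exponent_le (by norm_num) (by norm_num)
      _ = 2 := by rw [← Real.sqrt_eq_rpow]; norm_num
  have p1 := bracket_pos (-s) ξ
  have p2 := bracket_pos (1 / 2) η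
  have p3 := bracket_pos (-1) (ξ - η)
  rcases le_total (‖ξ - η‖ ^ 2) (‖ξ‖ ^ 2) with h | h
  · have h1 : bracket (1 / 2) η ≤ 2 * bracket (1 / 2) ξ :=
      (bracket_le_of_nonneg (by norm_num) (M := 4) (by linarith) (by norm_num)).trans
        (mul_le_mul_of_nonneg_right h4 (bracket_pos _ _).le)
    have h2 : bracket (s - 1 / 2) (ξ - η) ≤ bracket (s - 1 / 2) ξ := by
      have := bracket_le_of_nonneg (σ := s - 1 / 2) (by linarith) (ξ := ξ - η) (η := ξ) (M := 1)
        (by linarith) zero_le_one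
      simpa using this
    have h3 : bracket (1 / 2 - s) ξ ≤ bracket (1 / 2 - s) (ξ - η) := by
      have e1 : bracket (s - 1 / 2) (ξ - η) * bracket (1 / 2 - s) (ξ - η) = 1 := by
        rw [bracket_mul, show s - 1 / 2 + (1 / 2 - s) = 0 by ring, bracket_zero]
      have e2 : bracket (s - 1 / 2) ξ * bracket (1 / 2 - s) ξ = 1 := by
        rw [bracket_mul, show s - 1 / 2 + (1 / 2 - s) = 0 by ring, bracket_zero]
      have q1 := bracket_pos (1 / 2 - s) ξ
      have q2 := bracket_pos (1 / 2 - s) (ξ - η)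
      calc bracket (1 / 2 - s) ξ
          = (bracket (s - 1 / 2) (ξ - η) * bracket (1 / 2 - s) (ξ - η))
              * bracket (1 / 2 - s) ξ := by rw [e1, one_mul]
        _ ≤ (bracket (s - 1 / 2) ξ * bracket (1 / 2 - s) (ξ - η)) * bracket (1 / 2 - s) ξ := by
            gcongr
        _ = bracket (1 / 2 - s) (ξ - η) * (bracket (s - 1 / 2) ξ * bracket (1 / 2 - s) ξ) := by
            ring
        _ = _ := by rw [e2, mul_one]
    calc bracket (-s) ξ * bracket (1 / 2) η * bracket (-1) (ξ - η)
        ≤ bracket (-s) ξ * (2 * bracket (1 / 2) ξ) * bracket (-1) (ξ - η) := by gcongr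
      _ = 2 * bracket (1 / 2 - s) ξ * bracket (-1) (ξ - η) := by
          rw [show 1 / 2 - s = -s + 1 / 2 by ring, ← bracket_mul]; ring
      _ ≤ 2 * bracket (1 / 2 - s) (ξ - η) * bracket (-1) (ξ - η) := by gcongr
      _ = 2 * bracket (-(s + 1 / 2)) (ξ - η) := by
          rw [mul_assoc, bracket_mul]; congr 2; ring
      _ ≤ _ := by
          have := bracket_pos (-(s + 1 / 2)) ξ
          linarith
  · have h1 : bracket (1 / 2) η ≤ 2 * bracket (1 / 2) (ξ - η) :=
      (bracket_le_of_nonneg (by norm_num) (M := 4) (by linarith) (by norm_num)).trans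
        (mul_le_mul_of_nonneg_right h4 (bracket_pos _ _).le)
    have h3 : bracket (-(1 / 2)) (ξ - η) ≤ bracket (-(1 / 2)) ξ := by
      unfold bracket
      exact Real.rpow_le_rpow_of_nonpos (by positivity) (by linarith) (by norm_num)
    calc bracket (-s) ξ * bracket (1 / 2) η * bracket (-1) (ξ - η)
        ≤ bracket (-s) ξ * (2 * bracket (1 / 2) (ξ - η)) * bracket (-1) (ξ - η) := by gcongr
      _ = 2 * bracket (-s) ξ * bracket (-(1 / 2)) (ξ - η) := by
          rw [show (-(1 / 2) : ℝ) = 1 / 2 + -1 by ring, ← bracket_mul]; ring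
      _ ≤ 2 * bracket (-s) ξ * bracket (-(1 / 2)) ξ := by gcongr
      _ = 2 * bracket (-(s + 1 / 2)) ξ := by
          rw [mul_assoc, bracket_mul]; congr 2; ring
      _ ≤ _ := by
          have := bracket_pos (-(s + 1 / 2)) (ξ - η)
          linarith

lemma lintegral_bracket_lt_top {s : ℝ} (hs : 1 / 2 < s) :
    ∫⁻ ξ, ENNReal.ofReal (bracket (-(s + 1 / 2)) ξ) ^ 2 < ⊤ := by
  have h : Integrable (fun ξ : Plane => (1 + ‖ξ‖ ^ 2) ^ (-(2 * s + 1) / 2)) :=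
    integrable_rpow_neg_one_add_norm_sq (by simp; linarith)
  have := h.lintegral_lt_top
  refine lt_of_eq_of_lt (lintegral_congr fun ξ => ?_) this
  rw [← ENNReal.ofReal_pow (bracket_pos _ _).le, bracket_sq, bracket]
  congr 2; ring

/-- Young's inequality `L² * L¹ ⊆ L²` for nonnegative functions. -/
lemma lintegral_conv_sq_le {A B : Plane → ℝ≥0∞} (hA : Measurable A) (hB : Measurable B) :
    ∫⁻ ξ, (∫⁻ η, A η * B (ξ - η)) ^ 2 ≤ (∫⁻ ξ, A ξ ^ 2) * (∫⁻ ξ, B ξ) ^ 2 := by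
  have hpt : ∀ ξ, (∫⁻ η, A η * B (ξ - η)) ^ 2
      ≤ (∫⁻ η, A η ^ 2 * B (ξ - η)) * ∫⁻ η, B η := by
    intro ξ
    have hBξ : Measurable fun η => B (ξ - η) := by fun_prop
    have h := lintegral_mul_sq_le volume (f := fun η => A η * B (ξ - η) ^ (1 / 2 : ℝ))
      (g := fun η => B (ξ - η) ^ (1 / 2 : ℝ)) (by fun_prop) (by fun_prop)
    have hsq : ∀ x : ℝ≥0∞, x ^ (1 / 2 : ℝ) * x ^ (1 / 2 : ℝ) = x := fun x => by
      rw [← ENNReal.rpow_add_of_nonneg _ _ (by norm_num) (by norm_num)]; norm_num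
    have hsq2 : ∀ x : ℝ≥0∞, (x ^ (1 / 2 : ℝ)) ^ 2 = x := fun x => by rw [sq, hsq]
    simp only [mul_assoc, mul_pow, hsq, hsq2] at h
    rwa [lintegral_sub_left_eq_self (fun η => B η) ξ] at h
  calc _ ≤ ∫⁻ ξ, (∫⁻ η, A η ^ 2 * B (ξ - η)) * ∫⁻ η, B η := lintegral_mono hpt
    _ = (∫⁻ ξ, ∫⁻ η, A η ^ 2 * B (ξ - η)) * ∫⁻ η, B η := by
        rw [lintegral_mul_const]
        exact Measurable.lintegral_prod_right' (f := fun p : Plane × Plane => A p.2 ^ 2 * B (p.1 - p.2)) (by fun_prop)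
    _ = _ := by
        rw [lintegral_lintegral_swap (by fun_prop)]
        have : ∀ η, ∫⁻ ξ, A η ^ 2 * B (ξ - η) = A η ^ 2 * ∫⁻ ξ, B ξ := by
          intro η
          rw [lintegral_const_mul _ (by fun_prop), lintegral_sub_right_eq_self B η]
        simp_rw [this]
        rw [lintegral_mul_const _ (by fun_prop)]
        ring

/-- The product estimate `H^{-1/2} · H^1 ⊆ H^{-s}` on the Fourier side. -/
lemma lintegral_weighted_conv_le {s : ℝ} (hs : 1 / 2 < s) {A B : Plane → ℝ≥0∞}
    (hA : Measurable A) (hB : Measurable B) :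
    ∫⁻ ξ, (ENNReal.ofReal (bracket (-s) ξ) * ∫⁻ η, A η * B (ξ - η)) ^ 2
      ≤ 32 * (∫⁻ ξ, ENNReal.ofReal (bracket (-(s + 1 / 2)) ξ) ^ 2)
        * (∫⁻ ξ, (ENNReal.ofReal (bracket (-(1 / 2)) ξ) * A ξ) ^ 2)
        * ∫⁻ ξ, (ENNReal.ofReal (bracket 1 ξ) * B ξ) ^ 2 := by
  have mb : ∀ σ, Measurable fun ξ => ENNReal.ofReal (bracket σ ξ) := fun σ =>
    (continuous_bracket σ).measurable.ennreal_ofReal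
  set J : Plane → ℝ≥0∞ := fun ξ => ENNReal.ofReal (bracket (-(s + 1 / 2)) ξ) with hJ
  set a : Plane → ℝ≥0∞ := fun ξ => ENNReal.ofReal (bracket (-(1 / 2)) ξ) * A ξ with ha
  set b : Plane → ℝ≥0∞ := fun ξ => ENNReal.ofReal (bracket 1 ξ) * B ξ with hb
  have hJm : Measurable J := mb _
  have ham : Measurable a := (mb _).mul hA
  have hbm : Measurable b := (mb _).mul hB
  have hone : ∀ σ ξ, ENNReal.ofReal (bracket σ ξ) * ENNReal.ofReal (bracket (-σ) ξ) = 1 := by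
    intro σ ξ
    rw [← ENNReal.ofReal_mul (bracket_pos _ _).le, bracket_mul, add_neg_cancel, bracket_zero,
      ENNReal.ofReal_one]
  have hpt : ∀ ξ, ENNReal.ofReal (bracket (-s) ξ) * ∫⁻ η, A η * B (ξ - η)
      ≤ 2 * ((∫⁻ η, a η * (J (ξ - η) * b (ξ - η))) + J ξ * ∫⁻ η, a η * b (ξ - η)) := by
    intro ξ
    rw [← lintegral_const_mul _ (by fun_prop), ← lintegral_const_mul (J ξ) (by fun_prop),
      ← lintegral_add_left (by fun_prop), ← lintegral_const_mul _ (by fun_prop)]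
    refine lintegral_mono fun η => ?_
    have hk := ENNReal.ofReal_le_ofReal (bracket_kernel_le hs ξ η)
    rw [ENNReal.ofReal_mul (mul_pos (bracket_pos _ _) (bracket_pos _ _)).le,
      ENNReal.ofReal_mul (bracket_pos _ _).le, ENNReal.ofReal_mul zero_le_two,
      ENNReal.ofReal_add (bracket_pos _ _).le (bracket_pos _ _).le, ENNReal.ofReal_ofNat] at hk
    have hA' : A η = ENNReal.ofReal (bracket (1 / 2) η) * a η := by
      rw [ha, ← mul_assoc, hone, one_mul]
    have hB' : B (ξ - η) = ENNReal.ofReal (bracket (-1) (ξ - η)) * b (ξ - η) := by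
      have := hone (-1) (ξ - η)
      rw [neg_neg] at this
      rw [hb, ← mul_assoc, this, one_mul]
    calc ENNReal.ofReal (bracket (-s) ξ) * (A η * B (ξ - η))
        = (ENNReal.ofReal (bracket (-s) ξ) * ENNReal.ofReal (bracket (1 / 2) η)
            * ENNReal.ofReal (bracket (-1) (ξ - η))) * (a η * b (ξ - η)) := by
          rw [hA', hB']; ring
      _ ≤ (2 * (J (ξ - η) + J ξ)) * (a η * b (ξ - η)) := by gcongr
      _ = _ := by ring
  have hsqadd : ∀ x y : ℝ≥0∞, (2 * (x + y)) ^ 2 ≤ 16 * (x ^ 2 + y ^ 2) := by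
    intro x y
    have h1 : x + y ≤ 2 * max x y := by
      rw [two_mul]; exact add_le_add (le_max_left _ _) (le_max_right _ _)
    have h2 : max x y ^ 2 ≤ x ^ 2 + y ^ 2 := by
      rcases le_total x y with h | h
      · rw [max_eq_right h]; exact le_add_self
      · rw [max_eq_left h]; exact le_self_add
    calc (2 * (x + y)) ^ 2 ≤ (2 * (2 * max x y)) ^ 2 := by gcongr
      _ = 16 * max x y ^ 2 := by ring
      _ ≤ _ := by gcongr
  have hI1 : ∫⁻ ξ, (∫⁻ η, a η * (J (ξ - η) * b (ξ - η))) ^ 2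
      ≤ (∫⁻ ξ, a ξ ^ 2) * ((∫⁻ ξ, J ξ ^ 2) * ∫⁻ ξ, b ξ ^ 2) :=
    (lintegral_conv_sq_le (B := fun ξ => J ξ * b ξ) ham (hJm.mul hbm)).trans
      (mul_le_mul_right (lintegral_mul_sq_le _ hJm.aemeasurable hbm.aemeasurable) _)
  have hI2 : ∫⁻ ξ, (J ξ * ∫⁻ η, a η * b (ξ - η)) ^ 2
      ≤ (∫⁻ ξ, J ξ ^ 2) * ((∫⁻ ξ, a ξ ^ 2) * ∫⁻ ξ, b ξ ^ 2) := by
    rw [← lintegral_mul_const _ (by fun_prop)]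
    refine lintegral_mono fun ξ => ?_
    rw [mul_pow]
    gcongr
    refine (lintegral_mul_sq_le _ ham.aemeasurable (by fun_prop)).trans_eq ?_
    rw [lintegral_sub_left_eq_self (fun η => b η ^ 2) ξ]
  have hm1 : Measurable fun ξ => (∫⁻ η, a η * (J (ξ - η) * b (ξ - η))) ^ 2 :=
    (Measurable.lintegral_prod_right' (f := fun p : Plane × Plane =>
      a p.2 * (J (p.1 - p.2) * b (p.1 - p.2))) (by fun_prop)).pow_const 2
  calc _ ≤ ∫⁻ ξ, 16 * ((∫⁻ η, a η * (J (ξ - η) * b (ξ - η))) ^ 2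
        + (J ξ * ∫⁻ η, a η * b (ξ - η)) ^ 2) :=
        lintegral_mono fun ξ => (pow_le_pow_left' (hpt ξ) 2).trans (hsqadd _ _)
    _ = 16 * ((∫⁻ ξ, (∫⁻ η, a η * (J (ξ - η) * b (ξ - η))) ^ 2)
        + ∫⁻ ξ, (J ξ * ∫⁻ η, a η * b (ξ - η)) ^ 2) := by
        rw [lintegral_const_mul' _ _ (by norm_num), lintegral_add_left hm1]
    _ ≤ 16 * ((∫⁻ ξ, a ξ ^ 2) * ((∫⁻ ξ, J ξ ^ 2) * ∫⁻ ξ, b ξ ^ 2)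
        + (∫⁻ ξ, J ξ ^ 2) * ((∫⁻ ξ, a ξ ^ 2) * ∫⁻ ξ, b ξ ^ 2)) := by gcongr
    _ = _ := by ring

section SobolevProduct

variable {V : Type*} [NormedAddCommGroup V] [NormedSpace ℂ V]

lemma eLpNorm_two_sq {α : Type*} [MeasurableSpace α] {μ : Measure α} {E : Type*}
    [TopologicalSpace E] [ContinuousENorm E] (f : α → E) :
    eLpNorm f 2 μ ^ 2 = ∫⁻ x, ‖f x‖ₑ ^ 2 ∂μ := by
  have := eLpNorm_nnreal_pow_eq_lintegral (f := f) (μ := μ) (p := 2) two_ne_zero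
  simpa using this

lemma sobolevNorm_sq {σ : ℝ} {g : Plane → V} (hg : Integrable g) :
    sobolevNorm σ g ^ 2
      = ∫⁻ ξ, (ENNReal.ofReal (bracket σ ξ) * ‖planeFourier g ξ‖ₑ) ^ 2 := by
  rw [sobolevNorm, if_pos hg, eLpNorm_two_sq]
  refine lintegral_congr fun ξ => ?_
  rw [enorm_smul, ← ofReal_norm (((1 + ‖ξ‖ ^ 2) ^ (σ / 2) : ℝ) : ℂ), Complex.norm_real,
    Real.norm_of_nonneg (by positivity)]
  rfl

lemma integrable_cexp_smul {g : Plane → V} (hg : Integrable g) (ξ : Plane) :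
    Integrable fun x : Plane => Complex.exp (-(Complex.I * ((inner ℝ x ξ : ℝ) : ℂ))) • g x := by
  refine hg.bdd_smul 1 (Continuous.aestronglyMeasurable (f := fun x : Plane =>
    Complex.exp (-(Complex.I * ((inner ℝ x ξ : ℝ) : ℂ)))) (by fun_prop)) (ae_of_all _ fun x => ?_)
  rw [show -(Complex.I * ((inner ℝ x ξ : ℝ) : ℂ)) = ((-inner ℝ x ξ : ℝ) : ℂ) * Complex.I by
    push_cast; ring, Complex.norm_exp_ofReal_mul_I]

lemma planeFourier_sub {g h : Plane → V} (hg : Integrable g) (hh : Integrable h) (ξ : Plane) :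
    planeFourier g ξ - planeFourier h ξ = planeFourier (fun x => g x - h x) ξ := by
  rw [planeFourier, planeFourier, planeFourier, ← smul_sub, ← integral_sub (integrable_cexp_smul hg ξ)
    (integrable_cexp_smul hh ξ)]
  simp_rw [smul_sub]

/-- Lower semicontinuity of the Sobolev norm under convergence in `L¹`. -/
lemma sobolevNorm_sq_le_liminf {σ : ℝ} {h : Plane → V} {H : ℕ → Plane → V} (hh : Integrable h)
    (hH : ∀ n, Integrable (H n))
    (hlim : Tendsto (fun n => eLpNorm (fun x => H n x - h x) 1 volume) atTop (𝓝 0)) :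
    sobolevNorm σ h ^ 2 ≤ liminf (fun n => sobolevNorm σ (H n) ^ 2) atTop := by
  have hpt : ∀ ξ, Tendsto (fun n => planeFourier (H n) ξ) atTop (𝓝 (planeFourier h ξ)) := by
    intro ξ
    rw [tendsto_iff_norm_sub_tendsto_zero]
    have h0 : Tendsto (fun n => (2 * Real.pi)⁻¹ * ∫ x, ‖H n x - h x‖) atTop (𝓝 0) := by
      have h1 : ∀ n, ∫ x, ‖H n x - h x‖ = (eLpNorm (fun x => H n x - h x) 1 volume).toReal := by
        intro n
        rw [eLpNorm_one_eq_lintegral_enorm]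
        exact integral_norm_eq_lintegral_enorm ((hH n).sub hh).aestronglyMeasurable
      simp_rw [h1]
      simpa using ((ENNReal.tendsto_toReal ENNReal.zero_ne_top).comp hlim).const_mul
        ((2 * Real.pi)⁻¹)
    refine squeeze_zero (fun _ => norm_nonneg _) (fun n => ?_) h0
    rw [planeFourier_sub (hH n) hh]
    exact norm_planeFourier_le _ _
  rw [sobolevNorm_sq hh]
  simp_rw [sobolevNorm_sq (hH _)]
  refine le_trans (lintegral_mono fun ξ => ?_) (lintegral_liminf_le fun n => ?_)
  · refine le_of_eq (Tendsto.liminf_eq ?_).symm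
    have := (hpt ξ).enorm
    exact (ENNReal.continuous_pow 2).tendsto _ |>.comp
      (ENNReal.Tendsto.const_mul this (Or.inr ENNReal.ofReal_ne_top))
  · exact ((continuous_bracket σ).measurable.ennreal_ofReal.mul
      (continuous_planeFourier (hH n)).enorm.measurable).pow_const 2

lemma sobolevNorm_mul_schwartz_sq_le {s : ℝ} (hs : 1 / 2 < s) {f : Plane → ℂ} (hf : Integrable f)
    (φ : 𝓢(Plane, ℂ)) :
    sobolevNorm (-s) (fun x => f x * φ x) ^ 2
      ≤ 32 * (∫⁻ ξ, ENNReal.ofReal (bracket (-(s + 1 / 2)) ξ) ^ 2) * sobolevNorm (-(1 / 2)) f ^ 2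
        * ∫⁻ ξ, ENNReal.ofReal (1 + ‖ξ‖ ^ 2) * ‖planeFourier φ ξ‖ₑ ^ 2 := by
  have hπ : (1 : ℝ) ≤ 2 * Real.pi := by linarith [Real.pi_gt_three]
  have hfφ : Integrable (fun x => f x * φ x) :=
    hf.mul_bdd (c := ‖φ.toBoundedContinuousFunction‖) φ.continuous.aestronglyMeasurable
      (ae_of_all _ φ.toBoundedContinuousFunction.norm_coe_le_norm)
  rw [sobolevNorm_sq hfφ, sobolevNorm_sq hf]
  have hpt : ∀ ξ, ‖planeFourier (fun x => f x * φ x) ξ‖ₑ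
      ≤ ∫⁻ η, ‖planeFourier f η‖ₑ * ‖planeFourier φ (ξ - η)‖ₑ := by
    intro ξ
    rw [planeFourier_mul hf, enorm_mul]
    have h1 : ‖((2 * Real.pi : ℝ) : ℂ)⁻¹‖ₑ ≤ 1 := by
      rw [← ofReal_norm, norm_inv, Complex.norm_real, Real.norm_of_nonneg (by positivity)]
      exact ENNReal.ofReal_le_one.2 (inv_le_one_of_one_le₀ hπ)
    refine (mul_le_of_le_one_left zero_le h1).trans ((enorm_integral_le_lintegral_enorm _).trans_eq ?_)
    rw [← lintegral_sub_left_eq_self _ ξ]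
    refine lintegral_congr fun η => ?_
    rw [enorm_mul, sub_sub_cancel, mul_comm]
  refine (lintegral_mono fun ξ => pow_le_pow_left' (mul_le_mul_right (hpt ξ) _) 2).trans ?_
  refine (lintegral_weighted_conv_le hs (continuous_planeFourier hf).enorm.measurable
    (continuous_planeFourier φ.integrable).enorm.measurable).trans_eq ?_
  congr 1
  refine lintegral_congr fun ξ => ?_
  rw [mul_pow, ← ENNReal.ofReal_pow (bracket_pos _ _).le, bracket_sq, bracket]
  norm_num

end SobolevProduct

/-! ### Poincaré's inequality and multiplication by functions of `W^{1,2}_0(Ω)` -/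

section Poincare

lemma norm_fderiv_le_sum_pderiv (φ : Plane → ℝ) (x : Plane) :
    ‖fderiv ℝ φ x‖ ≤ ∑ j, |pderiv j φ x| := by
  refine ContinuousLinearMap.opNorm_le_bound _ (by positivity) fun v => ?_
  have hv : v = ∑ j, v j • (EuclideanSpace.single j (1 : ℝ) : Plane) := by
    ext i; fin_cases i <;> simp
  conv_lhs => rw [hv]
  rw [map_sum, Finset.sum_mul]
  refine (norm_sum_le _ _).trans (Finset.sum_le_sum fun j _ => ?_)
  rw [map_smul, norm_smul, mul_comm]
  exact mul_le_mul_of_nonneg_left (PiLp.norm_apply_le v j) (abs_nonneg _)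

/-- The constant of the Poincaré inequality on `Ω`. -/
noncomputable def poincareConst (Ω : Set Plane) : ℝ≥0∞ :=
  2 * (eLpNormLESNormFDerivOneConst (volume : Measure Plane) 2) ^ 2 * volume Ω

lemma poincareConst_ne_top {Ω : Set Plane} (hΩ : volume Ω ≠ ⊤) : poincareConst Ω ≠ ⊤ :=
  ENNReal.mul_ne_top (by finiteness) hΩ

/-- Poincaré's inequality on `C_0^∞(Ω)`, as a consequence of the Gagliardo-Nirenberg-Sobolev
inequality `‖φ‖_{L²} ≤ C ‖∇φ‖_{L¹}` in the plane. -/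
lemma lintegral_sq_le_poincareConst_mul {Ω : Set Plane} (hΩ : MeasurableSet Ω) {φ : Plane → ℝ}
    (hφ : ContDiff ℝ ∞ φ) (hc : HasCompactSupport φ) (hs : tsupport φ ⊆ Ω) :
    ∫⁻ x, ‖φ x‖ₑ ^ 2 ≤ poincareConst Ω * ∑ j, ∫⁻ x, ‖pderiv j φ x‖ₑ ^ 2 := by
  have hfin : (Module.finrank ℝ Plane : ℝ≥0).HolderConjugate 2 := by
    rw [finrank_euclideanSpace, Fintype.card_fin]
    exact NNReal.HolderConjugate.two_two
  have h1 := eLpNorm_le_eLpNorm_fderiv_one (volume : Measure Plane)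
    (hφ.of_le (by norm_cast)) hc hfin
  have hdcont : ∀ j, Continuous (pderiv j φ) := fun j =>
    (hφ.continuous_fderiv (by simp)).clm_apply continuous_const
  have hzero : ∀ x, x ∉ Ω → fderiv ℝ φ x = 0 := fun x hx =>
    fderiv_of_notMem_tsupport ℝ fun h => hx (hs h)
  have h2 : eLpNorm (fderiv ℝ φ) 1 volume ^ 2
      ≤ volume Ω * (2 * ∑ j, ∫⁻ x, ‖pderiv j φ x‖ₑ ^ 2) := by
    have hfc : Continuous (fderiv ℝ φ) := hφ.continuous_fderiv (by simp)
    rw [eLpNorm_one_eq_lintegral_enorm]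
    have h3 : ∫⁻ x, ‖fderiv ℝ φ x‖ₑ = ∫⁻ x in Ω, 1 * ‖fderiv ℝ φ x‖ₑ := by
      rw [← lintegral_indicator hΩ]
      refine lintegral_congr fun x => ?_
      by_cases hx : x ∈ Ω
      · rw [indicator_of_mem hx, one_mul]
      · rw [indicator_of_notMem hx, ← ofReal_norm, hzero x hx, norm_zero, ENNReal.ofReal_zero]
    rw [h3]
    refine (lintegral_mul_sq_le _ aemeasurable_const hfc.enorm.measurable.aemeasurable).trans ?_
    simp only [one_pow, lintegral_const, Measure.restrict_apply_univ, one_mul]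
    gcongr
    refine (setLIntegral_le_lintegral _ _).trans ?_
    rw [Fin.sum_univ_two, ← lintegral_add_left ((hdcont 0).enorm.measurable.pow_const 2),
      ← lintegral_const_mul' _ _ (by norm_num)]
    refine lintegral_mono fun x => ?_
    have hn := norm_fderiv_le_sum_pderiv φ x
    rw [Fin.sum_univ_two] at hn
    have : ‖fderiv ℝ φ x‖ ^ 2 ≤ 2 * (‖pderiv 0 φ x‖ ^ 2 + ‖pderiv 1 φ x‖ ^ 2) := by
      rw [Real.norm_eq_abs (pderiv 0 φ x), Real.norm_eq_abs (pderiv 1 φ x)]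
      nlinarith [norm_nonneg (fderiv ℝ φ x), sq_nonneg (|pderiv 0 φ x| - |pderiv 1 φ x|)]
    have h4 := ENNReal.ofReal_le_ofReal this
    rw [ENNReal.ofReal_mul zero_le_two, ENNReal.ofReal_add (by positivity) (by positivity)] at h4
    simpa only [ENNReal.ofReal_pow (norm_nonneg _), ofReal_norm, ENNReal.ofReal_ofNat] using h4
  have h5 : eLpNorm φ 2 volume ^ 2 ≤ _ := pow_le_pow_left' (by exact_mod_cast h1) 2
  rw [eLpNorm_two_sq, mul_pow] at h5
  refine h5.trans ((mul_le_mul_right h2 _).trans_eq ?_)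
  rw [poincareConst]
  ring

end Poincare

section ProductSobolev

/-- The constant of the product estimate `H^{-1/2} · H^1 ⊆ H^{-s}`. -/
noncomputable def productConst (s : ℝ) : ℝ≥0∞ :=
  32 * ∫⁻ ξ, ENNReal.ofReal (bracket (-(s + 1 / 2)) ξ) ^ 2

lemma productConst_ne_top {s : ℝ} (hs : 1 / 2 < s) : productConst s ≠ ⊤ :=
  ENNReal.mul_ne_top (by norm_num) (lintegral_bracket_lt_top hs).ne

lemma sobolevNorm_mul_smooth_sq_le {Ω : Set Plane} (hΩ : MeasurableSet Ω) {s : ℝ}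
    (hs : 1 / 2 < s) {f : Plane → ℝ} (hf : Integrable f) {φ : Plane → ℝ} (hφ : ContDiff ℝ ∞ φ)
    (hc : HasCompactSupport φ) (hsupp : tsupport φ ⊆ Ω) :
    sobolevNorm (-s) (fun x => ((f x * φ x : ℝ) : ℂ)) ^ 2
      ≤ productConst s * sobolevNorm (-(1 / 2)) (fun x => (f x : ℂ)) ^ 2 *
        ((1 + poincareConst Ω) * ∑ j, eLpNorm (pderiv j φ) 2 (volume.restrict Ω) ^ 2) := by
  have hc' : HasCompactSupport (fun x => (φ x : ℂ)) :=
    hc.comp_left (g := fun r : ℝ => (r : ℂ)) Complex.ofReal_zero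
  have hφ' : ContDiff ℝ ∞ (fun x => (φ x : ℂ)) := Complex.ofRealCLM.contDiff.comp hφ
  set Φ : 𝓢(Plane, ℂ) := hc'.toSchwartzMap hφ' with hΦ
  have hΦa : ∀ x, Φ x = (φ x : ℂ) := fun x => rfl
  have hd : ∀ (j : Fin 2) x, (LineDeriv.lineDerivOp (EuclideanSpace.single j (1 : ℝ) : Plane) Φ : 𝓢(Plane, ℂ)) x
      = ((pderiv j φ x : ℝ) : ℂ) := by
    intro j x
    rw [SchwartzMap.lineDerivOp_apply_eq_fderiv]
    have h1 : HasFDerivAt (fun x => (φ x : ℂ)) (Complex.ofRealCLM.comp (fderiv ℝ φ x)) x :=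
      Complex.ofRealCLM.hasFDerivAt.comp x (hφ.differentiable (by simp) x).hasFDerivAt
    have h2 : fderiv ℝ (Φ : Plane → ℂ) x = Complex.ofRealCLM.comp (fderiv ℝ φ x) := h1.fderiv
    rw [h2]
    rfl
  have h := sobolevNorm_mul_schwartz_sq_le hs (hf.ofReal (𝕜 := ℂ)) Φ
  have h1 : (fun x => ((f x * φ x : ℝ) : ℂ)) = fun x => (f x : ℂ) * Φ x := by
    ext x; rw [hΦa]; push_cast; rfl
  rw [h1]
  refine h.trans ?_
  rw [productConst]
  refine mul_le_mul_right ?_ _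
  have hen : ∀ r : ℝ, ‖(r : ℂ)‖ₑ = ‖r‖ₑ := fun r => by
    rw [← ofReal_norm, ← ofReal_norm, Complex.norm_real]
  rw [lintegral_bracket_mul_planeFourier_sq]
  simp_rw [hd, hΦa, hen]
  have h2 : ∀ j, ∫⁻ x, ‖pderiv j φ x‖ₑ ^ 2 = eLpNorm (pderiv j φ) 2 (volume.restrict Ω) ^ 2 := by
    intro j
    rw [eLpNorm_two_sq, ← lintegral_indicator hΩ]
    refine lintegral_congr fun x => ?_
    by_cases hx : x ∈ Ω
    · rw [indicator_of_mem hx]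
    · rw [indicator_of_notMem hx, pderiv, fderiv_of_notMem_tsupport ℝ fun h => hx (hsupp h)]
      simp
  have hP := lintegral_sq_le_poincareConst_mul hΩ hφ hc hsupp
  simp_rw [← h2]
  rw [add_mul, one_mul, add_comm]
  gcongr

/-- Multiplication by a function of class `W^{1,2}_0(Ω)` maps `H^{-1/2}` into `H^{-s}`,
`s > 1/2`. -/
lemma sobolevNorm_mul_sq_le {Ω : Set Plane} (hΩ : MeasurableSet Ω) (hΩv : volume Ω ≠ ⊤) {s : ℝ}
    (hs : 1 / 2 < s) {f : Plane → ℝ} (hf : Integrable f) (hf2 : MemLp f 2)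
    (hf0 : ∀ x, x ∉ Ω → f x = 0)
    (hfin : sobolevNorm (-(1 / 2)) (fun x => (f x : ℂ)) ≠ ⊤)
    {v : Plane → ℝ} {Dv : Fin 2 → Plane → ℝ} (hv : MemW120 Ω v Dv) :
    Integrable (fun x => f x * v x) ∧
    sobolevNorm (-s) (fun x => ((f x * v x : ℝ) : ℂ)) ^ 2
      ≤ productConst s * sobolevNorm (-(1 / 2)) (fun x => (f x : ℂ)) ^ 2 *
        ((1 + poincareConst Ω) * ∑ j, eLpNorm (Dv j) 2 (volume.restrict Ω) ^ 2) := by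
  obtain ⟨hv2, hDv2, φ, hφ, hlim, hDlim⟩ := hv
  have hf2Ω : MemLp f 2 (volume.restrict Ω) := hf2.restrict Ω
  have hzero : ∀ (w : Plane → ℝ) x, x ∉ Ω → f x * w x = 0 := fun w x hx => by
    rw [hf0 x hx, zero_mul]
  have hint : ∀ w : Plane → ℝ, MemLp w 2 (volume.restrict Ω) → Integrable (fun x => f x * w x) := by
    intro w hw
    have : IntegrableOn (fun x => f x * w x) Ω := hf2Ω.integrable_mul hw
    refine (integrableOn_iff_integrable_of_support_subset fun x hx => ?_).1 this
    by_contra h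
    exact hx (hzero w x h)
  have hφ2 : ∀ n, MemLp (φ n) 2 (volume.restrict Ω) := fun n =>
    ((hφ n).1.continuous.memLp_of_hasCompactSupport (hφ n).2.1).restrict Ω
  refine ⟨hint v hv2, ?_⟩
  have hL1 : Tendsto (fun n => eLpNorm (fun x => ((f x * φ n x : ℝ) : ℂ) - ((f x * v x : ℝ) : ℂ)) 1
      volume) atTop (𝓝 0) := by
    have hub : Tendsto (fun n => eLpNorm f 2 (volume.restrict Ω)
        * eLpNorm (fun x => v x - φ n x) 2 (volume.restrict Ω)) atTop (𝓝 0) := by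
      simpa using ENNReal.Tendsto.const_mul hlim (Or.inr hf2Ω.eLpNorm_ne_top)
    refine tendsto_of_tendsto_of_tendsto_of_le_of_le tendsto_const_nhds hub (fun _ => zero_le)
      fun n => ?_
    have h1 : eLpNorm (fun x => ((f x * φ n x : ℝ) : ℂ) - ((f x * v x : ℝ) : ℂ)) 1 volume
        = eLpNorm (f • fun x => v x - φ n x) 1 (volume.restrict Ω) := by
      rw [eLpNorm_one_eq_lintegral_enorm, eLpNorm_one_eq_lintegral_enorm,
        ← lintegral_indicator hΩ]
      refine lintegral_congr fun x => ?_
      by_cases hx : x ∈ Ω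
      · rw [indicator_of_mem hx, ← Complex.ofReal_sub, ← ofReal_norm, ← ofReal_norm,
          Complex.norm_real, ← mul_sub, ← norm_neg, ← mul_neg, neg_sub]
        rfl
      · rw [indicator_of_notMem hx, hzero _ x hx, hzero _ x hx]
        simp
    rw [h1]
    exact eLpNorm_smul_le_mul_eLpNorm (hv2.sub (hφ2 n)).aestronglyMeasurable
      hf2Ω.aestronglyMeasurable
  refine (sobolevNorm_sq_le_liminf (hint v hv2).ofReal (fun n => (hint _ (hφ2 n)).ofReal) hL1).trans ?_
  set P := productConst s * sobolevNorm (-(1 / 2)) (fun x => (f x : ℂ)) ^ 2 with hP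
  have hPt : P ≠ ⊤ := ENNReal.mul_ne_top (productConst_ne_top hs) (ENNReal.pow_ne_top hfin)
  have hCt : 1 + poincareConst Ω ≠ ⊤ := ENNReal.add_ne_top.2 ⟨ENNReal.one_ne_top, poincareConst_ne_top hΩv⟩
  have hlimU : Tendsto (fun n => P * ((1 + poincareConst Ω) * ∑ j,
      (eLpNorm (Dv j) 2 (volume.restrict Ω)
        + eLpNorm (fun x => Dv j x - pderiv j (φ n) x) 2 (volume.restrict Ω)) ^ 2)) atTop
      (𝓝 (P * ((1 + poincareConst Ω) * ∑ j, eLpNorm (Dv j) 2 (volume.restrict Ω) ^ 2))) := by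
    refine ENNReal.Tendsto.const_mul (ENNReal.Tendsto.const_mul (tendsto_finsetSum _ fun j _ => ?_)
      (Or.inr hCt)) (Or.inr hPt)
    have := (tendsto_const_nhds (x := eLpNorm (Dv j) 2 (volume.restrict Ω))).add (hDlim j)
    rw [add_zero] at this
    exact (ENNReal.continuous_pow 2).tendsto _ |>.comp this
  rw [← hlimU.liminf_eq]
  refine liminf_le_liminf (Eventually.of_forall fun n => ?_)
  refine (sobolevNorm_mul_smooth_sq_le hΩ hs hf (hφ n).1 (hφ n).2.1 (hφ n).2.2).trans ?_
  gcongr with j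
  have hdm : AEStronglyMeasurable (pderiv j (φ n)) (volume.restrict Ω) :=
    (((hφ n).1.continuous_fderiv (by simp)).clm_apply continuous_const).aestronglyMeasurable
  calc eLpNorm (pderiv j (φ n)) 2 (volume.restrict Ω)
      = eLpNorm (Dv j - fun x => Dv j x - pderiv j (φ n) x) 2 (volume.restrict Ω) := by
        congr 1; ext x; simp
    _ ≤ _ := eLpNorm_sub_le (hDv2 j).aestronglyMeasurable
        ((hDv2 j).aestronglyMeasurable.sub hdm) one_le_two

end ProductSobolev

/-! ### Testing the balance laws -/

section Testing

lemma IsCutoff.eq_zero_of_notMem {Ω : Set Plane} {ζ : Plane → ℝ} (hζ : IsCutoff Ω ζ) {x : Plane}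
    (hx : x ∉ Ω) : ζ x = 0 :=
  image_eq_zero_of_notMem_tsupport fun h => hx (hζ.support h)

lemma IsCutoff.continuous_pderiv {Ω : Set Plane} {ζ : Plane → ℝ} (hζ : IsCutoff Ω ζ) (j : Fin 2) :
    Continuous (pderiv j ζ) :=
  (hζ.smooth.continuous_fderiv (by simp)).clm_apply continuous_const

/-- The momentum balance tested with `χ(t) ζ(x) Φ(t,x) e`. -/
lemma MomentumBalance.tested {Ω : Set Plane} {T ν₁ ν₂ ε γ : ℝ} {ρ₀ : Plane → ℝ}
    {u₀ : Plane → Plane} {f : ℝ → Plane → Plane} {ρ : ℝ → Plane → ℝ} {u : ℝ → Plane → Plane}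
    {Du : ℝ → Plane → Fin 2 → Fin 2 → ℝ} (h : MomentumBalance Ω T ν₁ ν₂ ε γ ρ₀ u₀ f ρ u Du)
    (hΩ : IsOpen Ω) {ζ : Plane → ℝ} (hζ : IsCutoff Ω ζ) {χ : ℝ → ℝ} (hχ : ContDiff ℝ ∞ χ)
    (hχT : χ T = 0) {Φ : ℝ × Plane → ℝ} (hΦ : ContDiff ℝ ∞ Φ) (e : Plane) :
    (∫ z in spaceTime Ω T, ρ z.1 z.2 * (inner ℝ (u z.1 z.2) e
        * (deriv χ z.1 * ζ z.2 * Φ z + χ z.1 * ζ z.2 * fderiv ℝ Φ z (1, 0)))) +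
    (∫ z in spaceTime Ω T, ∑ i, ∑ j,
      (ρ z.1 z.2 * u z.1 z.2 i * u z.1 z.2 j
        + pressure ε γ (ρ z.1 z.2) * (if i = j then 1 else 0)
        - stress ν₁ ν₂ (Du z.1 z.2) i j) * (e i * (χ z.1 * (pderiv j ζ z.2 * Φ z
          + ζ z.2 * fderiv ℝ Φ z (0, EuclideanSpace.single j 1))))) +
    (∫ z in spaceTime Ω T, ρ z.1 z.2 * (inner ℝ (f z.1 z.2) e * (χ z.1 * ζ z.2 * Φ z))) +
    (∫ x in Ω, ρ₀ x * (inner ℝ (u₀ x) e * (χ 0 * ζ x * Φ (0, x)))) = 0 := by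
  have hξ : IsMomentumTest Ω T (fun t x => (χ t * ζ x * Φ (t, x)) • e) := by
    refine ⟨?_, fun x _ => by simp [hχT], fun t _ x hx => ?_⟩
    · have h1 : ContDiff ℝ ∞ (fun z : ℝ × Plane => ζ z.2) := hζ.smooth.comp contDiff_snd
      have h2 : ContDiff ℝ ∞ (fun z : ℝ × Plane => χ z.1) := hχ.comp contDiff_fst
      exact ((h2.mul h1).mul hΦ).smul contDiff_const
    · have : x ∉ Ω := fun hxΩ => by
        rw [hΩ.frontier_eq] at hx
        exact hx.2 hxΩ
      simp [hζ.eq_zero_of_notMem this]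
  have hΦd : Differentiable ℝ Φ := hΦ.differentiable (by simp)
  have ht : ∀ (t : ℝ) (x : Plane), deriv (fun τ => (χ τ * ζ x * Φ (τ, x)) • e) t
      = (deriv χ t * ζ x * Φ (t, x) + χ t * ζ x * fderiv ℝ Φ (t, x) (1, 0)) • e := by
    intro t x
    have h1 : HasDerivAt χ (deriv χ t) t := (hχ.differentiable (by simp) t).hasDerivAt
    have h2 : HasDerivAt (fun τ : ℝ => Φ (τ, x)) (fderiv ℝ Φ (t, x) (1, 0)) t :=
      (hΦd (t, x)).hasFDerivAt.comp_hasDerivAt t ((hasDerivAt_id t).prodMk (hasDerivAt_const t x))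
    exact (((h1.mul_const (ζ x)).mul h2).smul_const e).deriv
  have hx : ∀ (t : ℝ) (x : Plane) (i j : Fin 2),
      pderiv j (fun y => ((χ t * ζ y * Φ (t, y)) • e) i) x
      = e i * (χ t * (pderiv j ζ x * Φ (t, x)
          + ζ x * fderiv ℝ Φ (t, x) (0, EuclideanSpace.single j 1))) := by
    intro t x i j
    have h1 : HasFDerivAt ζ (fderiv ℝ ζ x) x := (hζ.smooth.differentiable (by simp) x).hasFDerivAt
    have h2 : HasFDerivAt (fun y : Plane => Φ (t, y))
        ((fderiv ℝ Φ (t, x)).comp ((0 : Plane →L[ℝ] ℝ).prod (ContinuousLinearMap.id ℝ Plane))) x :=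
      (hΦd (t, x)).hasFDerivAt.comp x ((hasFDerivAt_const t x).prodMk (hasFDerivAt_id x))
    have h3 := (((h1.const_mul (χ t)).mul h2).mul_const (e i)).fderiv
    have h4 : (fun y => ((χ t * ζ y * Φ (t, y)) • e) i)
        = fun y => χ t * ζ y * Φ (t, y) * e i := by
      ext y; simp
    rw [pderiv, h4]
    have h5 := congrArg (fun A : Plane →L[ℝ] ℝ => A (EuclideanSpace.single j 1)) h3
    refine h5.trans ?_
    simp [pderiv]
    ring
  have := h _ hξ
  simp only [ht, hx, real_inner_smul_right] at this
  refine Eq.trans ?_ this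
  congr 1
  · congr 1
    · congr 1
      refine integral_congr_ae (ae_of_all _ fun z => ?_)
      dsimp only
      ring
    · refine integral_congr_ae (ae_of_all _ fun z => ?_)
      dsimp only
      ring
  · refine integral_congr_ae (ae_of_all _ fun z => ?_)
    dsimp only
    ring

lemma isRenormalization_id : IsRenormalization (fun r => r) := by
  have h1 : ∀ r : ℝ, 0 ≤ r → derivWithin (fun r : ℝ => r) (Ici 0) r = 1 := fun r hr =>
    (hasDerivWithinAt_id r _).derivWithin (uniqueDiffOn_Ici 0 r hr)
  refine ⟨contDiff_id.contDiffOn, 2, fun r hr => ?_⟩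
  have h2 : iteratedDerivWithin 2 (fun r : ℝ => r) (Ici 0) r = 0 := by
    rw [iteratedDerivWithin_succ]
    have h3 : derivWithin (iteratedDerivWithin 1 (fun r : ℝ => r) (Ici 0)) (Ici 0) r
        = derivWithin (fun _ => (1 : ℝ)) (Ici 0) r :=
      derivWithin_congr (fun x hx => by rw [iteratedDerivWithin_one, h1 x hx])
        (by rw [iteratedDerivWithin_one, h1 r hr])
    rw [h3, derivWithin_fun_const, Pi.zero_apply]
  rw [h1 r hr, h2, one_mul, zero_mul, abs_zero, add_zero, abs_of_nonneg hr]
  nlinarith [sq_nonneg (r - 1)]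

/-- The mass balance tested with `ζ(y) κ(t - s, x - y)` as a function of `(s, y)`. -/
lemma RenormalizedMassBalance.tested {Ω : Set Plane} {T : ℝ} {ρ₀ : Plane → ℝ}
    {ρ : ℝ → Plane → ℝ} {u : ℝ → Plane → Plane} {Du : ℝ → Plane → Fin 2 → Fin 2 → ℝ}
    (h : RenormalizedMassBalance Ω T ρ₀ ρ u Du)
    (hρ : ∀ᵐ z ∂(volume.restrict (spaceTime Ω T)), 0 ≤ ρ z.1 z.2)
    {ζ : Plane → ℝ} (hζ : IsCutoff Ω ζ)
    {κ : ℝ × Plane → ℝ} (hκ : ContDiff ℝ ∞ κ) (z : ℝ × Plane) {δ : ℝ} (hδ : 0 < δ)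
    (hz : ∀ s ∈ Ioc (T - δ) T, ∀ y, κ (z.1 - s, y) = 0) :
    (∫ w in spaceTime Ω T, (ρ w.1 w.2 * -(ζ w.2 * fderiv ℝ κ (z - w) (1, 0))
        + ρ w.1 w.2 * ∑ j, u w.1 w.2 j * (pderiv j ζ w.2 * κ (z - w)
          - ζ w.2 * fderiv ℝ κ (z - w) (0, EuclideanSpace.single j 1)))) +
    (∫ y in Ω, ζ y * κ (z.1, z.2 - y) * ρ₀ y) = 0 := by
  have hψ : IsMassTest Ω T (fun s y => ζ y * κ (z.1 - s, z.2 - y)) := by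
    refine ⟨?_, δ, hδ, fun s hs y _ => by rw [hz s hs, mul_zero]⟩
    have h1 : ContDiff ℝ ∞ (fun z : ℝ × Plane => ζ z.2) := hζ.smooth.comp contDiff_snd
    exact h1.mul (hκ.comp (contDiff_const.sub contDiff_id))
  have hκd : Differentiable ℝ κ := hκ.differentiable (by simp)
  have ht : ∀ (s : ℝ) (y : Plane), deriv (fun τ => ζ y * κ (z.1 - τ, z.2 - y)) s
      = -(ζ y * fderiv ℝ κ (z.1 - s, z.2 - y) (1, 0)) := by
    intro s y
    have h2 : HasDerivAt (fun τ : ℝ => κ (z.1 - τ, z.2 - y))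
        (fderiv ℝ κ (z.1 - s, z.2 - y) (-1, 0)) s :=
      (hκd _).hasFDerivAt.comp_hasDerivAt s
        (((hasDerivAt_id s).const_sub z.1).prodMk (hasDerivAt_const s _))
    rw [(h2.const_mul (ζ y)).deriv]
    have : ((-1 : ℝ), (0 : Plane)) = -(1, 0) := by simp
    rw [this, map_neg]
    ring
  have hx : ∀ (s : ℝ) (y : Plane) (j : Fin 2),
      pderiv j (fun y => ζ y * κ (z.1 - s, z.2 - y)) y
      = pderiv j ζ y * κ (z.1 - s, z.2 - y)
        - ζ y * fderiv ℝ κ (z.1 - s, z.2 - y) (0, EuclideanSpace.single j 1) := by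
    intro s y j
    have h1 : HasFDerivAt ζ (fderiv ℝ ζ y) y := (hζ.smooth.differentiable (by simp) y).hasFDerivAt
    have h2 : HasFDerivAt (fun y : Plane => κ (z.1 - s, z.2 - y))
        ((fderiv ℝ κ (z.1 - s, z.2 - y)).comp
          ((0 : Plane →L[ℝ] ℝ).prod (-ContinuousLinearMap.id ℝ Plane))) y :=
      (hκd _).hasFDerivAt.comp y
        ((hasFDerivAt_const (z.1 - s) y).prodMk ((hasFDerivAt_id y).const_sub z.2))
    have h3 := (h1.mul h2).fderiv
    have h5 := congrArg (fun A : Plane →L[ℝ] ℝ => A (EuclideanSpace.single j 1)) h3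
    refine h5.trans ?_
    have h6 : ((0 : ℝ), -(EuclideanSpace.single j 1 : Plane)) = -(0, EuclideanSpace.single j 1) := by
      rw [Prod.neg_mk, neg_zero]
    have h7 : fderiv ℝ κ (z.1 - s, z.2 - y) (0, -(EuclideanSpace.single j 1 : Plane))
        = -fderiv ℝ κ (z.1 - s, z.2 - y) (0, EuclideanSpace.single j 1) := by
      rw [h6, map_neg]
    change ζ y * fderiv ℝ κ (z.1 - s, z.2 - y) (0, -(EuclideanSpace.single j 1 : Plane))
      + κ (z.1 - s, z.2 - y) * pderiv j ζ y = _
    rw [h7]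
    ring
  have := h _ hψ _ isRenormalization_id
  simp only [ht, hx, sub_zero] at this
  refine Eq.trans ?_ this
  congr 1
  refine integral_congr_ae ?_
  filter_upwards [hρ] with w hw
  have h1 : derivWithin (fun r : ℝ => r) (Ici 0) (ρ w.1 w.2) = 1 :=
    (hasDerivWithinAt_id _ _).derivWithin (uniqueDiffOn_Ici 0 _ hw)
  rw [h1, one_mul, sub_self, mul_zero, zero_mul, sub_zero]
  rfl

end Testing

/-! ### The space-time kernel of the test fields -/

section Kernels

/-- The odd primitive of the Gaussian kernel. -/
noncomputable def gaussPrimitive (b τ : ℝ) : ℝ := ∫ s in (0 : ℝ)..τ, gaussKernel b s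

lemma hasDerivAt_gaussPrimitive (b τ : ℝ) :
    HasDerivAt (gaussPrimitive b) (gaussKernel b τ) τ :=
  intervalIntegral.integral_hasDerivAt_right
    ((continuous_gaussKernel b).intervalIntegrable _ _)
    (continuous_gaussKernel b).stronglyMeasurable.stronglyMeasurableAtFilter
    (continuous_gaussKernel b).continuousAt

lemma contDiff_gaussPrimitive (b : ℝ) : ContDiff ℝ ∞ (gaussPrimitive b) := by
  rw [contDiff_infty_iff_deriv]
  refine ⟨fun τ => (hasDerivAt_gaussPrimitive b τ).differentiableAt, ?_⟩
  have : deriv (gaussPrimitive b) = gaussKernel b := by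
    ext τ; exact (hasDerivAt_gaussPrimitive b τ).deriv
  rw [this]
  exact contDiff_gaussKernel b

lemma abs_gaussPrimitive_le {b : ℝ} (hb : 0 < b) (τ : ℝ) : |gaussPrimitive b τ| ≤ 1 := by
  rw [gaussPrimitive, ← Real.norm_eq_abs]
  refine intervalIntegral.norm_integral_le_integral_norm_uIoc.trans ?_
  rw [← integral_gaussKernel hb]
  refine (setIntegral_le_integral (integrable_gaussKernel hb).norm
    (ae_of_all _ fun _ => norm_nonneg _)).trans_eq ?_
  congr 1; ext s
  exact Real.norm_of_nonneg (gaussKernel_nonneg _ _)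

/-- A compactly supported function on the plane which is the primitive `gaussPrimitive b ⟪e, x⟫`
of the strip kernel near the origin. -/
noncomputable def stripPotential (b : ℝ) (e : Plane) (η : ContDiffBump (0 : Plane)) (x : Plane) : ℝ :=
  gaussPrimitive b (inner ℝ e x) * η x

variable {b : ℝ} {e : Plane} {η : ContDiffBump (0 : Plane)}

lemma contDiff_stripPotential : ContDiff ℝ ∞ (stripPotential b e η) :=
  ((contDiff_gaussPrimitive b).comp (contDiff_const.inner ℝ contDiff_id)).mul η.contDiff

lemma hasCompactSupport_stripPotential : HasCompactSupport (stripPotential b e η) :=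
  η.hasCompactSupport.mul_left

lemma abs_stripPotential_le (hb : 0 < b) (x : Plane) : |stripPotential b e η x| ≤ 1 := by
  rw [stripPotential, abs_mul, abs_of_nonneg η.nonneg]
  exact mul_le_one₀ (abs_gaussPrimitive_le hb _) η.nonneg η.le_one

lemma fderiv_stripPotential {x : Plane} (hx : ‖x‖ < η.rIn) (v : Plane) :
    fderiv ℝ (stripPotential b e η) x v = gaussKernel b (inner ℝ e x) * inner ℝ e v := by
  have h1 : stripPotential b e η =ᶠ[𝓝 x] fun y => gaussPrimitive b (inner ℝ e y) := by
    have : Metric.ball (0 : Plane) η.rIn ∈ 𝓝 x :=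
      Metric.isOpen_ball.mem_nhds (by simpa using hx)
    filter_upwards [this] with y hy
    rw [stripPotential, η.one_of_mem_closedBall (Metric.ball_subset_closedBall hy), mul_one]
  have h2 : HasFDerivAt (fun y : Plane => gaussPrimitive b (inner ℝ e y))
      (gaussKernel b (inner ℝ e x) • innerSL ℝ e) x :=
    (hasDerivAt_gaussPrimitive b _).comp_hasFDerivAt x (innerSL ℝ e).hasFDerivAt
  rw [h1.fderiv_eq, h2.fderiv]
  simp

variable {θ : ℝ → ℝ} {W : Plane → ℝ}

lemma contDiff_tensor (hθ : ContDiff ℝ ∞ θ) (hW : ContDiff ℝ ∞ W) :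
    ContDiff ℝ ∞ (fun z : ℝ × Plane => θ z.1 * W z.2) :=
  (hθ.comp contDiff_fst).mul (hW.comp contDiff_snd)

lemma hasCompactSupport_tensor (hθ : HasCompactSupport θ) (hW : HasCompactSupport W) :
    HasCompactSupport (fun z : ℝ × Plane => θ z.1 * W z.2) := by
  refine HasCompactSupport.intro (K := tsupport θ ×ˢ tsupport W) (hθ.isCompact.prod hW.isCompact)
    fun z hz => ?_
  by_cases h : z.1 ∈ tsupport θ
  · rw [image_eq_zero_of_notMem_tsupport fun h2 => hz ⟨h, h2⟩, mul_zero]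
  · rw [image_eq_zero_of_notMem_tsupport h, zero_mul]

lemma fderiv_tensor_snd (hθ : ContDiff ℝ ∞ θ) (hW : ContDiff ℝ ∞ W) (z : ℝ × Plane) (v : Plane) :
    fderiv ℝ (fun z : ℝ × Plane => θ z.1 * W z.2) z (0, v) = θ z.1 * fderiv ℝ W z.2 v := by
  have hd := ((contDiff_tensor hθ hW).differentiable (by simp) z).hasFDerivAt
  have h2 : HasFDerivAt (fun y : Plane => θ z.1 * W y)
      ((fderiv ℝ (fun z : ℝ × Plane => θ z.1 * W z.2) z).comp
        ((0 : Plane →L[ℝ] ℝ).prod (ContinuousLinearMap.id ℝ Plane))) z.2 :=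
    HasFDerivAt.comp (f := fun y : Plane => (z.1, y)) z.2 hd
      ((hasFDerivAt_const z.1 z.2).prodMk (hasFDerivAt_id z.2))
  have h3 : HasFDerivAt (fun y : Plane => θ z.1 * W y) (θ z.1 • fderiv ℝ W z.2) z.2 :=
    (hW.differentiable (by simp) z.2).hasFDerivAt.const_mul _
  have h4 := congrArg (fun A : Plane →L[ℝ] ℝ => A v) (h2.unique h3)
  simpa using h4

/-- The convolution of a density with a kernel on space-time. -/
noncomputable def stConv (g κ : ℝ × Plane → ℝ) (z : ℝ × Plane) : ℝ := ∫ w, g w * κ (z - w)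

variable {g κ : ℝ × Plane → ℝ}

lemma stConv_eq_convolution :
    stConv g κ = convolution g κ (ContinuousLinearMap.mul ℝ ℝ) volume := by
  ext z; rfl

lemma contDiff_stConv (hg : Integrable g) (hκ : ContDiff ℝ ∞ κ) (hκc : HasCompactSupport κ) :
    ContDiff ℝ ∞ (stConv g κ) := by
  rw [stConv_eq_convolution]
  exact hκc.contDiff_convolution_right _ hg.locallyIntegrable hκ

lemma fderiv_stConv (hg : Integrable g) (hκ : ContDiff ℝ ∞ κ) (hκc : HasCompactSupport κ)
    (z v : ℝ × Plane) :
    fderiv ℝ (stConv g κ) z v = ∫ w, g w * fderiv ℝ κ (z - w) v := by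
  have : (volume : Measure (ℝ × Plane)).IsAddLeftInvariant :=
    inferInstanceAs ((volume : Measure ℝ).prod (volume : Measure Plane)).IsAddLeftInvariant
  have h1 := hκc.hasFDerivAt_convolution_right (ContinuousLinearMap.mul ℝ ℝ)
    hg.locallyIntegrable (hκ.of_le (by norm_cast)) z
  rw [stConv_eq_convolution, h1.fderiv, convolution, ContinuousLinearMap.integral_apply]
  · rfl
  · have h2 := (hκc.fderiv (𝕜 := ℝ)).convolutionExists_right
      ((ContinuousLinearMap.mul ℝ ℝ).precompR (ℝ × Plane)) hg.locallyIntegrable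
      (hκ.continuous_fderiv (by simp)) z
    exact h2

end Kernels

/-! ### A priori bounds -/

section Apriori

/-- The sum of the densities of mass, kinetic energy and pressure; it dominates all nonlinear
terms of the balance laws. -/
noncomputable def totalDensity (ε γ : ℝ) (ρ : ℝ → Plane → ℝ) (u : ℝ → Plane → Plane)
    (z : ℝ × Plane) : ℝ :=
  ρ z.1 z.2 + ρ z.1 z.2 * ‖u z.1 z.2‖ ^ 2 + pressure ε γ (ρ z.1 z.2)

/-- All the bounds on the data and on the solution which enter the estimate, with a common
constant `N`. -/
structure AprioriBound (Ω : Set Plane) (T ν₁ ν₂ ε γ : ℝ) (ρ₀ : Plane → ℝ)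
    (u₀ : Plane → Plane) (f : ℝ → Plane → Plane) (ρ : ℝ → Plane → ℝ) (u : ℝ → Plane → Plane)
    (Du : ℝ → Plane → Fin 2 → Fin 2 → ℝ) (N : ℝ) : Prop where
  one_le : 1 ≤ N
  time_nonneg : 0 ≤ T
  time_le : T ≤ N
  eps_pos : 0 < ε
  density_nonneg : ∀ᵐ z ∂(volume.restrict (spaceTime Ω T)), 0 ≤ ρ z.1 z.2
  density_meas : AEStronglyMeasurable (fun z : ℝ × Plane => ρ z.1 z.2)
    (volume.restrict (spaceTime Ω T))
  velocity_meas : AEStronglyMeasurable (fun z : ℝ × Plane => u z.1 z.2)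
    (volume.restrict (spaceTime Ω T))
  gradient_meas : ∀ i j, AEStronglyMeasurable (fun z : ℝ × Plane => Du z.1 z.2 i j)
    (volume.restrict (spaceTime Ω T))
  force_le : ∀ᵐ z ∂(volume.restrict (spaceTime Ω T)), ‖f z.1 z.2‖ ≤ N
  density_le : ∀ᵐ t ∂(volume.restrict (Ioo 0 T)),
    ∫⁻ x in Ω, ENNReal.ofReal (totalDensity ε γ ρ u (t, x)) ≤ ENNReal.ofReal N
  stress_le : ∫⁻ z in spaceTime Ω T,
    ENNReal.ofReal (∑ i, ∑ j, |stress ν₁ ν₂ (Du z.1 z.2) i j|) ≤ ENNReal.ofReal N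
  stress_sq_le : ∫⁻ z in spaceTime Ω T,
    ENNReal.ofReal (∑ i, ∑ j, stress ν₁ ν₂ (Du z.1 z.2) i j ^ 2) ≤ ENNReal.ofReal N
  initial_mass_le : ∫⁻ x in Ω, ‖ρ₀ x‖ₑ ≤ ENNReal.ofReal N
  initial_momentum_le : ∫⁻ x in Ω, ‖ρ₀ x‖ₑ * ‖u₀ x‖ₑ ≤ ENNReal.ofReal N

variable {Ω : Set Plane} {T ν₁ ν₂ ε γ : ℝ} {ρ₀ : Plane → ℝ} {u₀ : Plane → Plane}
  {f : ℝ → Plane → Plane} {ρ : ℝ → Plane → ℝ} {u : ℝ → Plane → Plane}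
  {Du : ℝ → Plane → Fin 2 → Fin 2 → ℝ} {N : ℝ}

lemma volume_restrict_spaceTime (Ω : Set Plane) (T : ℝ) :
    (volume : Measure (ℝ × Plane)).restrict (spaceTime Ω T)
      = ((volume : Measure ℝ).restrict (Ioo 0 T)).prod ((volume : Measure Plane).restrict Ω) := by
  rw [spaceTime, Measure.volume_eq_prod, Measure.prod_restrict]

lemma pressure_nonneg {r : ℝ} (hε : 0 < ε) (hr : 0 ≤ r) : 0 ≤ pressure ε γ r :=
  add_nonneg hr (mul_nonneg hε.le (Real.rpow_nonneg hr _))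

section Pointwise

variable {z : ℝ × Plane}

lemma density_le_totalDensity (hε : 0 < ε) (hz : 0 ≤ ρ z.1 z.2) :
    ρ z.1 z.2 ≤ totalDensity ε γ ρ u z := by
  have h1 := pressure_nonneg (γ := γ) hε hz
  have h2 := mul_nonneg hz (sq_nonneg ‖u z.1 z.2‖)
  unfold totalDensity; linarith

lemma totalDensity_nonneg (hε : 0 < ε) (hz : 0 ≤ ρ z.1 z.2) : 0 ≤ totalDensity ε γ ρ u z :=
  hz.trans (density_le_totalDensity hε hz)

lemma pressure_le_totalDensity (hz : 0 ≤ ρ z.1 z.2) :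
    pressure ε γ (ρ z.1 z.2) ≤ totalDensity ε γ ρ u z := by
  have h2 := mul_nonneg hz (sq_nonneg ‖u z.1 z.2‖)
  unfold totalDensity; linarith

lemma energyDensity_le_totalDensity (hε : 0 < ε) (hz : 0 ≤ ρ z.1 z.2) :
    ρ z.1 z.2 * ‖u z.1 z.2‖ ^ 2 ≤ totalDensity ε γ ρ u z := by
  have h1 := pressure_nonneg (γ := γ) hε hz
  unfold totalDensity; linarith

lemma momentum_le_totalDensity (hε : 0 < ε) (hz : 0 ≤ ρ z.1 z.2) :
    ρ z.1 z.2 * ‖u z.1 z.2‖ ≤ totalDensity ε γ ρ u z := by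
  have h1 := pressure_nonneg (γ := γ) hε hz
  have h2 : 0 ≤ ρ z.1 z.2 * (‖u z.1 z.2‖ - 1) ^ 2 := mul_nonneg hz (sq_nonneg _)
  have h3 := mul_nonneg hz (sq_nonneg ‖u z.1 z.2‖)
  unfold totalDensity; nlinarith

end Pointwise

namespace AprioriBound

variable (A : AprioriBound Ω T ν₁ ν₂ ε γ ρ₀ u₀ f ρ u Du N)

include A

lemma N_pos : 0 < N := zero_lt_one.trans_le A.one_le

lemma totalDensity_meas : AEStronglyMeasurable (totalDensity ε γ ρ u)
    (volume.restrict (spaceTime Ω T)) := by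
  have h1 := A.density_meas
  have h2 := A.velocity_meas
  have h3 : AEStronglyMeasurable (fun z : ℝ × Plane => ρ z.1 z.2 ^ γ)
    (volume.restrict (spaceTime Ω T)) := (h1.aemeasurable.pow_const γ).aestronglyMeasurable
  unfold totalDensity pressure
  exact (h1.add (h1.mul (h2.norm.pow 2))).add (h1.add (h3.const_mul ε))

lemma stress_meas (i j : Fin 2) : AEStronglyMeasurable
    (fun z : ℝ × Plane => stress ν₁ ν₂ (Du z.1 z.2) i j) (volume.restrict (spaceTime Ω T)) := by
  have h := A.gradient_meas
  unfold stress
  exact (((h i j).add (h j i)).const_mul ν₁).add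
    ((((h 0 0).add (h 1 1)).const_mul ν₂).mul_const _)

/-- The total density is bounded in `L^∞(0, T; L¹)`, so that weights in time cost their `L¹` norm. -/
lemma lintegral_weight_le {w : ℝ → ℝ} (hw : Measurable w) :
    ∫⁻ z in spaceTime Ω T, ENNReal.ofReal (w z.1) * ENNReal.ofReal (totalDensity ε γ ρ u z)
      ≤ ENNReal.ofReal N * ∫⁻ t in Ioo 0 T, ENNReal.ofReal (w t) := by
  have hm := A.totalDensity_meas
  rw [volume_restrict_spaceTime] at hm ⊢
  have hG : AEMeasurable (fun z => ENNReal.ofReal (totalDensity ε γ ρ u z))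
    (((volume : Measure ℝ).restrict (Ioo 0 T)).prod ((volume : Measure Plane).restrict Ω)) :=
    hm.aemeasurable.ennreal_ofReal
  have hwG : AEMeasurable (fun z : ℝ × Plane => ENNReal.ofReal (w z.1)
      * ENNReal.ofReal (totalDensity ε γ ρ u z))
      (((volume : Measure ℝ).restrict (Ioo 0 T)).prod ((volume : Measure Plane).restrict Ω)) :=
    (hw.ennreal_ofReal.comp measurable_fst).aemeasurable.mul hG
  rw [lintegral_prod _ hwG,
    ← lintegral_const_mul _ hw.ennreal_ofReal]
  refine lintegral_mono_ae ?_
  filter_upwards [A.density_le] with t ht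
  rw [lintegral_const_mul' _ _ ENNReal.ofReal_ne_top, mul_comm]
  gcongr

lemma lintegral_totalDensity_lt_top :
    ∫⁻ z in spaceTime Ω T, ENNReal.ofReal (totalDensity ε γ ρ u z) < ⊤ := by
  have h := A.lintegral_weight_le (w := fun _ => 1) measurable_const
  simp only [ENNReal.ofReal_one, one_mul] at h
  refine h.trans_lt (ENNReal.mul_lt_top ENNReal.ofReal_lt_top ?_)
  simp

lemma integrableOn_totalDensity : IntegrableOn (totalDensity ε γ ρ u) (spaceTime Ω T) := by
  refine ⟨A.totalDensity_meas, ?_⟩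
  rw [hasFiniteIntegral_iff_ofReal]
  · exact A.lintegral_totalDensity_lt_top
  · filter_upwards [A.density_nonneg] with z hz
    exact totalDensity_nonneg A.eps_pos hz

lemma integrableOn_stress (i j : Fin 2) : IntegrableOn
    (fun z : ℝ × Plane => stress ν₁ ν₂ (Du z.1 z.2) i j) (spaceTime Ω T) := by
  refine ⟨A.stress_meas i j, ?_⟩
  rw [hasFiniteIntegral_iff_norm]
  refine lt_of_le_of_lt (lintegral_mono fun z => ENNReal.ofReal_le_ofReal ?_)
    (A.stress_le.trans_lt ENNReal.ofReal_lt_top)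
  rw [Real.norm_eq_abs]
  exact (Finset.single_le_sum (f := fun j => |stress ν₁ ν₂ (Du z.1 z.2) i j|)
    (fun _ _ => abs_nonneg _) (Finset.mem_univ j)).trans
    (Finset.single_le_sum (f := fun i => ∑ j, |stress ν₁ ν₂ (Du z.1 z.2) i j|)
    (fun _ _ => Finset.sum_nonneg fun _ _ => abs_nonneg _) (Finset.mem_univ i))

lemma integrableOn_of_le {h : ℝ × Plane → ℝ}
    (hm : AEStronglyMeasurable h (volume.restrict (spaceTime Ω T))) {c : ℝ}
    (hle : ∀ᵐ z ∂(volume.restrict (spaceTime Ω T)), |h z| ≤ c * totalDensity ε γ ρ u z) :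
    IntegrableOn h (spaceTime Ω T) :=
  (A.integrableOn_totalDensity.const_mul c).mono' hm hle

/-- The integral over `Q_T` of a function dominated by the total density, with a weight in time, and
the viscous stress. -/
lemma abs_integral_le {h : ℝ × Plane → ℝ} {w : ℝ → ℝ} (hw : Measurable w) (hw0 : ∀ t, 0 ≤ w t)
    {c c' : ℝ} (hc : 0 ≤ c) (hc' : 0 ≤ c')
    (hwc : ∫⁻ t in Ioo 0 T, ENNReal.ofReal (w t) ≤ ENNReal.ofReal c)
    (hle : ∀ᵐ z ∂(volume.restrict (spaceTime Ω T)), |h z| ≤ w z.1 * totalDensity ε γ ρ u z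
      + c' * ∑ i, ∑ j, |stress ν₁ ν₂ (Du z.1 z.2) i j|) :
    |∫ z in spaceTime Ω T, h z| ≤ (c + c') * N := by
  have hN := A.N_pos
  rw [← Real.norm_eq_abs]
  have h1 : ∫⁻ z in spaceTime Ω T, ENNReal.ofReal ‖h z‖ ≤ ENNReal.ofReal ((c + c') * N) := by
    calc ∫⁻ z in spaceTime Ω T, ENNReal.ofReal ‖h z‖
        ≤ ∫⁻ z in spaceTime Ω T, (ENNReal.ofReal (w z.1) * ENNReal.ofReal (totalDensity ε γ ρ u z)
          + ENNReal.ofReal c' *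
            ENNReal.ofReal (∑ i, ∑ j, |stress ν₁ ν₂ (Du z.1 z.2) i j|)) := by
          refine lintegral_mono_ae ?_
          filter_upwards [hle, A.density_nonneg] with z hz hz0
          rw [← ENNReal.ofReal_mul (hw0 _), ← ENNReal.ofReal_mul hc', ← ENNReal.ofReal_add
            (mul_nonneg (hw0 _) (totalDensity_nonneg A.eps_pos hz0))
            (mul_nonneg hc' (Finset.sum_nonneg fun _ _ => Finset.sum_nonneg fun _ _ => abs_nonneg _))]
          exact ENNReal.ofReal_le_ofReal hz
      _ ≤ ENNReal.ofReal N * ENNReal.ofReal c + ENNReal.ofReal c' * ENNReal.ofReal N := by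
          rw [lintegral_add_left' , lintegral_const_mul' _ _ ENNReal.ofReal_ne_top]
          · gcongr
            · exact (A.lintegral_weight_le hw).trans (by gcongr)
            · exact A.stress_le
          · exact (hw.ennreal_ofReal.comp measurable_fst).aemeasurable.mul
              A.totalDensity_meas.aemeasurable.ennreal_ofReal
      _ = _ := by
          rw [← ENNReal.ofReal_mul hN.le, ← ENNReal.ofReal_mul hc', ← ENNReal.ofReal_add
            (by positivity) (by positivity)]
          congr 1; ring
  refine (norm_integral_le_lintegral_norm _).trans ?_
  exact ENNReal.toReal_le_of_le_ofReal (by positivity) h1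

end AprioriBound

end Apriori

/-! ### The localized, time-mollified momentum inequality -/

section Localized

/-- Bounds for a cutoff function with a common constant `κ`. -/
structure CutoffBound (ζ : Plane → ℝ) (κ : ℝ) : Prop where
  one_le : 1 ≤ κ
  abs_le : ∀ x, |ζ x| ≤ κ
  pderiv_le : ∀ j x, |pderiv j ζ x| ≤ κ
  support : ∀ x, ζ x ≠ 0 → ‖x‖ ≤ κ

/-- A smooth probability density on the time axis, supported in `[-h, h]`. -/
structure IsTimeMollifier (θ : ℝ → ℝ) (h : ℝ) : Prop where
  pos : 0 < h
  smooth : ContDiff ℝ ∞ θ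
  compact : HasCompactSupport θ
  nonneg : ∀ t, 0 ≤ θ t
  integral : ∫ t, θ t = 1
  zero : ∀ t, h ≤ |t| → θ t = 0

lemma IsTimeMollifier.lintegral {θ : ℝ → ℝ} {h : ℝ} (hθ : IsTimeMollifier θ h) :
    ∫⁻ t, ENNReal.ofReal (θ t) = 1 := by
  rw [← ofReal_integral_eq_lintegral_ofReal
    (hθ.smooth.continuous.integrable_of_hasCompactSupport hθ.compact) (ae_of_all _ hθ.nonneg),
    hθ.integral, ENNReal.ofReal_one]

/-- The tensor `ϱ u ⊗ u + p(ϱ) I - S(u)`. -/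
noncomputable def fluxTensor (ν₁ ν₂ ε γ : ℝ) (ρ : ℝ → Plane → ℝ) (u : ℝ → Plane → Plane)
    (Du : ℝ → Plane → Fin 2 → Fin 2 → ℝ) (z : ℝ × Plane) (i j : Fin 2) : ℝ :=
  ρ z.1 z.2 * u z.1 z.2 i * u z.1 z.2 j + pressure ε γ (ρ z.1 z.2) * (if i = j then 1 else 0)
    - stress ν₁ ν₂ (Du z.1 z.2) i j

/-- `ζ ϱ`, extended by zero. -/
noncomputable def cutDensity (Ω : Set Plane) (T : ℝ) (ζ : Plane → ℝ) (ρ : ℝ → Plane → ℝ) :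
    ℝ × Plane → ℝ :=
  (spaceTime Ω T).indicator fun z => ζ z.2 * ρ z.1 z.2

/-- The component `ζ ϱ u · e` of the localized momentum, extended by zero. -/
noncomputable def cutMomentum (Ω : Set Plane) (T : ℝ) (ζ : Plane → ℝ) (ρ : ℝ → Plane → ℝ)
    (u : ℝ → Plane → Plane) (e : Plane) : ℝ × Plane → ℝ :=
  (spaceTime Ω T).indicator fun z => ζ z.2 * (ρ z.1 z.2 * inner ℝ (u z.1 z.2) e)

/-- The component `ζ (ϱ u ⊗ u + p(ϱ) I - S(u)) : e ⊗ e` of the localized flux, extended by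
zero. -/
noncomputable def cutFlux (Ω : Set Plane) (T : ℝ) (ζ : Plane → ℝ) (ν₁ ν₂ ε γ : ℝ)
    (ρ : ℝ → Plane → ℝ) (u : ℝ → Plane → Plane) (Du : ℝ → Plane → Fin 2 → Fin 2 → ℝ)
    (e : Plane) : ℝ × Plane → ℝ :=
  (spaceTime Ω T).indicator fun z =>
    ζ z.2 * ∑ i, ∑ j, fluxTensor ν₁ ν₂ ε γ ρ u Du z i j * (e i * e j)

/-- The product of a time mollifier and the strip kernel. -/
noncomputable def stripKernel (θ : ℝ → ℝ) (b : ℝ) (e : Plane) (z : ℝ × Plane) : ℝ :=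
  θ z.1 * gaussKernel b (inner ℝ e z.2)

lemma measurableSet_spaceTime {Ω : Set Plane} (hΩ : IsOpen Ω) (T : ℝ) :
    MeasurableSet (spaceTime Ω T) :=
  measurableSet_Ioo.prod hΩ.measurableSet

lemma stConv_indicator {Q : Set (ℝ × Plane)} (hQ : MeasurableSet Q) (g κ : ℝ × Plane → ℝ)
    (z : ℝ × Plane) : stConv (Q.indicator g) κ z = ∫ w in Q, g w * κ (z - w) := by
  rw [stConv, ← integral_indicator hQ]
  congr 1; ext w
  by_cases hw : w ∈ Q <;> simp [hw]

lemma integrableOn_mul_kernel {Q : Set (ℝ × Plane)} {g κ : ℝ × Plane → ℝ} (hg : IntegrableOn g Q)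
    (hκ : Continuous κ) {C : ℝ} (hC : ∀ z, |κ z| ≤ C) (z : ℝ × Plane) :
    IntegrableOn (fun w => g w * κ (z - w)) Q :=
  Integrable.mul_bdd (c := C) hg (hκ.comp (by fun_prop)).aestronglyMeasurable
    (ae_of_all _ fun w => hC _)

lemma continuous_stConv {g κ : ℝ × Plane → ℝ} (hg : Integrable g) (hκ : Continuous κ) {C : ℝ}
    (hC : ∀ z, |κ z| ≤ C) : Continuous (stConv g κ) := by
  refine continuous_of_dominated (bound := fun w => |g w| * C)
    (fun z => hg.aestronglyMeasurable.mul (hκ.comp (by fun_prop)).aestronglyMeasurable)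
    (fun z => ae_of_all _ fun w => ?_) (hg.abs.mul_const C)
    (ae_of_all _ fun w => continuous_const.mul (hκ.comp (by fun_prop)))
  rw [Real.norm_eq_abs, abs_mul]
  exact mul_le_mul_of_nonneg_left (hC _) (abs_nonneg _)

lemma abs_stConv_le {g κ : ℝ × Plane → ℝ} (hg : Integrable g) {C : ℝ}
    (hC : ∀ z, |κ z| ≤ C) (z : ℝ × Plane) : |stConv g κ z| ≤ C * ∫ w, |g w| := by
  rw [stConv, ← Real.norm_eq_abs, ← integral_const_mul]
  refine norm_integral_le_of_norm_le (hg.abs.const_mul C) (ae_of_all _ fun w => ?_)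
  rw [Real.norm_eq_abs, abs_mul, mul_comm]
  exact mul_le_mul_of_nonneg_right (hC _) (abs_nonneg _)

lemma continuous_stripKernel {θ : ℝ → ℝ} (hθ : Continuous θ) (b : ℝ) (e : Plane) :
    Continuous (stripKernel θ b e) :=
  (hθ.comp continuous_fst).mul ((continuous_gaussKernel b).comp (by fun_prop))

lemma IsTimeMollifier.exists_stripKernel_le {θ : ℝ → ℝ} {h b : ℝ} (hθ : IsTimeMollifier θ h)
    (hb : 0 < b) (e : Plane) : ∃ C, ∀ z, |stripKernel θ b e z| ≤ C := by
  obtain ⟨C, hC⟩ := hθ.compact.exists_bound_of_continuous hθ.smooth.continuous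
  refine ⟨C * √(b / Real.pi), fun z => ?_⟩
  have hC0 : 0 ≤ C := (norm_nonneg _).trans (hC 0)
  rw [stripKernel, abs_mul, abs_of_nonneg (gaussKernel_nonneg _ _)]
  exact mul_le_mul (hC _) (gaussKernel_le hb _) (gaussKernel_nonneg _ _) hC0

variable {Ω : Set Plane} {T ν₁ ν₂ ε γ : ℝ} {ρ₀ : Plane → ℝ} {u₀ : Plane → Plane}
  {f : ℝ → Plane → Plane} {ρ : ℝ → Plane → ℝ} {u : ℝ → Plane → Plane}
  {Du : ℝ → Plane → Fin 2 → Fin 2 → ℝ} {N : ℝ} {ζ : Plane → ℝ} {κ b h : ℝ} {e : Plane}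
  {θ : ℝ → ℝ}

lemma abs_apply_le_norm (v : Plane) (i : Fin 2) : |v i| ≤ ‖v‖ := PiLp.norm_apply_le v i

lemma abs_inner_le (he : ‖e‖ = 1) (v : Plane) : |inner ℝ v e| ≤ ‖v‖ := by
  simpa [he] using abs_real_inner_le_norm v e

namespace AprioriBound

variable (A : AprioriBound Ω T ν₁ ν₂ ε γ ρ₀ u₀ f ρ u Du N)

include A

lemma integrableOn_cutDensity (hζ : IsCutoff Ω ζ) (hκ : CutoffBound ζ κ) :
    IntegrableOn (fun z : ℝ × Plane => ζ z.2 * ρ z.1 z.2) (spaceTime Ω T) := by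
  refine A.integrableOn_of_le (c := κ) ((hζ.smooth.continuous.comp
    continuous_snd).aestronglyMeasurable.mul A.density_meas) ?_
  filter_upwards [A.density_nonneg] with z hz
  rw [abs_mul, abs_of_nonneg hz]
  exact mul_le_mul (hκ.abs_le _) (density_le_totalDensity A.eps_pos hz) hz
    (zero_le_one.trans hκ.one_le)

lemma momentum_meas (e : Plane) : AEStronglyMeasurable
    (fun z : ℝ × Plane => ρ z.1 z.2 * inner ℝ (u z.1 z.2) e)
    (volume.restrict (spaceTime Ω T)) :=
  A.density_meas.mul (A.velocity_meas.inner aestronglyMeasurable_const)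

lemma abs_momentum_le (he : ‖e‖ = 1) : ∀ᵐ z ∂(volume.restrict (spaceTime Ω T)),
    |ρ z.1 z.2 * inner ℝ (u z.1 z.2) e| ≤ totalDensity ε γ ρ u z := by
  filter_upwards [A.density_nonneg] with z hz
  rw [abs_mul, abs_of_nonneg hz]
  exact (mul_le_mul_of_nonneg_left (abs_inner_le he _) hz).trans
    (momentum_le_totalDensity A.eps_pos hz)

lemma integrableOn_cutMomentum (hζ : IsCutoff Ω ζ) (hκ : CutoffBound ζ κ) (he : ‖e‖ = 1) :
    IntegrableOn (fun z : ℝ × Plane => ζ z.2 * (ρ z.1 z.2 * inner ℝ (u z.1 z.2) e))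
      (spaceTime Ω T) := by
  refine A.integrableOn_of_le (c := κ) ((hζ.smooth.continuous.comp
    continuous_snd).aestronglyMeasurable.mul (A.momentum_meas e)) ?_
  filter_upwards [A.abs_momentum_le he] with z hz
  rw [abs_mul]
  exact mul_le_mul (hκ.abs_le _) hz (abs_nonneg _) (zero_le_one.trans hκ.one_le)

lemma fluxTensor_meas (i j : Fin 2) : AEStronglyMeasurable
    (fun z => fluxTensor ν₁ ν₂ ε γ ρ u Du z i j) (volume.restrict (spaceTime Ω T)) := by
  have hu : ∀ i : Fin 2, AEStronglyMeasurable (fun z : ℝ × Plane => u z.1 z.2 i)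
      (volume.restrict (spaceTime Ω T)) := fun i =>
    (EuclideanSpace.proj (𝕜 := ℝ) i).continuous.comp_aestronglyMeasurable A.velocity_meas
  have hp : AEStronglyMeasurable (fun z : ℝ × Plane => pressure ε γ (ρ z.1 z.2))
      (volume.restrict (spaceTime Ω T)) :=
    A.density_meas.add ((A.density_meas.aemeasurable.pow_const γ).aestronglyMeasurable.const_mul ε)
  exact (((A.density_meas.mul (hu i)).mul (hu j)).add (hp.mul_const _)).sub (A.stress_meas i j)

lemma abs_fluxTensor_le : ∀ᵐ z ∂(volume.restrict (spaceTime Ω T)), ∀ i j,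
    |fluxTensor ν₁ ν₂ ε γ ρ u Du z i j|
      ≤ 2 * totalDensity ε γ ρ u z + |stress ν₁ ν₂ (Du z.1 z.2) i j| := by
  filter_upwards [A.density_nonneg] with z hz i j
  have h1 : |ρ z.1 z.2 * u z.1 z.2 i * u z.1 z.2 j| ≤ totalDensity ε γ ρ u z := by
    rw [mul_assoc, abs_mul, abs_of_nonneg hz, abs_mul]
    refine le_trans (mul_le_mul_of_nonneg_left ?_ hz)
      (energyDensity_le_totalDensity (γ := γ) A.eps_pos hz)
    rw [sq]
    exact mul_le_mul (abs_apply_le_norm _ _) (abs_apply_le_norm _ _) (abs_nonneg _)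
      (norm_nonneg _)
  have hp := pressure_nonneg (γ := γ) A.eps_pos hz
  have h2 : |pressure ε γ (ρ z.1 z.2) * (if i = j then 1 else 0)| ≤ totalDensity ε γ ρ u z := by
    refine le_trans ?_ (pressure_le_totalDensity hz)
    split_ifs
    · rw [mul_one, abs_of_nonneg hp]
    · simpa using hp
  rw [fluxTensor]
  have h3 := abs_sub (ρ z.1 z.2 * u z.1 z.2 i * u z.1 z.2 j
    + pressure ε γ (ρ z.1 z.2) * (if i = j then 1 else 0)) (stress ν₁ ν₂ (Du z.1 z.2) i j)
  have h4 := abs_add_le (ρ z.1 z.2 * u z.1 z.2 i * u z.1 z.2 j)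
    (pressure ε γ (ρ z.1 z.2) * (if i = j then 1 else 0))
  linarith

lemma integrableOn_fluxTensor (i j : Fin 2) :
    IntegrableOn (fun z => fluxTensor ν₁ ν₂ ε γ ρ u Du z i j) (spaceTime Ω T) := by
  refine ((A.integrableOn_totalDensity.const_mul 2).add (A.integrableOn_stress i j).abs).mono'
    (A.fluxTensor_meas i j) ?_
  filter_upwards [A.abs_fluxTensor_le] with z hz
  exact hz i j

lemma integrableOn_cutFlux (hζ : IsCutoff Ω ζ) (hκ : CutoffBound ζ κ) (e : Plane) :
    IntegrableOn (fun z : ℝ × Plane =>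
      ζ z.2 * ∑ i, ∑ j, fluxTensor ν₁ ν₂ ε γ ρ u Du z i j * (e i * e j)) (spaceTime Ω T) := by
  have h1 : IntegrableOn (fun z : ℝ × Plane =>
      ∑ i, ∑ j, fluxTensor ν₁ ν₂ ε γ ρ u Du z i j * (e i * e j)) (spaceTime Ω T) :=
    integrable_finsetSum _ fun i _ => integrable_finsetSum _ fun j _ =>
      (A.integrableOn_fluxTensor i j).mul_const _
  exact Integrable.bdd_mul (c := κ) h1
    (hζ.smooth.continuous.comp continuous_snd).aestronglyMeasurable
    (ae_of_all _ fun z => hκ.abs_le _)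

lemma abs_integral_mollified_le (hθ : IsTimeMollifier θ h) (t : ℝ) {g : ℝ × Plane → ℝ} {c : ℝ}
    (hc : 0 ≤ c) (hle : ∀ᵐ z ∂(volume.restrict (spaceTime Ω T)),
      |g z| ≤ c * θ (t - z.1) * totalDensity ε γ ρ u z) :
    |∫ z in spaceTime Ω T, g z| ≤ c * N := by
  have h1 := A.abs_integral_le (h := g) (w := fun s => c * θ (t - s)) (c := c) (c' := 0)
    (by have := hθ.smooth.continuous; fun_prop) (fun s => mul_nonneg hc (hθ.nonneg _)) hc le_rfl
    ?_ ?_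
  · simpa using h1
  · simp_rw [ENNReal.ofReal_mul hc]
    rw [lintegral_const_mul' _ _ ENNReal.ofReal_ne_top]
    refine mul_le_of_le_one_right zero_le ((setLIntegral_le_lintegral _ _).trans_eq ?_)
    rw [lintegral_sub_left_eq_self (fun s => ENNReal.ofReal (θ s)), hθ.lintegral]
  · filter_upwards [hle] with z hz
    simpa using hz

lemma abs_stConv_cutDensity_le (hΩ : IsOpen Ω) (hκ : CutoffBound ζ κ)
    (hθ : IsTimeMollifier θ h) {W : Plane → ℝ} (hW : ∀ x, |W x| ≤ 1) (z : ℝ × Plane) :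
    |stConv (cutDensity Ω T ζ ρ) (fun z => θ z.1 * W z.2) z| ≤ κ * N := by
  have hκ0 : 0 ≤ κ := zero_le_one.trans hκ.one_le
  rw [cutDensity, stConv_indicator (measurableSet_spaceTime hΩ T)]
  refine A.abs_integral_mollified_le hθ z.1 hκ0 ?_
  filter_upwards [A.density_nonneg] with w hw
  rw [abs_mul, abs_mul, abs_mul, abs_of_nonneg hw, abs_of_nonneg (hθ.nonneg _)]
  have h1 := density_le_totalDensity (γ := γ) (u := u) A.eps_pos hw
  calc |ζ w.2| * ρ w.1 w.2 * (θ (z - w).1 * |W (z - w).2|)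
      ≤ κ * totalDensity ε γ ρ u w * (θ (z - w).1 * 1) :=
        mul_le_mul (mul_le_mul (hκ.abs_le _) h1 hw hκ0)
          (mul_le_mul_of_nonneg_left (hW _) (hθ.nonneg _))
          (mul_nonneg (hθ.nonneg _) (abs_nonneg _)) (mul_nonneg hκ0 (hw.trans h1))
    _ = _ := by rw [Prod.fst_sub]; ring

/-- The time derivative of the mollified potential of `ζ ϱ` is, up to a bounded error, the
negative of the mollified strip integral of the momentum: this is the mass balance. -/
lemma abs_fderiv_add_stConv_le (hΩ : IsOpen Ω) (hmass : RenormalizedMassBalance Ω T ρ₀ ρ u Du)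
    (hζ : IsCutoff Ω ζ) (hκ : CutoffBound ζ κ) (hθ : IsTimeMollifier θ h) (hb : 0 < b)
    (he : ‖e‖ = 1) {η : ContDiffBump (0 : Plane)} (hη : 2 * κ < η.rIn) {z : ℝ × Plane}
    (hz : ‖z.2‖ ≤ κ) (hzT : z.1 ≤ T - 2 * h) :
    |fderiv ℝ (stConv (cutDensity Ω T ζ ρ) fun z => θ z.1 * stripPotential b e η z.2) z (1, 0)
      + stConv (cutMomentum Ω T ζ ρ u e) (stripKernel θ b e) z| ≤ κ * N * (2 + θ z.1) := by
  have hκ0 : 0 ≤ κ := zero_le_one.trans hκ.one_le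
  have hQ := measurableSet_spaceTime hΩ T
  set K : ℝ × Plane → ℝ := fun z => θ z.1 * stripPotential b e η z.2 with hK
  have hKs : ContDiff ℝ ∞ K := contDiff_tensor hθ.smooth contDiff_stripPotential
  have hKc : HasCompactSupport K := hasCompactSupport_tensor hθ.compact hasCompactSupport_stripPotential
  obtain ⟨C1, hC1⟩ := hKc.exists_bound_of_continuous hKs.continuous
  have hKt : Continuous (fun z => fderiv ℝ K z (1, 0)) :=
    (hKs.continuous_fderiv (by simp)).clm_apply continuous_const
  obtain ⟨C2, hC2⟩ := ((hKc.fderiv (𝕜 := ℝ)).comp_left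
    (g := fun L : (ℝ × Plane) →L[ℝ] ℝ => L (1, 0)) rfl).exists_bound_of_continuous hKt
  obtain ⟨C3, hC3⟩ := hθ.exists_stripKernel_le hb e
  have hX : fderiv ℝ (stConv (cutDensity Ω T ζ ρ) K) z (1, 0)
      = ∫ w in spaceTime Ω T, ζ w.2 * ρ w.1 w.2 * fderiv ℝ K (z - w) (1, 0) := by
    rw [cutDensity, fderiv_stConv ((integrable_indicator_iff hQ).2 (A.integrableOn_cutDensity hζ hκ)) hKs hKc]
    exact stConv_indicator hQ _ (fun w => fderiv ℝ K w (1, 0)) z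
  have hY : stConv (cutMomentum Ω T ζ ρ u e) (stripKernel θ b e) z
      = ∫ w in spaceTime Ω T, ζ w.2 * (ρ w.1 w.2 * inner ℝ (u w.1 w.2) e)
          * stripKernel θ b e (z - w) := stConv_indicator hQ _ _ z
  have iX : IntegrableOn (fun w : ℝ × Plane =>
      ζ w.2 * ρ w.1 w.2 * fderiv ℝ K (z - w) (1, 0)) (spaceTime Ω T) :=
    integrableOn_mul_kernel (A.integrableOn_cutDensity hζ hκ) hKt hC2 z
  have iY : IntegrableOn (fun w : ℝ × Plane => ζ w.2 * (ρ w.1 w.2 * inner ℝ (u w.1 w.2) e)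
      * stripKernel θ b e (z - w)) (spaceTime Ω T) :=
    integrableOn_mul_kernel (A.integrableOn_cutMomentum hζ hκ he)
      (continuous_stripKernel hθ.smooth.continuous b e) hC3 z
  have hZle : ∀ᵐ w ∂(volume.restrict (spaceTime Ω T)),
      |ρ w.1 w.2 * ∑ j, u w.1 w.2 j * pderiv j ζ w.2| ≤ 2 * κ * totalDensity ε γ ρ u w := by
    filter_upwards [A.density_nonneg] with w hw
    have h1 : ∀ j, |u w.1 w.2 j * pderiv j ζ w.2| ≤ ‖u w.1 w.2‖ * κ := fun j => by
      rw [abs_mul]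
      exact mul_le_mul (abs_apply_le_norm _ _) (hκ.pderiv_le _ _) (abs_nonneg _) (norm_nonneg _)
    have h2 : |∑ j, u w.1 w.2 j * pderiv j ζ w.2| ≤ 2 * (‖u w.1 w.2‖ * κ) := by
      rw [Fin.sum_univ_two]
      refine (abs_add_le _ _).trans ?_
      linarith [h1 0, h1 1]
    rw [abs_mul, abs_of_nonneg hw]
    calc ρ w.1 w.2 * |∑ j, u w.1 w.2 j * pderiv j ζ w.2|
        ≤ ρ w.1 w.2 * (2 * (‖u w.1 w.2‖ * κ)) := mul_le_mul_of_nonneg_left h2 hw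
      _ = 2 * κ * (ρ w.1 w.2 * ‖u w.1 w.2‖) := by ring
      _ ≤ _ := mul_le_mul_of_nonneg_left (momentum_le_totalDensity A.eps_pos hw) (by positivity)
  have hZm : AEStronglyMeasurable (fun w : ℝ × Plane =>
      ρ w.1 w.2 * ∑ j, u w.1 w.2 j * pderiv j ζ w.2) (volume.restrict (spaceTime Ω T)) := by
    refine A.density_meas.mul (Finset.aestronglyMeasurable_fun_sum _ fun j _ => ?_)
    exact ((EuclideanSpace.proj (𝕜 := ℝ) j).continuous.comp_aestronglyMeasurable
      A.velocity_meas).mul ((hζ.continuous_pderiv j).comp continuous_snd).aestronglyMeasurable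
  have iZ : IntegrableOn (fun w : ℝ × Plane =>
      (ρ w.1 w.2 * ∑ j, u w.1 w.2 j * pderiv j ζ w.2) * K (z - w)) (spaceTime Ω T) :=
    integrableOn_mul_kernel (A.integrableOn_of_le hZm hZle) hKs.continuous hC1 z
  have hmassz := hmass.tested A.density_nonneg hζ hKs z hθ.pos (fun s hs y => by
    have : θ (z.1 - s) = 0 := hθ.zero _ (by
      rw [abs_of_nonpos (by linarith [hs.1, hθ.pos])]; linarith [hs.1])
    rw [hK]; simp [this])
  have hsplit : ∀ w : ℝ × Plane, (ρ w.1 w.2 * -(ζ w.2 * fderiv ℝ K (z - w) (1, 0))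
        + ρ w.1 w.2 * ∑ j, u w.1 w.2 j * (pderiv j ζ w.2 * K (z - w)
          - ζ w.2 * fderiv ℝ K (z - w) (0, EuclideanSpace.single j 1)))
      = (ρ w.1 w.2 * ∑ j, u w.1 w.2 j * pderiv j ζ w.2) * K (z - w)
        - (ζ w.2 * ρ w.1 w.2 * fderiv ℝ K (z - w) (1, 0)
          + ζ w.2 * (ρ w.1 w.2 * inner ℝ (u w.1 w.2) e) * stripKernel θ b e (z - w)) := by
    intro w
    by_cases hw : ζ w.2 = 0
    · rw [hw]
      simp only [zero_mul, neg_zero, mul_zero, zero_add, sub_zero, add_zero, Finset.sum_mul,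
        Finset.mul_sum]
      refine Finset.sum_congr rfl fun j _ => by ring
    · have h1 : ‖(z - w).2‖ < η.rIn := by
        rw [Prod.snd_sub]
        have := norm_sub_le z.2 w.2
        have := hκ.support _ hw
        linarith
      have h2 : ∀ j, fderiv ℝ K (z - w) (0, EuclideanSpace.single j 1)
          = stripKernel θ b e (z - w) * e j := fun j => by
        rw [hK, fderiv_tensor_snd hθ.smooth contDiff_stripPotential, fderiv_stripPotential h1,
          stripKernel, EuclideanSpace.inner_single_right]
        simp; ring
      have h3 : inner ℝ (u w.1 w.2) e = u w.1 w.2 0 * e 0 + u w.1 w.2 1 * e 1 := by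
        rw [PiLp.inner_apply, Fin.sum_univ_two]
        simp [mul_comm]
      simp only [h2, h3, Fin.sum_univ_two]
      ring
  simp_rw [hsplit] at hmassz
  have iXY : IntegrableOn (fun w : ℝ × Plane => ζ w.2 * ρ w.1 w.2 * fderiv ℝ K (z - w) (1, 0)
      + ζ w.2 * (ρ w.1 w.2 * inner ℝ (u w.1 w.2) e) * stripKernel θ b e (z - w))
      (spaceTime Ω T) := iX.add iY
  rw [integral_sub iZ iXY, integral_add iX iY, ← hX, ← hY] at hmassz
  have hZb : |∫ w in spaceTime Ω T, (ρ w.1 w.2 * ∑ j, u w.1 w.2 j * pderiv j ζ w.2) * K (z - w)|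
      ≤ 2 * κ * N := by
    refine A.abs_integral_mollified_le hθ z.1 (by positivity) ?_
    filter_upwards [hZle] with w hw
    have hKw : |K (z - w)| = θ (z.1 - w.1) * |stripPotential b e η (z - w).2| := by
      rw [hK]
      simp only [abs_mul, abs_of_nonneg (hθ.nonneg _), Prod.fst_sub]
    rw [abs_mul, hKw]
    calc |ρ w.1 w.2 * ∑ j, u w.1 w.2 j * pderiv j ζ w.2|
          * (θ (z.1 - w.1) * |stripPotential b e η (z - w).2|)
        ≤ (2 * κ * totalDensity ε γ ρ u w) * (θ (z.1 - w.1) * 1) := by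
          refine mul_le_mul hw (mul_le_mul_of_nonneg_left (abs_stripPotential_le hb _)
            (hθ.nonneg _)) (mul_nonneg (hθ.nonneg _) (abs_nonneg _)) ((abs_nonneg _).trans hw)
      _ = _ := by ring
  have hIb : |∫ y in Ω, ζ y * K (z.1, z.2 - y) * ρ₀ y| ≤ κ * θ z.1 * N := by
    rw [← Real.norm_eq_abs]
    refine (norm_integral_le_lintegral_norm _).trans ?_
    have hN := A.N_pos
    have hc : 0 ≤ κ * θ z.1 := mul_nonneg hκ0 (hθ.nonneg _)
    refine ENNReal.toReal_le_of_le_ofReal (mul_nonneg hc hN.le) ?_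
    calc ∫⁻ y in Ω, ENNReal.ofReal ‖ζ y * K (z.1, z.2 - y) * ρ₀ y‖
        ≤ ∫⁻ y in Ω, ENNReal.ofReal (κ * θ z.1) * ‖ρ₀ y‖ₑ := by
          refine lintegral_mono fun y => ?_
          rw [← ofReal_norm (ρ₀ y), ← ENNReal.ofReal_mul hc]
          refine ENNReal.ofReal_le_ofReal ?_
          rw [norm_mul]
          refine mul_le_mul_of_nonneg_right ?_ (norm_nonneg _)
          rw [hK, norm_mul, norm_mul, Real.norm_of_nonneg (hθ.nonneg _)]
          refine mul_le_mul (hκ.abs_le _) (mul_le_of_le_one_right (hθ.nonneg _)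
            (abs_stripPotential_le hb _)) (mul_nonneg (hθ.nonneg _) (norm_nonneg _)) hκ0
      _ ≤ ENNReal.ofReal (κ * θ z.1) * ENNReal.ofReal N := by
          rw [lintegral_const_mul' _ _ ENNReal.ofReal_ne_top]
          gcongr
          exact A.initial_mass_le
      _ = _ := by rw [← ENNReal.ofReal_mul hc]
  have hfin : ∀ X Y Z I : ℝ, Z - (X + Y) + I = 0 → X + Y = Z + I := fun X Y Z I h => by linarith
  rw [hfin _ _ _ _ hmassz]
  refine (abs_add_le _ _).trans ((add_le_add hZb hIb).trans_eq ?_)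
  ring

end AprioriBound

end Localized

section MollifiedInequality

/-- A smooth cutoff in time, between `0` and `1`, of total variation at most `1` on `(0, T)`, which
vanishes near `T`. -/
structure IsTimeCutoff (T : ℝ) (χ : ℝ → ℝ) (τ : ℝ) : Prop where
  smooth : ContDiff ℝ ∞ χ
  nonneg : ∀ t, 0 ≤ χ t
  le_one : ∀ t, χ t ≤ 1
  variation : ∫⁻ t in Ioo 0 T, ENNReal.ofReal |deriv χ t| ≤ 1
  zero : ∀ t, T - τ ≤ t → χ t = 0

variable {Ω : Set Plane} {T ν₁ ν₂ ε γ : ℝ} {ρ₀ : Plane → ℝ} {u₀ : Plane → Plane}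
  {f : ℝ → Plane → Plane} {ρ : ℝ → Plane → ℝ} {u : ℝ → Plane → Plane}
  {Du : ℝ → Plane → Fin 2 → Fin 2 → ℝ} {N : ℝ} {ζ : Plane → ℝ} {κ b h : ℝ} {e : Plane}
  {θ χ : ℝ → ℝ}

namespace AprioriBound

variable (A : AprioriBound Ω T ν₁ ν₂ ε γ ρ₀ u₀ f ρ u Du N)

include A

lemma integrable_cutDensity (hΩ : IsOpen Ω) (hζ : IsCutoff Ω ζ) (hκ : CutoffBound ζ κ) :
    Integrable (cutDensity Ω T ζ ρ) :=
  (integrable_indicator_iff (measurableSet_spaceTime hΩ T)).2 (A.integrableOn_cutDensity hζ hκ)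

lemma integrable_cutMomentum (hΩ : IsOpen Ω) (hζ : IsCutoff Ω ζ) (hκ : CutoffBound ζ κ)
    (he : ‖e‖ = 1) : Integrable (cutMomentum Ω T ζ ρ u e) :=
  (integrable_indicator_iff (measurableSet_spaceTime hΩ T)).2
    (A.integrableOn_cutMomentum hζ hκ he)

lemma integrable_cutFlux (hΩ : IsOpen Ω) (hζ : IsCutoff Ω ζ) (hκ : CutoffBound ζ κ)
    (e : Plane) : Integrable (cutFlux Ω T ζ ν₁ ν₂ ε γ ρ u Du e) :=
  (integrable_indicator_iff (measurableSet_spaceTime hΩ T)).2 (A.integrableOn_cutFlux hζ hκ e)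

/-- The space derivatives of the mollified potential of `ζ ϱ` are strip integrals of `ζ ϱ`. -/
lemma fderiv_stConv_cutDensity_snd (hΩ : IsOpen Ω) (hζ : IsCutoff Ω ζ) (hκ : CutoffBound ζ κ)
    (hθ : IsTimeMollifier θ h) {η : ContDiffBump (0 : Plane)} (hη : 2 * κ < η.rIn)
    {z : ℝ × Plane} (hz : ‖z.2‖ ≤ κ) (j : Fin 2) :
    fderiv ℝ (stConv (cutDensity Ω T ζ ρ) fun z => θ z.1 * stripPotential b e η z.2) z
        (0, EuclideanSpace.single j 1)
      = e j * stConv (cutDensity Ω T ζ ρ) (stripKernel θ b e) z := by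
  have hKs : ContDiff ℝ ∞ fun z : ℝ × Plane => θ z.1 * stripPotential b e η z.2 :=
    contDiff_tensor hθ.smooth contDiff_stripPotential
  have hKc : HasCompactSupport fun z : ℝ × Plane => θ z.1 * stripPotential b e η z.2 :=
    hasCompactSupport_tensor hθ.compact hasCompactSupport_stripPotential
  rw [fderiv_stConv (A.integrable_cutDensity hΩ hζ hκ) hKs hKc, stConv, ← integral_const_mul]
  congr 1; ext w
  by_cases hw : cutDensity Ω T ζ ρ w = 0
  · simp [hw]
  · have h0 : ζ w.2 ≠ 0 := fun h0 => hw (by simp [cutDensity, indicator, h0])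
    have h1 : ‖(z - w).2‖ < η.rIn := by
      rw [Prod.snd_sub]
      have := norm_sub_le z.2 w.2
      have := hκ.support _ h0
      linarith
    rw [fderiv_tensor_snd hθ.smooth contDiff_stripPotential, fderiv_stripPotential h1,
      stripKernel, EuclideanSpace.inner_single_right]
    simp
    ring

/-- The momentum balance tested with the mollified potential of `ζ ϱ`: the interaction of the
momentum flux with the density exceeds the self-interaction of the momentum by at most a
constant. The cutoff `χ` vanishes for `t ≥ T - 2 h`, because the translated mollifier is a test
function of the mass balance, zero near `T`, only for earlier times. -/
lemma mollified_flux_sub_momentum_le (hΩ : IsOpen Ω)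
    (hmom : MomentumBalance Ω T ν₁ ν₂ ε γ ρ₀ u₀ f ρ u Du)
    (hmass : RenormalizedMassBalance Ω T ρ₀ ρ u Du)
    (hζ : IsCutoff Ω ζ) (hκ : CutoffBound ζ κ) (hθ : IsTimeMollifier θ h) (hb : 0 < b)
    (he : ‖e‖ = 1) (hχ : IsTimeCutoff T χ (2 * h)) :
    (∫ z, χ z.1 * cutFlux Ω T ζ ν₁ ν₂ ε γ ρ u Du e z
        * stConv (cutDensity Ω T ζ ρ) (stripKernel θ b e) z)
      - (∫ z, χ z.1 * cutMomentum Ω T ζ ρ u e z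
        * stConv (cutMomentum Ω T ζ ρ u e) (stripKernel θ b e) z)
      ≤ 20 * κ ^ 2 * N ^ 4 := by
  have hκ0 : 0 < κ := zero_lt_one.trans_le hκ.one_le
  have hN := A.N_pos
  have hN1 := A.one_le
  have hQ := measurableSet_spaceTime hΩ T
  have hh := hθ.pos
  have hχb : ∀ t, |χ t| ≤ 1 := fun t => by
    rw [abs_of_nonneg (hχ.nonneg t)]; exact hχ.le_one t
  -- the cutoff of the primitive is inactive at all differences of points of the support of `ζ`
  set η : ContDiffBump (0 : Plane) := ⟨2 * κ + 1, 2 * κ + 2, by positivity, by linarith⟩ with hηd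
  have hη : 2 * κ < η.rIn := by change 2 * κ < 2 * κ + 1; linarith
  set K : ℝ × Plane → ℝ := fun z => θ z.1 * stripPotential b e η z.2 with hK
  set S := stripKernel θ b e with hS
  have hSc : Continuous S := continuous_stripKernel hθ.smooth.continuous b e
  obtain ⟨CS, hCS⟩ := hθ.exists_stripKernel_le hb e
  have hKs : ContDiff ℝ ∞ K := contDiff_tensor hθ.smooth contDiff_stripPotential
  have hKc : HasCompactSupport K :=
    hasCompactSupport_tensor hθ.compact hasCompactSupport_stripPotential
  set a := cutDensity Ω T ζ ρ with ha
  set m := cutMomentum Ω T ζ ρ u e with hm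
  have ia : Integrable a := A.integrable_cutDensity hΩ hζ hκ
  have im : Integrable m := A.integrable_cutMomentum hΩ hζ hκ he
  set Φ := stConv a K with hΦ
  have hΦs : ContDiff ℝ ∞ Φ := contDiff_stConv ia hKs hKc
  have hΦb : ∀ z, |Φ z| ≤ κ * N :=
    A.abs_stConv_cutDensity_le hΩ hκ hθ (fun x => abs_stripPotential_le hb x)
  set D := stConv a S with hD
  set M := stConv m S with hM
  have hDc : Continuous D := continuous_stConv ia hSc hCS
  have hMc : Continuous M := continuous_stConv im hSc hCS
  have hDb : ∀ z, |D z| ≤ CS * ∫ w, |a w| := abs_stConv_le ia hCS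
  have hMb : ∀ z, |M z| ≤ CS * ∫ w, |m w| := abs_stConv_le im hCS
  set r : ℝ × Plane → ℝ := fun z => fderiv ℝ Φ z (1, 0) + M z with hr
  have hrc : Continuous r :=
    ((hΦs.continuous_fderiv (by simp)).clm_apply continuous_const).add hMc
  have hrb : ∀ z : ℝ × Plane, ζ z.2 ≠ 0 → z.1 ≤ T - 2 * h → |r z| ≤ κ * N * (2 + θ z.1) :=
    fun z hz hzT => A.abs_fderiv_add_stConv_le hΩ hmass hζ hκ hθ hb he hη (hκ.support _ hz) hzT
  have hχc : Continuous fun z : ℝ × Plane => χ z.1 := hχ.smooth.continuous.comp continuous_fst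
  have hχ'c : Continuous (deriv χ) := hχ.smooth.continuous_deriv (by simp)
  have hζc : Continuous fun z : ℝ × Plane => ζ z.2 := hζ.smooth.continuous.comp continuous_snd
  have htest := hmom.tested hΩ hζ hχ.smooth (hχ.zero T (by linarith)) hΦs e
  -- the transport term
  set H1 : ℝ × Plane → ℝ := fun z => ρ z.1 z.2 * inner ℝ (u z.1 z.2) e
    * (deriv χ z.1 * ζ z.2 * Φ z + χ z.1 * ζ z.2 * r z) with hH1
  set P1 : ℝ × Plane → ℝ := fun z => χ z.1 * (ζ z.2 * (ρ z.1 z.2 * inner ℝ (u z.1 z.2) e)) * M z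
    with hP1
  have e1 : ∀ z : ℝ × Plane, ρ z.1 z.2 * (inner ℝ (u z.1 z.2) e
        * (deriv χ z.1 * ζ z.2 * Φ z + χ z.1 * ζ z.2 * fderiv ℝ Φ z (1, 0))) = H1 z - P1 z := by
    intro z; simp only [hH1, hP1, hr]; ring
  have hH1le : ∀ᵐ z ∂(volume.restrict (spaceTime Ω T)), |H1 z|
      ≤ (κ ^ 2 * N * (|deriv χ z.1| + (2 + θ z.1))) * totalDensity ε γ ρ u z := by
    filter_upwards [A.abs_momentum_le he] with z hz
    have h1 : |deriv χ z.1 * ζ z.2 * Φ z| ≤ |deriv χ z.1| * κ * (κ * N) := by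
      rw [abs_mul, abs_mul]
      have := hκ.abs_le z.2
      have := hΦb z
      gcongr
    have h2 : |χ z.1 * ζ z.2 * r z| ≤ κ * (κ * N * (2 + θ z.1)) := by
      have h0 : 0 ≤ κ * (κ * N * (2 + θ z.1)) := by have := hθ.nonneg z.1; positivity
      by_cases h3 : ζ z.2 = 0
      · simpa [h3] using h0
      rcases le_total (T - 2 * h) z.1 with h4 | h4
      · simpa [hχ.zero _ h4] using h0
      · rw [abs_mul, abs_mul]
        calc |χ z.1| * |ζ z.2| * |r z| ≤ 1 * κ * (κ * N * (2 + θ z.1)) :=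
              mul_le_mul (mul_le_mul (hχb _) (hκ.abs_le _) (abs_nonneg _) zero_le_one)
                (hrb z h3 h4) (abs_nonneg _) (by positivity)
          _ = _ := by ring
    rw [hH1, abs_mul]
    calc |ρ z.1 z.2 * inner ℝ (u z.1 z.2) e|
          * |deriv χ z.1 * ζ z.2 * Φ z + χ z.1 * ζ z.2 * r z|
        ≤ totalDensity ε γ ρ u z
          * (|deriv χ z.1| * κ * (κ * N) + κ * (κ * N * (2 + θ z.1))) :=
          mul_le_mul hz ((abs_add_le _ _).trans (add_le_add h1 h2)) (abs_nonneg _)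
            ((abs_nonneg _).trans hz)
      _ = _ := by ring
  have bH1 : |∫ z in spaceTime Ω T, H1 z| ≤ (κ ^ 2 * N * (2 + 2 * N) + 0) * N := by
    have hθm := hθ.smooth.continuous
    refine A.abs_integral_le (w := fun t => κ ^ 2 * N * (|deriv χ t| + (2 + θ t))) (by fun_prop)
      (fun t => by have := hθ.nonneg t; positivity) (by positivity) le_rfl ?_ ?_
    · simp_rw [ENNReal.ofReal_mul (show 0 ≤ κ ^ 2 * N by positivity)]
      rw [lintegral_const_mul' _ _ ENNReal.ofReal_ne_top]
      gcongr
      calc ∫⁻ t in Ioo 0 T, ENNReal.ofReal (|deriv χ t| + (2 + θ t))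
          = (∫⁻ t in Ioo 0 T, ENNReal.ofReal |deriv χ t|)
            + ((∫⁻ t in Ioo 0 T, ENNReal.ofReal 2) + ∫⁻ t in Ioo 0 T, ENNReal.ofReal (θ t)) := by
            rw [← lintegral_add_left measurable_const, ← lintegral_add_left
              (by fun_prop)]
            refine lintegral_congr fun t => ?_
            rw [ENNReal.ofReal_add (abs_nonneg _) (add_nonneg zero_le_two (hθ.nonneg t)),
              ENNReal.ofReal_add zero_le_two (hθ.nonneg t)]
        _ ≤ 1 + (ENNReal.ofReal (2 * N) + 1) := by
            gcongr
            · exact hχ.variation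
            · rw [lintegral_const, Measure.restrict_apply_univ, Real.volume_Ioo,
                ← ENNReal.ofReal_mul zero_le_two]
              exact ENNReal.ofReal_le_ofReal (by linarith [A.time_le])
            · exact (setLIntegral_le_lintegral _ _).trans_eq hθ.lintegral
        _ = _ := by
            rw [← ENNReal.ofReal_one, ← ENNReal.ofReal_add (by positivity) (by positivity),
              ← ENNReal.ofReal_add (by positivity) (by positivity)]
            congr 1; ring
    · filter_upwards [hH1le] with z hz
      simpa using hz
  have iP1 : IntegrableOn P1 (spaceTime Ω T) :=
    Integrable.mul_bdd (c := CS * ∫ w, |m w|)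
      (Integrable.bdd_mul (c := 1) (A.integrableOn_cutMomentum hζ hκ he) hχc.aestronglyMeasurable
        (ae_of_all _ fun z => hχb _)) hMc.aestronglyMeasurable (ae_of_all _ hMb)
  have iH1 : IntegrableOn H1 (spaceTime Ω T) := by
    obtain ⟨C, hC⟩ := hθ.compact.exists_bound_of_continuous hθ.smooth.continuous
    obtain ⟨C', hC'⟩ := (isCompact_Icc (a := (0 : ℝ)) (b := T)).exists_bound_of_continuousOn
      hχ'c.continuousOn
    refine A.integrableOn_of_le (c := κ ^ 2 * N * (C' + (2 + C))) ?_ ?_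
    · refine (A.momentum_meas e).mul (Continuous.aestronglyMeasurable ?_)
      have := hΦs.continuous
      exact (((hχ'c.comp continuous_fst).mul hζc).mul this).add ((hχc.mul hζc).mul hrc)
    · filter_upwards [hH1le, A.density_nonneg, ae_restrict_mem hQ] with z hz hz0 hzQ
      refine hz.trans (mul_le_mul_of_nonneg_right ?_ (totalDensity_nonneg A.eps_pos hz0))
      have h1 := (le_abs_self _).trans (hC z.1)
      have h2 := hC' z.1 (Ioo_subset_Icc_self hzQ.1)
      rw [Real.norm_eq_abs] at h2
      gcongr
  -- the flux term
  set H2 : ℝ × Plane → ℝ := fun z => ∑ i, ∑ j, fluxTensor ν₁ ν₂ ε γ ρ u Du z i j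
    * (e i * (χ z.1 * (pderiv j ζ z.2 * Φ z))) with hH2
  set P2 : ℝ × Plane → ℝ := fun z => χ z.1 * (ζ z.2 * ∑ i, ∑ j,
    fluxTensor ν₁ ν₂ ε γ ρ u Du z i j * (e i * e j)) * D z with hP2
  have e2 : ∀ z : ℝ × Plane, (∑ i, ∑ j,
      (ρ z.1 z.2 * u z.1 z.2 i * u z.1 z.2 j
        + pressure ε γ (ρ z.1 z.2) * (if i = j then 1 else 0)
        - stress ν₁ ν₂ (Du z.1 z.2) i j) * (e i * (χ z.1 * (pderiv j ζ z.2 * Φ z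
          + ζ z.2 * fderiv ℝ Φ z (0, EuclideanSpace.single j 1))))) = H2 z + P2 z := by
    intro z
    have h1 : ∀ j, ζ z.2 * fderiv ℝ Φ z (0, EuclideanSpace.single j 1) = ζ z.2 * (e j * D z) := by
      intro j
      by_cases h0 : ζ z.2 = 0
      · rw [h0, zero_mul, zero_mul]
      · rw [hΦ, hK, A.fderiv_stConv_cutDensity_snd hΩ hζ hκ hθ hη (hκ.support _ h0) j]
    simp only [h1, hH2, hP2, fluxTensor, Fin.sum_univ_two]
    ring
  have hei : ∀ i, |e i| ≤ 1 := fun i => (abs_apply_le_norm e i).trans_eq he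
  have hH2le : ∀ᵐ z ∂(volume.restrict (spaceTime Ω T)), |H2 z|
      ≤ (8 * κ ^ 2 * N) * totalDensity ε γ ρ u z
        + κ ^ 2 * N * ∑ i, ∑ j, |stress ν₁ ν₂ (Du z.1 z.2) i j| := by
    filter_upwards [A.abs_fluxTensor_le] with z hz
    have h1 : ∀ i j, |fluxTensor ν₁ ν₂ ε γ ρ u Du z i j
        * (e i * (χ z.1 * (pderiv j ζ z.2 * Φ z)))|
        ≤ (2 * totalDensity ε γ ρ u z + |stress ν₁ ν₂ (Du z.1 z.2) i j|) * (κ ^ 2 * N) := by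
      intro i j
      rw [abs_mul]
      refine mul_le_mul (hz i j) ?_ (abs_nonneg _) ((abs_nonneg _).trans (hz i j))
      rw [abs_mul, abs_mul, abs_mul]
      calc |e i| * (|χ z.1| * (|pderiv j ζ z.2| * |Φ z|)) ≤ 1 * (1 * (κ * (κ * N))) := by
            have := hei i; have := hχb z.1; have := hκ.pderiv_le j z.2; have := hΦb z
            gcongr
        _ = _ := by ring
    refine (Finset.abs_sum_le_sum_abs _ _).trans ((Finset.sum_le_sum fun i _ =>
      (Finset.abs_sum_le_sum_abs _ _).trans (Finset.sum_le_sum fun j _ => h1 i j)).trans_eq ?_)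
    simp only [Fin.sum_univ_two]
    ring
  have bH2 : |∫ z in spaceTime Ω T, H2 z| ≤ (8 * κ ^ 2 * N * N + κ ^ 2 * N) * N := by
    refine A.abs_integral_le (w := fun _ => 8 * κ ^ 2 * N) measurable_const
      (fun _ => by positivity) (by positivity) (by positivity) ?_ hH2le
    rw [lintegral_const, Measure.restrict_apply_univ, Real.volume_Ioo,
      ← ENNReal.ofReal_mul (by positivity)]
    refine ENNReal.ofReal_le_ofReal (mul_le_mul_of_nonneg_left ?_ (by positivity))
    linarith [A.time_le]
  have iH2 : IntegrableOn H2 (spaceTime Ω T) := by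
    refine integrable_finsetSum _ fun i _ => integrable_finsetSum _ fun j _ => ?_
    refine Integrable.mul_bdd (c := κ * (κ * N)) (A.integrableOn_fluxTensor i j)
      (Continuous.aestronglyMeasurable ?_) (ae_of_all _ fun z => ?_)
    · have := hΦs.continuous
      exact continuous_const.mul (hχc.mul (((hζ.continuous_pderiv j).comp continuous_snd).mul this))
    · rw [Real.norm_eq_abs, abs_mul, abs_mul, abs_mul]
      calc |e i| * (|χ z.1| * (|pderiv j ζ z.2| * |Φ z|)) ≤ 1 * (1 * (κ * (κ * N))) := by
            have := hei i; have := hχb z.1; have := hκ.pderiv_le j z.2; have := hΦb z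
            gcongr
        _ = _ := by ring
  have iP2 : IntegrableOn P2 (spaceTime Ω T) :=
    Integrable.mul_bdd (c := CS * ∫ w, |a w|)
      (Integrable.bdd_mul (c := 1) (A.integrableOn_cutFlux hζ hκ e) hχc.aestronglyMeasurable
        (ae_of_all _ fun z => hχb _)) hDc.aestronglyMeasurable (ae_of_all _ hDb)
  -- the force and the initial momentum
  have b3 : |∫ z in spaceTime Ω T, ρ z.1 z.2 * (inner ℝ (f z.1 z.2) e * (χ z.1 * ζ z.2 * Φ z))|
      ≤ (κ ^ 2 * N ^ 2 * N + 0) * N := by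
    refine A.abs_integral_le (w := fun _ => κ ^ 2 * N ^ 2) measurable_const
      (fun _ => by positivity) (by positivity) le_rfl ?_ ?_
    · rw [lintegral_const, Measure.restrict_apply_univ, Real.volume_Ioo,
        ← ENNReal.ofReal_mul (by positivity)]
      refine ENNReal.ofReal_le_ofReal (mul_le_mul_of_nonneg_left ?_ (by positivity))
      linarith [A.time_le]
    · filter_upwards [A.density_nonneg, A.force_le] with z hz hf
      rw [zero_mul, add_zero, abs_mul, abs_mul, abs_mul, abs_mul, abs_of_nonneg hz]
      have h1 := (abs_inner_le he (f z.1 z.2)).trans hf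
      have h2 := hχb z.1
      have h3 := hκ.abs_le z.2
      have h4 := hΦb z
      have h5 := density_le_totalDensity (γ := γ) (u := u) A.eps_pos hz
      calc ρ z.1 z.2 * (|inner ℝ (f z.1 z.2) e| * (|χ z.1| * |ζ z.2| * |Φ z|))
          ≤ totalDensity ε γ ρ u z * (N * (1 * κ * (κ * N))) :=
            mul_le_mul h5 (by gcongr) (by positivity) (hz.trans h5)
        _ = _ := by ring
  have b4 : |∫ x in Ω, ρ₀ x * (inner ℝ (u₀ x) e * (χ 0 * ζ x * Φ (0, x)))| ≤ κ ^ 2 * N * N := by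
    rw [← Real.norm_eq_abs]
    refine (norm_integral_le_lintegral_norm _).trans ?_
    refine ENNReal.toReal_le_of_le_ofReal (by positivity) ?_
    calc ∫⁻ x in Ω, ENNReal.ofReal ‖ρ₀ x * (inner ℝ (u₀ x) e * (χ 0 * ζ x * Φ (0, x)))‖
        ≤ ∫⁻ x in Ω, ENNReal.ofReal (κ ^ 2 * N) * (‖ρ₀ x‖ₑ * ‖u₀ x‖ₑ) := by
          refine lintegral_mono fun x => ?_
          rw [← ofReal_norm (ρ₀ x), ← ofReal_norm (u₀ x), ← ENNReal.ofReal_mul (norm_nonneg _),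
            ← ENNReal.ofReal_mul (by positivity)]
          refine ENNReal.ofReal_le_ofReal ?_
          rw [norm_mul, norm_mul, norm_mul, norm_mul]
          have h1 : ‖(inner ℝ (u₀ x) e : ℝ)‖ ≤ ‖u₀ x‖ := abs_inner_le he (u₀ x)
          have h2 : ‖χ 0‖ ≤ 1 := hχb 0
          have h3 : ‖ζ x‖ ≤ κ := hκ.abs_le x
          have h4 : ‖Φ (0, x)‖ ≤ κ * N := hΦb (0, x)
          calc ‖ρ₀ x‖ * (‖(inner ℝ (u₀ x) e : ℝ)‖ * (‖χ 0‖ * ‖ζ x‖ * ‖Φ (0, x)‖))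
              ≤ ‖ρ₀ x‖ * (‖u₀ x‖ * (1 * κ * (κ * N))) := by gcongr
            _ = _ := by ring
      _ ≤ ENNReal.ofReal (κ ^ 2 * N) * ENNReal.ofReal N := by
          rw [lintegral_const_mul' _ _ ENNReal.ofReal_ne_top]
          gcongr
          exact A.initial_momentum_le
      _ = _ := by rw [← ENNReal.ofReal_mul (by positivity)]
  simp_rw [e1, e2] at htest
  rw [integral_sub iH1 iP1, integral_add iH2 iP2] at htest
  have hI2 : ∫ z, χ z.1 * cutFlux Ω T ζ ν₁ ν₂ ε γ ρ u Du e z * D z = ∫ z in spaceTime Ω T, P2 z := by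
    rw [← integral_indicator hQ]
    congr 1; ext z
    by_cases hz : z ∈ spaceTime Ω T <;> simp [cutFlux, hP2, hz]
  have hI1 : ∫ z, χ z.1 * m z * M z = ∫ z in spaceTime Ω T, P1 z := by
    rw [← integral_indicator hQ]
    congr 1; ext z
    by_cases hz : z ∈ spaceTime Ω T <;> simp [hm, cutMomentum, hP1, hz]
  rw [hI1, hI2]
  have q1 := (neg_le_abs _).trans bH1
  have q2 := (neg_le_abs _).trans bH2
  have q3 := (neg_le_abs _).trans b3
  have q4 := (neg_le_abs _).trans b4
  have p2 : N ≤ N ^ 2 := by nlinarith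
  have p3 : N ^ 2 ≤ N ^ 3 := by nlinarith [sq_nonneg N]
  have p4 : N ^ 3 ≤ N ^ 4 := by nlinarith [pow_pos hN 3]
  have hk2 : 0 < κ ^ 2 := by positivity
  have hfinal : (κ ^ 2 * N * (2 + 2 * N) + 0) * N + (8 * κ ^ 2 * N * N + κ ^ 2 * N) * N
      + (κ ^ 2 * N ^ 2 * N + 0) * N + κ ^ 2 * N * N ≤ 20 * κ ^ 2 * N ^ 4 := by
    have : (κ ^ 2 * N * (2 + 2 * N) + 0) * N + (8 * κ ^ 2 * N * N + κ ^ 2 * N) * N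
      + (κ ^ 2 * N ^ 2 * N + 0) * N + κ ^ 2 * N * N
      = κ ^ 2 * (4 * N ^ 2 + 10 * N ^ 3 + N ^ 4) := by ring
    rw [this, show 20 * κ ^ 2 * N ^ 4 = κ ^ 2 * (20 * N ^ 4) by ring]
    exact mul_le_mul_of_nonneg_left (by linarith) hk2.le
  linarith

end AprioriBound

end MollifiedInequality

/-! ### Removing the mollification in time -/

section TimeLimit

/-- A bump function at the origin of the time axis, of outer radius `1 / (n + 1)`; the ratio of the
radii is fixed, as the differentiation theorem requires. -/
noncomputable def timeBump (n : ℕ) : ContDiffBump (0 : ℝ) where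
  rIn := 1 / (2 * ((n : ℝ) + 1))
  rOut := 1 / ((n : ℝ) + 1)
  rIn_pos := by positivity
  rIn_lt_rOut := by
    have : (0 : ℝ) < (n : ℝ) + 1 := by positivity
    exact one_div_lt_one_div_of_lt this (by linarith)

/-- The corresponding approximate identity. -/
noncomputable def timeMollifier (n : ℕ) : ℝ → ℝ := (timeBump n).normed volume

lemma isTimeMollifier_timeMollifier (n : ℕ) :
    IsTimeMollifier (timeMollifier n) (1 / ((n : ℝ) + 1)) where
  pos := by positivity
  smooth := (timeBump n).contDiff_normed
  compact := (timeBump n).hasCompactSupport_normed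
  nonneg := (timeBump n).nonneg_normed
  integral := (timeBump n).integral_normed
  zero := fun t ht => by
    have h : t ∉ Function.support ((timeBump n).normed volume) := by
      rw [ContDiffBump.support_normed_eq]
      simpa [Real.norm_eq_abs, timeBump] using ht
    exact Function.notMem_support.1 h

variable {b c : ℝ} {e : Plane} {q a a' : ℝ × Plane → ℝ} {θ χ : ℝ → ℝ} {h : ℝ}

lemma ae_integrable_slice (ha : Integrable a) : ∀ᵐ t, Integrable fun x : Plane => a (t, x) := by
  rw [Measure.volume_eq_prod] at ha
  exact ha.prod_right_ae

lemma integrable_mul_gaussKernel_snd (hb : 0 < b) (ha : Integrable a) (x : Plane) :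
    Integrable fun w : ℝ × Plane => a w * gaussKernel b (inner ℝ e (x - w.2)) := by
  refine ha.mul_bdd (c := √(b / Real.pi))
    ((continuous_gaussKernel b).comp (by fun_prop)).aestronglyMeasurable (ae_of_all _ fun y => ?_)
  rw [Real.norm_of_nonneg (gaussKernel_nonneg _ _)]
  exact gaussKernel_le hb _

lemma integrable_dirPot_slice (hb : 0 < b) (ha : Integrable a) (x : Plane) :
    Integrable fun t => dirPot b e (fun y => a (t, y)) x := by
  have h1 := integrable_mul_gaussKernel_snd (e := e) hb ha x
  rw [Measure.volume_eq_prod] at h1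
  exact h1.integral_prod_left

/-- The mollified strip integral is the convolution in time of the strip integrals at fixed times. -/
lemma stConv_stripKernel (hθ : IsTimeMollifier θ h) (hb : 0 < b) (ha : Integrable a)
    (z : ℝ × Plane) :
    stConv a (stripKernel θ b e) z
      = ∫ s, θ (z.1 - s) * dirPot b e (fun y => a (s, y)) z.2 := by
  obtain ⟨C, hC⟩ := hθ.exists_stripKernel_le hb e
  have h1 : Integrable fun w : ℝ × Plane => a w * stripKernel θ b e (z - w) :=
    integrableOn_univ.1 (integrableOn_mul_kernel ha.integrableOn
      (continuous_stripKernel hθ.smooth.continuous b e) hC z)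
  rw [Measure.volume_eq_prod] at h1
  rw [stConv, Measure.volume_eq_prod, integral_prod _ h1]
  congr 1; ext s
  rw [dirPot, ← integral_const_mul]
  congr 1; ext y
  simp only [stripKernel, Prod.fst_sub, Prod.snd_sub]
  ring

lemma abs_stConv_stripKernel_le (hθ : IsTimeMollifier θ h) (hb : 0 < b) (ha : Integrable a)
    (hac : ∀ᵐ t, ∫ x : Plane, |a (t, x)| ≤ c) (z : ℝ × Plane) :
    |stConv a (stripKernel θ b e) z| ≤ √(b / Real.pi) * c := by
  have hθi : Integrable fun s => θ (z.1 - s) :=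
    (hθ.smooth.continuous.integrable_of_hasCompactSupport hθ.compact).comp_sub_left z.1
  rw [stConv_stripKernel hθ hb ha, ← Real.norm_eq_abs]
  refine (norm_integral_le_of_norm_le (hθi.mul_const (√(b / Real.pi) * c)) ?_).trans_eq ?_
  · filter_upwards [hac, ae_integrable_slice ha] with s hs hs'
    rw [norm_mul, Real.norm_of_nonneg (hθ.nonneg _)]
    exact mul_le_mul_of_nonneg_left ((abs_dirPot_le hb hs' _).trans
      (mul_le_mul_of_nonneg_left hs (Real.sqrt_nonneg _))) (hθ.nonneg _)
  · rw [integral_mul_const, integral_sub_left_eq_self (fun s => θ s), hθ.integral, one_mul]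

/-- Almost everywhere in space-time, the mollified strip integrals converge to the strip
integrals at fixed time. -/
lemma ae_tendsto_stConv (hb : 0 < b) (ha : Integrable a) :
    ∀ᵐ z : ℝ × Plane, Tendsto (fun n => stConv a (stripKernel (timeMollifier n) b e) z) atTop
      (𝓝 (dirPot b e (fun y => a (z.1, y)) z.2)) := by
  -- a jointly measurable representative, for which the convergence set is measurable
  obtain ⟨a', ha'm, haa'⟩ := ha.aestronglyMeasurable
  have ha' : Integrable a' := ha.congr haa'
  have hslice : ∀ᵐ t, (fun y => a (t, y)) =ᵐ[volume] fun y => a' (t, y) := by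
    rw [Measure.volume_eq_prod] at haa'
    exact Measure.ae_ae_of_ae_prod haa'
  have hpot : ∀ᵐ z : ℝ × Plane, dirPot b e (fun y => a (z.1, y)) z.2
      = dirPot b e (fun y => a' (z.1, y)) z.2 := by
    rw [Measure.volume_eq_prod]
    filter_upwards [Measure.quasiMeasurePreserving_fst.ae hslice] with z hz
    refine integral_congr_ae ?_
    filter_upwards [hz] with y hy
    rw [hy]
  have hconv : ∀ n z, stConv a (stripKernel (timeMollifier n) b e) z
      = stConv a' (stripKernel (timeMollifier n) b e) z := fun n z => by
    refine integral_congr_ae ?_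
    filter_upwards [haa'] with y hy
    rw [hy]
  have hm : Measurable fun z : ℝ × Plane => dirPot b e (fun y => a' (z.1, y)) z.2 := by
    have h1 : StronglyMeasurable fun p : (ℝ × Plane) × Plane =>
        a' (p.1.1, p.2) * gaussKernel b (inner ℝ e (p.1.2 - p.2)) :=
      (ha'm.comp_measurable (by fun_prop)).mul
        ((continuous_gaussKernel b).comp (by fun_prop)).stronglyMeasurable
    exact h1.integral_prod_right.measurable
  have hmn : ∀ n, Measurable (stConv a' (stripKernel (timeMollifier n) b e)) := fun n => by
    have hθ := isTimeMollifier_timeMollifier n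
    obtain ⟨C, hC⟩ := hθ.exists_stripKernel_le hb e
    exact (continuous_stConv ha' (continuous_stripKernel hθ.smooth.continuous b e) hC).measurable
  have hset : MeasurableSet {z : ℝ × Plane | Tendsto
      (fun n => stConv a' (stripKernel (timeMollifier n) b e) z) atTop
      (𝓝 (dirPot b e (fun y => a' (z.1, y)) z.2))} :=
    measurableSet_tendsto_fun hmn hm
  have key : ∀ᵐ z : ℝ × Plane, Tendsto
      (fun n => stConv a' (stripKernel (timeMollifier n) b e) z) atTop
      (𝓝 (dirPot b e (fun y => a' (z.1, y)) z.2)) := by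
    have hswap : MeasurableSet (Prod.swap ⁻¹' {z : ℝ × Plane | Tendsto
      (fun n => stConv a' (stripKernel (timeMollifier n) b e) z) atTop
      (𝓝 (dirPot b e (fun y => a' (z.1, y)) z.2))} : Set (Plane × ℝ)) := measurable_swap hset
    have h2 : ∀ᵐ p : Plane × ℝ ∂((volume : Measure Plane).prod (volume : Measure ℝ)),
        Tendsto (fun n => stConv a' (stripKernel (timeMollifier n) b e) p.swap) atTop
          (𝓝 (dirPot b e (fun y => a' (p.swap.1, y)) p.swap.2)) := by
      refine (Measure.ae_prod_mem_iff_ae_ae_mem hswap).2 (ae_of_all _ fun x => ?_)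
      have h3 := ContDiffBump.ae_convolution_tendsto_right_of_locallyIntegrable
        (μ := (volume : Measure ℝ)) (φ := timeBump) (l := atTop) (K := 2)
        (g := fun t => dirPot b e (fun y => a' (t, y)) x)
        (by simpa [timeBump] using tendsto_one_div_add_atTop_nhds_zero_nat (𝕜 := ℝ))
        (Eventually.of_forall fun n => by
          simp only [timeBump]
          refine le_of_eq ?_
          field_simp) (integrable_dirPot_slice hb ha' x).locallyIntegrable
      filter_upwards [h3] with t ht
      refine ht.congr fun n => ?_
      rw [Prod.swap_prod_mk, stConv_stripKernel (isTimeMollifier_timeMollifier n) hb ha',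
        convolution_lsmul_swap]
      rfl
    have h4 := (Measure.measurePreserving_swap (μ := (volume : Measure ℝ))
      (ν := (volume : Measure Plane))).quasiMeasurePreserving.ae h2
    rw [Measure.volume_eq_prod]
    filter_upwards [h4] with z hz using hz
  filter_upwards [key, hpot] with z h1 h2
  simpa only [h2, hconv] using h1

/-- The limit of the interaction energies when the mollification in time is removed. -/
lemma tendsto_integral_stConv (hb : 0 < b) (hq : Integrable q) (ha : Integrable a)
    (hac : ∀ᵐ t, ∫ x : Plane, |a (t, x)| ≤ c) (hχ : Continuous χ) (hχ1 : ∀ t, |χ t| ≤ 1) :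
    (Integrable fun t => χ t * dirForm b e (fun x => q (t, x)) fun x => a (t, x)) ∧
    Tendsto (fun n => ∫ z : ℝ × Plane, χ z.1 * q z * stConv a (stripKernel (timeMollifier n) b e) z)
      atTop (𝓝 (∫ t, χ t * dirForm b e (fun x => q (t, x)) fun x => a (t, x))) := by
  have hlim := ae_tendsto_stConv (e := e) hb ha
  have hχc : Continuous fun z : ℝ × Plane => χ z.1 := hχ.comp continuous_fst
  have hχq : Integrable fun z : ℝ × Plane => χ z.1 * q z :=
    hq.bdd_mul (c := 1) hχc.aestronglyMeasurable (ae_of_all _ fun z => hχ1 _)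
  have hcont : ∀ n, Continuous (stConv a (stripKernel (timeMollifier n) b e)) := fun n => by
    have hθ := isTimeMollifier_timeMollifier n
    obtain ⟨C, hC⟩ := hθ.exists_stripKernel_le hb e
    exact continuous_stConv ha (continuous_stripKernel hθ.smooth.continuous b e) hC
  have hbd : ∀ n z, ‖χ z.1 * q z * stConv a (stripKernel (timeMollifier n) b e) z‖
      ≤ ‖χ z.1 * q z‖ * (√(b / Real.pi) * c) := fun n z => by
    rw [norm_mul]
    exact mul_le_mul_of_nonneg_left
      (abs_stConv_stripKernel_le (isTimeMollifier_timeMollifier n) hb ha hac z) (norm_nonneg _)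
  have hmeas : ∀ n, AEStronglyMeasurable
      (fun z => χ z.1 * q z * stConv a (stripKernel (timeMollifier n) b e) z) volume := fun n =>
    hχq.aestronglyMeasurable.mul (hcont n).aestronglyMeasurable
  have hlim' : ∀ᵐ z : ℝ × Plane, Tendsto
      (fun n => χ z.1 * q z * stConv a (stripKernel (timeMollifier n) b e) z) atTop
      (𝓝 (χ z.1 * q z * dirPot b e (fun y => a (z.1, y)) z.2)) := by
    filter_upwards [hlim] with z hz using hz.const_mul _
  have hint : Integrable fun z : ℝ × Plane =>
      χ z.1 * q z * dirPot b e (fun y => a (z.1, y)) z.2 := by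
    refine (hχq.norm.mul_const (√(b / Real.pi) * c)).mono'
      (aestronglyMeasurable_of_tendsto_ae _ hmeas hlim') ?_
    filter_upwards [hlim'] with z hz
    exact le_of_tendsto hz.norm (Eventually.of_forall fun n => hbd n z)
  have hD := tendsto_integral_of_dominated_convergence _ hmeas
    (hχq.norm.mul_const (√(b / Real.pi) * c)) (fun n => ae_of_all _ (hbd n)) hlim'
  have hslice : (fun t => ∫ x, χ t * q (t, x) * dirPot b e (fun y => a (t, y)) x)
      =ᵐ[volume] fun t => χ t * dirForm b e (fun x => q (t, x)) fun x => a (t, x) := by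
    filter_upwards [ae_integrable_slice hq, ae_integrable_slice ha] with t h1 h2
    rw [dirForm_eq_integral hb h1 h2, ← integral_const_mul]
    congr 1; ext x; ring
  rw [Measure.volume_eq_prod] at hint
  refine ⟨hint.integral_prod_left.congr hslice, ?_⟩
  rw [← integral_congr_ae hslice]
  rw [Measure.volume_eq_prod, integral_prod _ hint] at hD
  rw [Measure.volume_eq_prod]
  exact hD

lemma IsTimeCutoff.mono {T τ τ' : ℝ} (hχ : IsTimeCutoff T χ τ) (hτ : τ' ≤ τ) :
    IsTimeCutoff T χ τ' :=
  ⟨hχ.smooth, hχ.nonneg, hχ.le_one, hχ.variation, fun t ht => hχ.zero t (by linarith)⟩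

end TimeLimit

section LimitInequality

variable {Ω : Set Plane} {T ν₁ ν₂ ε γ : ℝ} {ρ₀ : Plane → ℝ} {u₀ : Plane → Plane}
  {f : ℝ → Plane → Plane} {ρ : ℝ → Plane → ℝ} {u : ℝ → Plane → Plane}
  {Du : ℝ → Plane → Fin 2 → Fin 2 → ℝ} {N : ℝ} {ζ : Plane → ℝ} {κ b τ : ℝ} {e : Plane}
  {χ : ℝ → ℝ}

namespace AprioriBound

variable (A : AprioriBound Ω T ν₁ ν₂ ε γ ρ₀ u₀ f ρ u Du N)

include A

/-- A localized function dominated by the total density is bounded in `L^∞(0, T; L¹)`. -/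
lemma integral_abs_slice_le (hΩ : IsOpen Ω) {g : ℝ × Plane → ℝ} {c : ℝ} (hc : 0 ≤ c)
    (hg : ∀ᵐ z ∂(volume.restrict (spaceTime Ω T)), |g z| ≤ c * totalDensity ε γ ρ u z) :
    ∀ᵐ t, ∫ x : Plane, |(spaceTime Ω T).indicator g (t, x)| ≤ c * N := by
  have hcN : 0 ≤ c * N := mul_nonneg hc A.N_pos.le
  have h1 : ∀ᵐ t ∂(volume.restrict (Ioo 0 T)), ∀ᵐ x ∂(volume.restrict Ω),
      |g (t, x)| ≤ c * totalDensity ε γ ρ u (t, x) := by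
    rw [volume_restrict_spaceTime] at hg
    exact Measure.ae_ae_of_ae_prod hg
  have h2 := A.density_le
  rw [ae_restrict_iff' measurableSet_Ioo] at h1 h2
  filter_upwards [h1, h2] with t ht1 ht2
  by_cases ht : t ∈ Ioo 0 T
  · have he : ∀ x, |(spaceTime Ω T).indicator g (t, x)| = Ω.indicator (fun x => |g (t, x)|) x := by
      intro x
      by_cases hx : x ∈ Ω <;> simp [spaceTime, indicator, ht.1, ht.2, hx]
    simp_rw [he]
    rw [integral_indicator hΩ.measurableSet]
    refine (le_abs_self _).trans ?_
    rw [← Real.norm_eq_abs]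
    refine (norm_integral_le_lintegral_norm _).trans ?_
    refine ENNReal.toReal_le_of_le_ofReal hcN ?_
    calc ∫⁻ x in Ω, ENNReal.ofReal ‖|g (t, x)|‖
        ≤ ∫⁻ x in Ω, ENNReal.ofReal c * ENNReal.ofReal (totalDensity ε γ ρ u (t, x)) := by
          refine lintegral_mono_ae ?_
          filter_upwards [ht1 ht] with x hx
          rw [Real.norm_eq_abs, abs_abs, ← ENNReal.ofReal_mul hc]
          exact ENNReal.ofReal_le_ofReal hx
      _ ≤ ENNReal.ofReal c * ENNReal.ofReal N := by
          rw [lintegral_const_mul' _ _ ENNReal.ofReal_ne_top]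
          gcongr
          exact ht2 ht
      _ = _ := by rw [← ENNReal.ofReal_mul hc]
  · have he : ∀ x, (spaceTime Ω T).indicator g (t, x) = 0 := fun x =>
      indicator_of_notMem (fun h => ht h.1) _
    simpa [he] using hcN

/-- The localized momentum inequality at fixed times: the interaction of the momentum flux with
the density exceeds the self-interaction of the momentum by at most a constant. -/
lemma flux_sub_momentum_le (hΩ : IsOpen Ω)
    (hmom : MomentumBalance Ω T ν₁ ν₂ ε γ ρ₀ u₀ f ρ u Du)
    (hmass : RenormalizedMassBalance Ω T ρ₀ ρ u Du)
    (hζ : IsCutoff Ω ζ) (hκ : CutoffBound ζ κ) (hb : 0 < b)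
    (he : ‖e‖ = 1) (hτ : 0 < τ) (hχ : IsTimeCutoff T χ τ) :
    Integrable (fun t => χ t * (dirForm b e (fun x => cutFlux Ω T ζ ν₁ ν₂ ε γ ρ u Du e (t, x))
        (fun x => cutDensity Ω T ζ ρ (t, x))
      - dirForm b e (fun x => cutMomentum Ω T ζ ρ u e (t, x))
        (fun x => cutMomentum Ω T ζ ρ u e (t, x)))) ∧
    ∫ t, χ t * (dirForm b e (fun x => cutFlux Ω T ζ ν₁ ν₂ ε γ ρ u Du e (t, x))
        (fun x => cutDensity Ω T ζ ρ (t, x))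
      - dirForm b e (fun x => cutMomentum Ω T ζ ρ u e (t, x))
        (fun x => cutMomentum Ω T ζ ρ u e (t, x))) ≤ 20 * κ ^ 2 * N ^ 4 := by
  have hκ0 : 0 ≤ κ := zero_le_one.trans hκ.one_le
  have hχ1 : ∀ t, |χ t| ≤ 1 := fun t => by
    rw [abs_of_nonneg (hχ.nonneg t)]; exact hχ.le_one t
  have ha := A.integrable_cutDensity hΩ hζ hκ
  have hm := A.integrable_cutMomentum hΩ hζ hκ he
  have hq := A.integrable_cutFlux hΩ hζ hκ e
  have hac : ∀ᵐ t, ∫ x : Plane, |cutDensity Ω T ζ ρ (t, x)| ≤ κ * N := by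
    refine A.integral_abs_slice_le hΩ hκ0 ?_
    filter_upwards [A.density_nonneg] with z hz
    rw [abs_mul, abs_of_nonneg hz]
    exact mul_le_mul (hκ.abs_le _) (density_le_totalDensity A.eps_pos hz) hz hκ0
  have hmc : ∀ᵐ t, ∫ x : Plane, |cutMomentum Ω T ζ ρ u e (t, x)| ≤ κ * N := by
    refine A.integral_abs_slice_le hΩ hκ0 ?_
    filter_upwards [A.abs_momentum_le he] with z hz
    rw [abs_mul]
    exact mul_le_mul (hκ.abs_le _) hz (abs_nonneg _) hκ0
  obtain ⟨i1, l1⟩ := tendsto_integral_stConv (e := e) hb hq ha hac hχ.smooth.continuous hχ1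
  obtain ⟨i2, l2⟩ := tendsto_integral_stConv (e := e) hb hm hm hmc hχ.smooth.continuous hχ1
  simp_rw [mul_sub]
  refine ⟨i1.sub i2, ?_⟩
  rw [integral_sub i1 i2]
  refine le_of_tendsto (l1.sub l2) ?_
  have hsmall : ∀ᶠ n : ℕ in atTop, 2 * (1 / ((n : ℝ) + 1)) < τ := by
    have := (tendsto_one_div_add_atTop_nhds_zero_nat (𝕜 := ℝ)).const_mul 2
    rw [mul_zero] at this
    exact this.eventually_lt_const hτ
  filter_upwards [hsmall] with n hn
  exact A.mollified_flux_sub_momentum_le hΩ hmom hmass hζ hκ (isTimeMollifier_timeMollifier n) hb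
    he (hχ.mono hn.le)

end AprioriBound

end LimitInequality

/-! ### The directional energy bound -/

section DirectionalBound

/-- The self-interaction of the density `a` is bounded by the interaction of the flux `q` with `a`, if
`q` dominates the sum of the transport term, the density and minus the stress `g`. -/
lemma dirForm_self_le_of_flux {b : ℝ} {e : Plane} (hb : 0 < b) {a v g q : Plane → ℝ}
    (ha : Integrable a) (hav : Integrable fun x => a x * v x)
    (hav2 : Integrable fun x => a x * v x ^ 2) (hg : Integrable g) (hq : Integrable q)
    (h0 : ∀ᵐ x, 0 ≤ a x) (hle : ∀ᵐ x, a x * v x ^ 2 + a x - g x ≤ q x) :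
    dirForm b e a a ≤ 2 * (dirForm b e q a
      - dirForm b e (fun x => a x * v x) fun x => a x * v x) + dirForm b e g g := by
  have hs : Integrable fun x => a x * v x ^ 2 + a x := hav2.add ha
  have h1 := dirForm_mono_left (e := e) hb (hs.sub hg) hq ha hle h0
  have h2 : dirForm b e ((fun x => a x * v x ^ 2 + a x) - g) a
      = dirForm b e (fun x => a x * v x ^ 2) a + dirForm b e a a - dirForm b e g a := by
    rw [← dirForm_add_left hb hav2 ha ha, ← dirForm_sub_left hb hs hg ha]
    rfl
  have h3 := dirForm_momentum_le (e := e) hb ha hav hav2 h0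
  have h4 := two_mul_dirForm_le (e := e) hb hg ha
  linarith

/-- The component `ζ S(u) : e ⊗ e` of the localized viscous stress, extended by zero. -/
noncomputable def cutStress (Ω : Set Plane) (T : ℝ) (ζ : Plane → ℝ) (ν₁ ν₂ : ℝ)
    (Du : ℝ → Plane → Fin 2 → Fin 2 → ℝ) (e : Plane) : ℝ × Plane → ℝ :=
  (spaceTime Ω T).indicator fun z =>
    ζ z.2 * ∑ i, ∑ j, stress ν₁ ν₂ (Du z.1 z.2) i j * (e i * e j)

variable {Ω : Set Plane} {T ν₁ ν₂ ε γ : ℝ} {ρ₀ : Plane → ℝ} {u₀ : Plane → Plane}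
  {f : ℝ → Plane → Plane} {ρ : ℝ → Plane → ℝ} {u : ℝ → Plane → Plane}
  {Du : ℝ → Plane → Fin 2 → Fin 2 → ℝ} {N : ℝ} {ζ : Plane → ℝ} {κ b τ : ℝ} {e : Plane}
  {χ : ℝ → ℝ}

lemma sum_apply_sq (he : ‖e‖ = 1) : e 0 ^ 2 + e 1 ^ 2 = 1 := by
  have := EuclideanSpace.real_norm_sq_eq e
  rw [he, Fin.sum_univ_two] at this
  linarith

lemma sum_fluxTensor_mul (he : ‖e‖ = 1) (z : ℝ × Plane) :
    ∑ i, ∑ j, fluxTensor ν₁ ν₂ ε γ ρ u Du z i j * (e i * e j)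
      = ρ z.1 z.2 * inner ℝ (u z.1 z.2) e ^ 2 + pressure ε γ (ρ z.1 z.2)
        - ∑ i, ∑ j, stress ν₁ ν₂ (Du z.1 z.2) i j * (e i * e j) := by
  have h3 : inner ℝ (u z.1 z.2) e = u z.1 z.2 0 * e 0 + u z.1 z.2 1 * e 1 := by
    rw [PiLp.inner_apply, Fin.sum_univ_two]
    simp [mul_comm]
  have h4 := sum_apply_sq he
  rw [h3]
  simp only [fluxTensor, Fin.sum_univ_two]
  simp
  linear_combination (pressure ε γ (ρ z.1 z.2)) * h4

lemma sq_sum_stress_le (he : ‖e‖ = 1) (S : Fin 2 → Fin 2 → ℝ) :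
    (∑ i, ∑ j, S i j * (e i * e j)) ^ 2 ≤ ∑ i, ∑ j, S i j ^ 2 := by
  have h4 := sum_apply_sq he
  have h5 := Finset.sum_mul_sq_le_sq_mul_sq (Finset.univ : Finset (Fin 2 × Fin 2))
    (fun p => S p.1 p.2) (fun p => e p.1 * e p.2)
  simp only [Fintype.sum_prod_type] at h5
  have h6 : ∑ i : Fin 2, ∑ j : Fin 2, (e i * e j) ^ 2 = 1 := by
    simp only [Fin.sum_univ_two]
    linear_combination (e 0 ^ 2 + e 1 ^ 2 + 1) * h4
  rwa [h6, mul_one] at h5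

/-- Smooth functions increasing to the indicator function of `(-∞, T)`. -/
noncomputable def endCutoff (T : ℝ) (n : ℕ) (t : ℝ) : ℝ :=
  Real.smoothTransition (((n : ℝ) + 1) * (T - t) - 1)

lemma isTimeCutoff_endCutoff (hT : 0 ≤ T) (n : ℕ) :
    IsTimeCutoff T (endCutoff T n) (1 / ((n : ℝ) + 1)) := by
  have hn : (0 : ℝ) < (n : ℝ) + 1 := by positivity
  have hs : ContDiff ℝ ∞ (endCutoff T n) :=
    Real.smoothTransition.contDiff.comp (by fun_prop)
  have hanti : Antitone (endCutoff T n) := fun s t hst => by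
    refine Real.smoothTransition.monotone ?_
    have := mul_le_mul_of_nonneg_left hst hn.le
    linarith
  have hd : ∀ t, deriv (endCutoff T n) t ≤ 0 := fun t => hanti.deriv_nonpos
  refine ⟨hs, fun t => Real.smoothTransition.nonneg _, fun t => Real.smoothTransition.le_one _,
    ?_, fun t ht => ?_⟩
  · have hdc : Continuous (deriv (endCutoff T n)) := hs.continuous_deriv (by simp)
    have hi : IntegrableOn (fun t => -deriv (endCutoff T n) t) (Ioo 0 T) :=
      (hdc.neg.continuousOn.integrableOn_Icc).mono_set Ioo_subset_Icc_self
    have h1 : ∀ t, |deriv (endCutoff T n) t| = -deriv (endCutoff T n) t := fun t =>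
      abs_of_nonpos (hd t)
    simp_rw [h1]
    rw [← ofReal_integral_eq_lintegral_ofReal hi (ae_of_all _ fun t => neg_nonneg.2 (hd t)),
      ← integral_Ioc_eq_integral_Ioo, ← intervalIntegral.integral_of_le hT,
      intervalIntegral.integral_neg, intervalIntegral.integral_deriv_eq_sub
        (fun t _ => (hs.differentiable (by simp)) t) (hdc.intervalIntegrable _ _)]
    refine ENNReal.ofReal_le_one.2 ?_
    have h2 : endCutoff T n 0 ≤ 1 := Real.smoothTransition.le_one _
    have h3 : 0 ≤ endCutoff T n T := Real.smoothTransition.nonneg _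
    linarith
  · refine Real.smoothTransition.zero_of_nonpos ?_
    have h1 : ((n : ℝ) + 1) * (T - t) ≤ ((n : ℝ) + 1) * (1 / ((n : ℝ) + 1)) :=
      mul_le_mul_of_nonneg_left (by linarith) hn.le
    rw [mul_one_div_cancel hn.ne'] at h1
    linarith

lemma eventually_endCutoff_eq_one {t : ℝ} (ht : t < T) : ∀ᶠ n in atTop, endCutoff T n t = 1 := by
  have h1 : Tendsto (fun n : ℕ => ((n : ℝ) + 1) * (T - t)) atTop atTop :=
    (tendsto_atTop_add_const_right _ _ tendsto_natCast_atTop_atTop).atTop_mul_const (sub_pos.2 ht)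
  filter_upwards [h1.eventually_ge_atTop 2] with n hn
  exact Real.smoothTransition.one_of_one_le (by linarith)

namespace AprioriBound

variable (A : AprioriBound Ω T ν₁ ν₂ ε γ ρ₀ u₀ f ρ u Du N)

include A

lemma cutStress_meas (hΩ : IsOpen Ω) (hζ : IsCutoff Ω ζ) (e : Plane) :
    AEStronglyMeasurable (cutStress Ω T ζ ν₁ ν₂ Du e) volume := by
  refine (aestronglyMeasurable_indicator_iff (measurableSet_spaceTime hΩ T)).2 ?_
  refine (hζ.smooth.continuous.comp continuous_snd).aestronglyMeasurable.mul ?_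
  exact Finset.aestronglyMeasurable_fun_sum _ fun i _ =>
    Finset.aestronglyMeasurable_fun_sum _ fun j _ => (A.stress_meas i j).mul_const _

lemma integrable_cutStress (hΩ : IsOpen Ω) (hζ : IsCutoff Ω ζ) (hκ : CutoffBound ζ κ)
    (e : Plane) : Integrable (cutStress Ω T ζ ν₁ ν₂ Du e) := by
  refine (integrable_indicator_iff (measurableSet_spaceTime hΩ T)).2 ?_
  have h1 : IntegrableOn (fun z : ℝ × Plane =>
      ∑ i, ∑ j, stress ν₁ ν₂ (Du z.1 z.2) i j * (e i * e j)) (spaceTime Ω T) :=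
    integrable_finsetSum _ fun i _ => integrable_finsetSum _ fun j _ =>
      (A.integrableOn_stress i j).mul_const _
  exact Integrable.bdd_mul (c := κ) h1
    (hζ.smooth.continuous.comp continuous_snd).aestronglyMeasurable
    (ae_of_all _ fun z => hκ.abs_le _)

lemma lintegral_cutStress_sq_le (hΩ : IsOpen Ω) (hκ : CutoffBound ζ κ) (he : ‖e‖ = 1) :
    ∫⁻ z, ENNReal.ofReal (cutStress Ω T ζ ν₁ ν₂ Du e z ^ 2) ≤ ENNReal.ofReal (κ ^ 2 * N) := by
  have hκ0 : 0 ≤ κ := zero_le_one.trans hκ.one_le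
  calc ∫⁻ z, ENNReal.ofReal (cutStress Ω T ζ ν₁ ν₂ Du e z ^ 2)
      = ∫⁻ z in spaceTime Ω T, ENNReal.ofReal
        ((ζ z.2 * ∑ i, ∑ j, stress ν₁ ν₂ (Du z.1 z.2) i j * (e i * e j)) ^ 2) := by
        rw [← lintegral_indicator (measurableSet_spaceTime hΩ T)]
        refine lintegral_congr fun z => ?_
        by_cases hz : z ∈ spaceTime Ω T <;> simp [cutStress, hz]
    _ ≤ ∫⁻ z in spaceTime Ω T, ENNReal.ofReal (κ ^ 2)
        * ENNReal.ofReal (∑ i, ∑ j, stress ν₁ ν₂ (Du z.1 z.2) i j ^ 2) := by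
        refine lintegral_mono fun z => ?_
        rw [← ENNReal.ofReal_mul (sq_nonneg κ), mul_pow]
        refine ENNReal.ofReal_le_ofReal (mul_le_mul ?_ (sq_sum_stress_le he _) (sq_nonneg _)
          (sq_nonneg _))
        rw [← sq_abs (ζ z.2)]
        exact pow_le_pow_left₀ (abs_nonneg _) (hκ.abs_le _) 2
    _ ≤ ENNReal.ofReal (κ ^ 2) * ENNReal.ofReal N := by
        rw [lintegral_const_mul' _ _ ENNReal.ofReal_ne_top]
        gcongr
        exact A.stress_sq_le
    _ = _ := by rw [← ENNReal.ofReal_mul (sq_nonneg κ)]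

/-- The interaction inequality at almost every fixed time: the pressure term controls the
self-interaction of the density, and the transport term is absorbed by convexity. -/
lemma dirForm_cutDensity_le (hΩ : IsOpen Ω) (hζ : IsCutoff Ω ζ) (hκ : CutoffBound ζ κ)
    (hb : 0 < b) (he : ‖e‖ = 1) :
    ∀ᵐ t, dirForm b e (fun x => cutDensity Ω T ζ ρ (t, x)) (fun x => cutDensity Ω T ζ ρ (t, x))
      ≤ 2 * (dirForm b e (fun x => cutFlux Ω T ζ ν₁ ν₂ ε γ ρ u Du e (t, x))
          (fun x => cutDensity Ω T ζ ρ (t, x))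
        - dirForm b e (fun x => cutMomentum Ω T ζ ρ u e (t, x))
          (fun x => cutMomentum Ω T ζ ρ u e (t, x)))
        + 2 * κ * ∫ x, cutStress Ω T ζ ν₁ ν₂ Du e (t, x) ^ 2 := by
  have hκ0 : 0 ≤ κ := zero_le_one.trans hκ.one_le
  have hQ := measurableSet_spaceTime hΩ T
  set v : ℝ × Plane → ℝ := fun z => inner ℝ (u z.1 z.2) e with hv
  have hmv : ∀ z, cutMomentum Ω T ζ ρ u e z = cutDensity Ω T ζ ρ z * v z := fun z => by
    by_cases hz : z ∈ spaceTime Ω T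
    · simp [cutMomentum, cutDensity, hz, hv, mul_assoc]
    · simp [cutMomentum, cutDensity, hz]
  have iv2 : Integrable fun z => cutDensity Ω T ζ ρ z * v z ^ 2 := by
    have h1 : IntegrableOn (fun z : ℝ × Plane => ζ z.2 * ρ z.1 z.2 * v z ^ 2)
        (spaceTime Ω T) := by
      refine A.integrableOn_of_le (c := κ) (((hζ.smooth.continuous.comp
        continuous_snd).aestronglyMeasurable.mul A.density_meas).mul
        ((A.velocity_meas.inner aestronglyMeasurable_const).pow 2)) ?_
      filter_upwards [A.density_nonneg] with z hz
      rw [mul_assoc, abs_mul]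
      refine mul_le_mul (hκ.abs_le _) ?_ (abs_nonneg _) hκ0
      rw [abs_mul, abs_of_nonneg hz, abs_pow]
      refine (mul_le_mul_of_nonneg_left ?_ hz).trans
        (energyDensity_le_totalDensity (γ := γ) A.eps_pos hz)
      exact pow_le_pow_left₀ (abs_nonneg _) (abs_inner_le he _) 2
    refine ((integrable_indicator_iff hQ).2 h1).congr (ae_of_all _ fun z => ?_)
    by_cases hz : z ∈ spaceTime Ω T <;> simp [cutDensity, hz]
  have ig2 : Integrable fun z => cutStress Ω T ζ ν₁ ν₂ Du e z ^ 2 := by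
    refine ⟨(A.cutStress_meas hΩ hζ e).pow 2, ?_⟩
    rw [hasFiniteIntegral_iff_ofReal (ae_of_all _ fun z => sq_nonneg _)]
    exact (A.lintegral_cutStress_sq_le hΩ hκ he).trans_lt ENNReal.ofReal_lt_top
  -- the artificial pressure only helps: `ϱ ≤ p(ϱ)`
  have hpt : ∀ᵐ z : ℝ × Plane, 0 ≤ cutDensity Ω T ζ ρ z ∧
      cutDensity Ω T ζ ρ z * v z ^ 2 + cutDensity Ω T ζ ρ z - cutStress Ω T ζ ν₁ ν₂ Du e z
        ≤ cutFlux Ω T ζ ν₁ ν₂ ε γ ρ u Du e z := by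
    have h0 := A.density_nonneg
    rw [ae_restrict_iff' hQ] at h0
    filter_upwards [h0] with z hz
    by_cases hzQ : z ∈ spaceTime Ω T
    · have h1 := hz hzQ
      have h2 : ρ z.1 z.2 ≤ pressure ε γ (ρ z.1 z.2) :=
        le_add_of_nonneg_right (mul_nonneg A.eps_pos.le (Real.rpow_nonneg h1 _))
      have h3 := mul_le_mul_of_nonneg_left h2 (hζ.nonneg z.2)
      simp only [cutDensity, cutStress, cutFlux, hzQ, indicator_of_mem, sum_fluxTensor_mul he]
      refine ⟨mul_nonneg (hζ.nonneg _) h1, ?_⟩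
      simp only [hv]
      linarith
    · simp [cutDensity, cutStress, cutFlux, hzQ]
  rw [Measure.volume_eq_prod] at hpt
  filter_upwards [Measure.ae_ae_of_ae_prod hpt,
    ae_integrable_slice (A.integrable_cutDensity hΩ hζ hκ),
    ae_integrable_slice (A.integrable_cutMomentum hΩ hζ hκ he),
    ae_integrable_slice (A.integrable_cutFlux hΩ hζ hκ e), ae_integrable_slice iv2,
    ae_integrable_slice (A.integrable_cutStress hΩ hζ hκ e), ae_integrable_slice ig2]
    with t h1 ia im iq iv ig ig'
  simp_rw [hmv] at im ⊢
  have h2 := dirForm_self_le_of_flux (e := e) hb (v := fun x => v (t, x)) ia im iv ig iq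
    (h1.mono fun x hx => hx.1) (h1.mono fun x hx => hx.2)
  have h3 := dirForm_self_le (e := e) hb he hκ0 ig ig' (fun x hx => by
    have h0 : ζ x = 0 := by
      by_contra h0
      exact hx (by simpa using hκ.support x h0)
    simp [cutStress, indicator, h0])
  linarith

/-- The bound of the directional energy of `ζ ϱ`, uniform in the direction and in the width of the
strip. -/
lemma lintegral_dirForm_cutDensity_le (hΩ : IsOpen Ω)
    (hmom : MomentumBalance Ω T ν₁ ν₂ ε γ ρ₀ u₀ f ρ u Du)
    (hmass : RenormalizedMassBalance Ω T ρ₀ ρ u Du)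
    (hζ : IsCutoff Ω ζ) (hκ : CutoffBound ζ κ) (hb : 0 < b)
    (he : ‖e‖ = 1) (hτ : 0 < τ) (hχ : IsTimeCutoff T χ τ) :
    AEMeasurable (fun t => ENNReal.ofReal (χ t * dirForm b e
      (fun x => cutDensity Ω T ζ ρ (t, x)) fun x => cutDensity Ω T ζ ρ (t, x))) volume ∧
    ∫⁻ t, ENNReal.ofReal (χ t * dirForm b e (fun x => cutDensity Ω T ζ ρ (t, x))
      fun x => cutDensity Ω T ζ ρ (t, x)) ≤ ENNReal.ofReal (42 * κ ^ 3 * N ^ 4) := by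
  have hκ1 := hκ.one_le
  have hκ0 : 0 ≤ κ := zero_le_one.trans hκ1
  have hN := A.one_le
  have hχ1 : ∀ t, |χ t| ≤ 1 := fun t => by
    rw [abs_of_nonneg (hχ.nonneg t)]; exact hχ.le_one t
  have ha := A.integrable_cutDensity hΩ hζ hκ
  have hac : ∀ᵐ t, ∫ x : Plane, |cutDensity Ω T ζ ρ (t, x)| ≤ κ * N := by
    refine A.integral_abs_slice_le hΩ hκ0 ?_
    filter_upwards [A.density_nonneg] with z hz
    rw [abs_mul, abs_of_nonneg hz]
    exact mul_le_mul (hκ.abs_le _) (density_le_totalDensity A.eps_pos hz) hz hκ0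
  obtain ⟨i1, -⟩ := tendsto_integral_stConv (e := e) hb ha ha hac hχ.smooth.continuous hχ1
  obtain ⟨i2, hle⟩ := A.flux_sub_momentum_le hΩ hmom hmass hζ hκ hb he hτ hχ
  have ig2 : Integrable fun z => cutStress Ω T ζ ν₁ ν₂ Du e z ^ 2 := by
    refine ⟨(A.cutStress_meas hΩ hζ e).pow 2, ?_⟩
    rw [hasFiniteIntegral_iff_ofReal (ae_of_all _ fun z => sq_nonneg _)]
    exact (A.lintegral_cutStress_sq_le hΩ hκ he).trans_lt ENNReal.ofReal_lt_top
  have hG : ∫ z, cutStress Ω T ζ ν₁ ν₂ Du e z ^ 2 ≤ κ ^ 2 * N := by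
    rw [integral_eq_lintegral_of_nonneg_ae (ae_of_all _ fun z => sq_nonneg _)
      ig2.aestronglyMeasurable]
    exact ENNReal.toReal_le_of_le_ofReal (by positivity) (A.lintegral_cutStress_sq_le hΩ hκ he)
  rw [Measure.volume_eq_prod] at ig2 hG
  rw [integral_prod _ ig2] at hG
  have i3 := ig2.integral_prod_left
  refine ⟨i1.aemeasurable.ennreal_ofReal, ?_⟩
  rw [← ofReal_integral_eq_lintegral_ofReal i1]
  · refine ENNReal.ofReal_le_ofReal ?_
    calc _ ≤ ∫ t, (2 * (χ t * (dirForm b e (fun x => cutFlux Ω T ζ ν₁ ν₂ ε γ ρ u Du e (t, x))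
          (fun x => cutDensity Ω T ζ ρ (t, x))
        - dirForm b e (fun x => cutMomentum Ω T ζ ρ u e (t, x))
          (fun x => cutMomentum Ω T ζ ρ u e (t, x))))
        + 2 * κ * ∫ x, cutStress Ω T ζ ν₁ ν₂ Du e (t, x) ^ 2) := by
          refine integral_mono_ae i1 ((i2.const_mul 2).add (i3.const_mul _)) ?_
          filter_upwards [A.dirForm_cutDensity_le hΩ hζ hκ hb he] with t ht
          have h1 := mul_le_mul_of_nonneg_left ht (hχ.nonneg t)
          have h2 : χ t * (2 * κ * ∫ x, cutStress Ω T ζ ν₁ ν₂ Du e (t, x) ^ 2)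
              ≤ 1 * (2 * κ * ∫ x, cutStress Ω T ζ ν₁ ν₂ Du e (t, x) ^ 2) :=
            mul_le_mul_of_nonneg_right (hχ.le_one t)
              (mul_nonneg (by positivity) (integral_nonneg fun x => sq_nonneg _))
          linarith
      _ ≤ 2 * (20 * κ ^ 2 * N ^ 4) + 2 * κ * (κ ^ 2 * N) := by
          rw [integral_add (i2.const_mul 2) (i3.const_mul _), integral_const_mul,
            integral_const_mul]
          gcongr
      _ ≤ 42 * κ ^ 3 * N ^ 4 := by
          have h1 : κ ^ 2 ≤ κ ^ 3 := pow_le_pow_right₀ hκ1 (by norm_num)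
          have h2 : N ≤ N ^ 4 := le_self_pow₀ hN (by norm_num)
          have h3 : κ ^ 2 * N ^ 4 ≤ κ ^ 3 * N ^ 4 := by gcongr
          have h4 : κ ^ 3 * N ≤ κ ^ 3 * N ^ 4 := by gcongr
          linarith
  · filter_upwards [ae_integrable_slice ha] with t ht
    exact mul_nonneg (hχ.nonneg t) (dirForm_self_nonneg hb ht)

/-- The Fourier transform of `ζ ϱ` is square integrable on the line in a fixed direction: the limit of
an infinitely thin strip, by Fatou's lemma. -/
lemma lintegral_planeFourier_dir_le (hΩ : IsOpen Ω)
    (hmom : MomentumBalance Ω T ν₁ ν₂ ε γ ρ₀ u₀ f ρ u Du)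
    (hmass : RenormalizedMassBalance Ω T ρ₀ ρ u Du)
    (hζ : IsCutoff Ω ζ) (hκ : CutoffBound ζ κ) (he : ‖e‖ = 1) :
    ∫⁻ t in Ioo 0 T, ∫⁻ r : ℝ,
        ‖planeFourier (fun x => (cutDensity Ω T ζ ρ (t, x) : ℂ)) (r • e)‖ₑ ^ 2
      ≤ ENNReal.ofReal ((2 * Real.pi)⁻¹ * (42 * κ ^ 3 * N ^ 4)) := by
  have hπ := Real.pi_pos
  have ha := A.integrable_cutDensity hΩ hζ hκ
  set F : ℕ → ℝ → ℝ≥0∞ := fun n t => ENNReal.ofReal (2 * Real.pi)⁻¹ * ENNReal.ofReal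
    (endCutoff T n t * dirForm ((n : ℝ) + 1) e (fun x => cutDensity Ω T ζ ρ (t, x))
      fun x => cutDensity Ω T ζ ρ (t, x)) with hF
  have hn : ∀ n : ℕ, (0 : ℝ) < (n : ℝ) + 1 := fun n => by positivity
  have hpair := fun n : ℕ => A.lintegral_dirForm_cutDensity_le hΩ hmom hmass hζ hκ (hn n) he
    (one_div_pos.2 (hn n)) (isTimeCutoff_endCutoff A.time_nonneg n)
  have hFm : ∀ n, AEMeasurable (F n) (volume.restrict (Ioo 0 T)) := fun n =>
    ((hpair n).1.const_mul _).mono_measure Measure.restrict_le_self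
  have hFle : ∀ n, ∫⁻ t in Ioo 0 T, F n t
      ≤ ENNReal.ofReal ((2 * Real.pi)⁻¹ * (42 * κ ^ 3 * N ^ 4)) := fun n => by
    rw [ENNReal.ofReal_mul (by positivity), hF]
    dsimp only
    rw [lintegral_const_mul' _ _ ENNReal.ofReal_ne_top]
    gcongr
    exact (setLIntegral_le_lintegral _ _).trans (hpair n).2
  have hpt : ∀ᵐ t ∂(volume.restrict (Ioo 0 T)), ∫⁻ r : ℝ,
        ‖planeFourier (fun x => (cutDensity Ω T ζ ρ (t, x) : ℂ)) (r • e)‖ₑ ^ 2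
      ≤ liminf (fun n => F n t) atTop := by
    filter_upwards [ae_restrict_of_ae (ae_integrable_slice ha), ae_restrict_mem measurableSet_Ioo]
      with t hta ht
    set G : ℝ → ℝ≥0∞ := fun r =>
      ‖planeFourier (fun x => (cutDensity Ω T ζ ρ (t, x) : ℂ)) (r • e)‖ₑ ^ 2 with hG
    have hGm : Measurable G := by
      have := continuous_planeFourier (hta.ofReal (𝕜 := ℂ))
      have h2 : Continuous fun r : ℝ =>
          planeFourier (fun x => (cutDensity Ω T ζ ρ (t, x) : ℂ)) (r • e) := by fun_prop
      exact h2.measurable.enorm.pow_const 2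
    have hFe : ∀ᶠ n in atTop, F n t
        = ∫⁻ r : ℝ, ENNReal.ofReal (Real.exp (-r ^ 2 / (4 * ((n : ℝ) + 1)))) * G r := by
      filter_upwards [eventually_endCutoff_eq_one ht.2] with n hn1
      rw [lintegral_gauss_mul_planeFourier (hn n) hta, hF]
      dsimp only
      rw [hn1, one_mul, ← ENNReal.ofReal_mul (by positivity)]
    rw [liminf_congr hFe]
    refine le_trans (le_of_eq ?_) (lintegral_liminf_le fun n => ?_)
    · refine lintegral_congr fun r => ?_
      have h1 : Tendsto (fun n : ℕ => ENNReal.ofReal (Real.exp (-r ^ 2 / (4 * ((n : ℝ) + 1)))) * G r)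
          atTop (𝓝 (1 * G r)) := by
        refine ENNReal.Tendsto.mul_const ?_ (Or.inl one_ne_zero)
        have h2 : Tendsto (fun n : ℕ => 4 * ((n : ℝ) + 1)) atTop atTop :=
          (tendsto_atTop_add_const_right _ _ tendsto_natCast_atTop_atTop).const_mul_atTop
            (by norm_num)
        have h3 := ENNReal.tendsto_ofReal
          ((Real.continuous_exp.tendsto 0).comp (h2.const_div_atTop (-r ^ 2)))
        rwa [Real.exp_zero, ENNReal.ofReal_one] at h3
      rw [h1.liminf_eq, one_mul]
    · exact (by fun_prop : Measurable fun r : ℝ =>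
        ENNReal.ofReal (Real.exp (-r ^ 2 / (4 * ((n : ℝ) + 1))))).mul hGm
  calc _ ≤ ∫⁻ t in Ioo 0 T, liminf (fun n => F n t) atTop := lintegral_mono_ae hpt
    _ ≤ liminf (fun n => ∫⁻ t in Ioo 0 T, F n t) atTop := lintegral_liminf_le' hFm
    _ ≤ _ := by
        refine (liminf_le_liminf (Eventually.of_forall hFle)).trans ?_
        rw [liminf_const]

/-- The estimate of `ζ ϱ` in `L²(0,T; H^{-1/2})`, by integration over all directions in polar
coordinates. -/
lemma lintegral_sobolevNorm_cutDensity_le (hΩ : IsOpen Ω)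
    (hmom : MomentumBalance Ω T ν₁ ν₂ ε γ ρ₀ u₀ f ρ u Du)
    (hmass : RenormalizedMassBalance Ω T ρ₀ ρ u Du)
    (hζ : IsCutoff Ω ζ) (hκ : CutoffBound ζ κ) :
    ∫⁻ t in Ioo 0 T, sobolevNorm (-(1 / 2)) (fun x => (cutDensity Ω T ζ ρ (t, x) : ℂ)) ^ 2
      ≤ ENNReal.ofReal (42 * κ ^ 3 * N ^ 4) := by
  have hπ := Real.pi_pos
  have ha := A.integrable_cutDensity hΩ hζ hκ
  -- a jointly measurable representative, needed to exchange the integrals over time and angle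
  obtain ⟨a', ha'm, haa'⟩ := ha.aestronglyMeasurable
  have ha' : Integrable a' := ha.congr haa'
  have hslice : ∀ᵐ t, (fun y => cutDensity Ω T ζ ρ (t, y)) =ᵐ[volume] fun y => a' (t, y) := by
    rw [Measure.volume_eq_prod] at haa'
    exact Measure.ae_ae_of_ae_prod haa'
  have hFou : ∀ᵐ t, planeFourier (fun x => (cutDensity Ω T ζ ρ (t, x) : ℂ))
      = planeFourier fun x => (a' (t, x) : ℂ) := by
    filter_upwards [hslice] with t ht
    ext ξ
    unfold planeFourier
    congr 1
    refine integral_congr_ae ?_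
    filter_upwards [ht] with x hx
    rw [hx]
  set P : ℝ × Plane → ℝ≥0∞ := fun p => ‖planeFourier (fun x => (a' (p.1, x) : ℂ)) p.2‖ₑ ^ 2 with hP
  have hPm : Measurable P := by
    have h0 : Continuous fun p : (ℝ × Plane) × Plane => (inner ℝ p.2 p.1.2 : ℝ) := by fun_prop
    have h1 : StronglyMeasurable (Function.uncurry fun (p : ℝ × Plane) (x : Plane) =>
        Complex.exp (-(Complex.I * ((inner ℝ x p.2 : ℝ) : ℂ))) • (a' (p.1, x) : ℂ)) := by
      refine StronglyMeasurable.smul (Complex.continuous_exp.comp (continuous_const.mul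
        (Complex.continuous_ofReal.comp h0)).neg).stronglyMeasurable ?_
      exact Complex.continuous_ofReal.comp_stronglyMeasurable
        (ha'm.comp_measurable (by fun_prop))
    have h2 : StronglyMeasurable fun p : ℝ × Plane =>
        planeFourier (fun x => (a' (p.1, x) : ℂ)) p.2 :=
      h1.integral_prod_right.const_smul (((2 * Real.pi : ℝ) : ℂ)⁻¹)
    exact h2.measurable.enorm.pow_const 2
  have hPm3 : Measurable fun p : (ℝ × ℝ) × ℝ => P (p.1.1, p.2 • dir p.1.2) := by
    have := continuous_dir
    exact hPm.comp (by fun_prop)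
  have hPm2 : Measurable fun p : ℝ × ℝ => ∫⁻ r : ℝ, P (p.1, r • dir p.2) :=
    hPm3.lintegral_prod_right'
  calc ∫⁻ t in Ioo 0 T, sobolevNorm (-(1 / 2)) (fun x => (cutDensity Ω T ζ ρ (t, x) : ℂ)) ^ 2
      ≤ ∫⁻ t in Ioo 0 T, ∫⁻ θ in Ioo (-Real.pi) Real.pi, ∫⁻ r : ℝ, P (t, r • dir θ) := by
        refine lintegral_mono_ae ?_
        filter_upwards [ae_restrict_of_ae (ae_integrable_slice ha), ae_restrict_of_ae hFou]
          with t hta htF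
        have htC : Integrable fun x => (cutDensity Ω T ζ ρ (t, x) : ℂ) := hta.ofReal
        rw [sobolevNorm_sq htC, htF]
        refine le_trans (le_of_eq ?_) (lintegral_bracket_rpow_le (fun ξ => P (t, ξ))
          (hPm.comp measurable_prodMk_left))
        refine lintegral_congr fun ξ => ?_
        have h0 : (0 : ℝ) ≤ 1 + ‖ξ‖ ^ 2 := by positivity
        rw [mul_pow, ← ENNReal.ofReal_pow (by unfold bracket; positivity), bracket,
          ← Real.rpow_mul_natCast h0]
        norm_num [hP]
    _ = ∫⁻ θ in Ioo (-Real.pi) Real.pi, ∫⁻ t in Ioo 0 T, ∫⁻ r : ℝ, P (t, r • dir θ) :=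
        lintegral_lintegral_swap hPm2.aemeasurable
    _ ≤ ∫⁻ θ in Ioo (-Real.pi) Real.pi,
          ENNReal.ofReal ((2 * Real.pi)⁻¹ * (42 * κ ^ 3 * N ^ 4)) := by
        refine lintegral_mono fun θ => ?_
        refine le_trans (le_of_eq ?_)
          (A.lintegral_planeFourier_dir_le hΩ hmom hmass hζ hκ (norm_dir θ))
        refine lintegral_congr_ae ?_
        filter_upwards [ae_restrict_of_ae hFou] with t htF
        rw [htF]
    _ = _ := by
        rw [lintegral_const, Measure.restrict_apply_univ, Real.volume_Ioo,
          ← ENNReal.ofReal_mul' (by linarith)]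
        congr 1
        field_simp
        ring

end AprioriBound

end DirectionalBound

/-! ### The a priori bounds from the energy inequality -/

section EnergyBounds

lemma le_two_add_mul_log {r : ℝ} (hr : 0 ≤ r) : r ≤ 2 + r * Real.log (1 + r) := by
  rcases le_total r 2 with h | h
  · have := mul_nonneg hr (Real.log_nonneg (show (1 : ℝ) ≤ 1 + r by linarith))
    linarith
  · have h1 : 1 ≤ Real.log (1 + r) := by
      rw [Real.le_log_iff_exp_le (by linarith)]
      linarith [Real.exp_one_lt_d9]
    have := mul_le_mul_of_nonneg_left h1 hr
    linarith

lemma sum_stress_sq_le (ν₁ ν₂ : ℝ) (D : Fin 2 → Fin 2 → ℝ) :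
    ∑ i, ∑ j, stress ν₁ ν₂ D i j ^ 2 ≤ 8 * (ν₁ ^ 2 + ν₂ ^ 2) * ∑ i, ∑ j, D i j ^ 2 := by
  have h1 : ∀ a b c d : ℝ, (ν₁ * (a + b) + ν₂ * (c + d)) ^ 2
      ≤ 4 * ν₁ ^ 2 * (a ^ 2 + b ^ 2) + 4 * ν₂ ^ 2 * (c ^ 2 + d ^ 2) := fun a b c d => by
    nlinarith [sq_nonneg (ν₁ * (a + b) - ν₂ * (c + d)), sq_nonneg (ν₁ * (a - b)),
      sq_nonneg (ν₂ * (c - d))]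
  have h00 := h1 (D 0 0) (D 0 0) (D 0 0) (D 1 1)
  have h11 := h1 (D 1 1) (D 1 1) (D 0 0) (D 1 1)
  have h01 := h1 (D 0 1) (D 1 0) 0 0
  have h10 := h1 (D 1 0) (D 0 1) 0 0
  have h2 : 0 ≤ ν₂ ^ 2 * (D 0 1 ^ 2 + D 1 0 ^ 2) := by positivity
  simp only [stress, Fin.sum_univ_two, if_true, mul_one, if_false, mul_zero,
    add_zero, zero_ne_one, one_ne_zero] at *
  linarith

variable {Ω : Set Plane} {T ν₁ ν₂ ε γ : ℝ} {R U F E₀ : ℝ≥0} {ρ₀ : Plane → ℝ} {u₀ : Plane → Plane}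
  {f : ℝ → Plane → Plane} {ρ : ℝ → Plane → ℝ} {u : ℝ → Plane → Plane}
  {Du : ℝ → Plane → Fin 2 → Fin 2 → ℝ} {ζ : Plane → ℝ} {κ : ℝ}

/-- The constant which bounds the data and the solution in terms of the domain, the final time,
the viscosities, the norms of the data and the energy. -/
noncomputable def aprioriConst (Ω : Set Plane) (T ν₁ ν₂ : ℝ) (R U F E₀ : ℝ≥0) : ℝ :=
  1 + T + F + (4 * volume.real Ω + 2 * E₀)
    + (4 * (T * volume.real Ω) + 8 * (ν₁ ^ 2 + ν₂ ^ 2) * E₀)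
    + (R * volume.real Ω + R * (volume.real Ω + U ^ 2))

lemma IsFlowDomain.volume_ne_top (hΩ : IsFlowDomain Ω) : volume Ω ≠ ⊤ :=
  hΩ.isBounded.measure_lt_top.ne

lemma IsRegularizedSolution.ae_energy_le
    (h : IsRegularizedSolution Ω T ν₁ ν₂ ε γ ρ₀ u₀ f E₀ ρ u Du) :
    ∀ᵐ t ∂(volume.restrict (Ioo 0 T)), ∫⁻ x in Ω, ENNReal.ofReal
      (ρ t x * ‖u t x‖ ^ 2 + ρ t x * Real.log (1 + ρ t x) + ε * ρ t x ^ γ) ≤ E₀ := by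
  have h1 := h.energy_le
  rw [energy] at h1
  filter_upwards [ENNReal.ae_le_essSup (μ := volume.restrict (Ioo 0 T)) (fun t => ∫⁻ x in Ω,
    ENNReal.ofReal (ρ t x * ‖u t x‖ ^ 2 + ρ t x * Real.log (1 + ρ t x) + ε * ρ t x ^ γ))] with t ht
  exact ht.trans (le_self_add.trans h1)

lemma IsRegularizedSolution.lintegral_gradient_le
    (h : IsRegularizedSolution Ω T ν₁ ν₂ ε γ ρ₀ u₀ f E₀ ρ u Du) :
    ∫⁻ z in spaceTime Ω T, ENNReal.ofReal (∑ i, ∑ j, Du z.1 z.2 i j ^ 2) ≤ E₀ :=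
  (le_add_self.trans h.energy_le)

lemma IsRegularizedSolution.ae_ae_density_nonneg
    (h : IsRegularizedSolution Ω T ν₁ ν₂ ε γ ρ₀ u₀ f E₀ ρ u Du) :
    ∀ᵐ t ∂(volume.restrict (Ioo 0 T)), ∀ᵐ x ∂(volume.restrict Ω), 0 ≤ ρ t x := by
  have h1 := h.density_nonneg
  rw [volume_restrict_spaceTime] at h1
  exact Measure.ae_ae_of_ae_prod h1

lemma lintegral_stress_sq_le (h : IsRegularizedSolution Ω T ν₁ ν₂ ε γ ρ₀ u₀ f E₀ ρ u Du) :
    ∫⁻ z in spaceTime Ω T, ENNReal.ofReal (∑ i, ∑ j, stress ν₁ ν₂ (Du z.1 z.2) i j ^ 2)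
      ≤ ENNReal.ofReal (8 * (ν₁ ^ 2 + ν₂ ^ 2) * E₀) := by
  have hC : 0 ≤ 8 * (ν₁ ^ 2 + ν₂ ^ 2) := by positivity
  calc _ ≤ ∫⁻ z in spaceTime Ω T, ENNReal.ofReal (8 * (ν₁ ^ 2 + ν₂ ^ 2))
        * ENNReal.ofReal (∑ i, ∑ j, Du z.1 z.2 i j ^ 2) := by
        refine lintegral_mono fun z => ?_
        rw [← ENNReal.ofReal_mul hC]
        exact ENNReal.ofReal_le_ofReal (sum_stress_sq_le _ _ _)
    _ ≤ ENNReal.ofReal (8 * (ν₁ ^ 2 + ν₂ ^ 2)) * E₀ := by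
        rw [lintegral_const_mul' _ _ ENNReal.ofReal_ne_top]
        gcongr
        exact h.lintegral_gradient_le
    _ = _ := by rw [ENNReal.ofReal_mul hC, ENNReal.ofReal_coe_nnreal]

/-- The energy inequality and the bounds on the data provide all the bounds needed for the
estimate, uniformly in `ε` and `γ`. -/
lemma IsRegularizedSolution.aprioriBound (hΩ : IsFlowDomain Ω) (hT : 0 < T) (hε : 0 < ε)
    (hR : eLpNorm ρ₀ ⊤ (volume.restrict Ω) ≤ R)
    (hU : eLpNorm u₀ 2 (volume.restrict Ω) ≤ U)
    (hF : eLpNorm (fun z : ℝ × Plane => f z.1 z.2) ⊤ (volume.restrict (spaceTime Ω T)) ≤ F)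
    (h : IsRegularizedSolution Ω T ν₁ ν₂ ε γ ρ₀ u₀ f E₀ ρ u Du) :
    AprioriBound Ω T ν₁ ν₂ ε γ ρ₀ u₀ f ρ u Du (aprioriConst Ω T ν₁ ν₂ R U F E₀) := by
  have hV := hΩ.volume_ne_top
  have hV0 : 0 ≤ volume.real Ω := measureReal_nonneg
  have hVr : ENNReal.ofReal (volume.real Ω) = volume Ω := ofReal_measureReal hV
  have hF0 : (0 : ℝ) ≤ F := F.2
  have hE0 : (0 : ℝ) ≤ E₀ := E₀.2
  have hR0 : (0 : ℝ) ≤ R := R.2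
  have hC : 0 ≤ 8 * (ν₁ ^ 2 + ν₂ ^ 2) * (E₀ : ℝ) := by positivity
  have hTV : 0 ≤ T * volume.real Ω := by positivity
  have hRV : 0 ≤ R * volume.real Ω := by positivity
  have hRV2 : 0 ≤ R * (volume.real Ω + U ^ 2) := by positivity
  have hρ₀ : ∀ᵐ x ∂(volume.restrict Ω), ‖ρ₀ x‖ₑ ≤ R := by
    filter_upwards [enorm_ae_le_eLpNormEssSup ρ₀ (volume.restrict Ω)] with x hx
    rw [← eLpNorm_exponent_top] at hx
    exact hx.trans hR
  refine
    { one_le := by unfold aprioriConst; linarith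
      time_nonneg := hT.le
      time_le := by unfold aprioriConst; linarith
      eps_pos := hε
      density_nonneg := h.density_nonneg
      density_meas := h.density_measurable
      velocity_meas := h.velocity_memLp.aestronglyMeasurable
      gradient_meas := fun i j => (h.gradient_memLp i j).aestronglyMeasurable
      force_le := ?_
      density_le := ?_
      stress_le := ?_
      stress_sq_le := ?_
      initial_mass_le := ?_
      initial_momentum_le := ?_ }
  · filter_upwards [enorm_ae_le_eLpNormEssSup (fun z : ℝ × Plane => f z.1 z.2)
      (volume.restrict (spaceTime Ω T))] with z hz
    rw [← eLpNorm_exponent_top] at hz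
    have h1 : ‖f z.1 z.2‖ ≤ F := by
      have := hz.trans hF
      rw [enorm_le_coe] at this
      exact_mod_cast this
    unfold aprioriConst; linarith
  · filter_upwards [h.ae_energy_le, h.ae_ae_density_nonneg] with t ht htn
    calc ∫⁻ x in Ω, ENNReal.ofReal (totalDensity ε γ ρ u (t, x))
        ≤ ∫⁻ x in Ω, (ENNReal.ofReal 4 + ENNReal.ofReal 2 * ENNReal.ofReal
          (ρ t x * ‖u t x‖ ^ 2 + ρ t x * Real.log (1 + ρ t x) + ε * ρ t x ^ γ)) := by
          refine lintegral_mono_ae ?_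
          filter_upwards [htn] with x hx
          have h1 := le_two_add_mul_log hx
          have h2 : 0 ≤ ρ t x * ‖u t x‖ ^ 2 := by positivity
          have h3 : 0 ≤ ε * ρ t x ^ γ := mul_nonneg hε.le (Real.rpow_nonneg hx _)
          have h4 : 0 ≤ ρ t x * Real.log (1 + ρ t x) :=
            mul_nonneg hx (Real.log_nonneg (by linarith))
          rw [← ENNReal.ofReal_mul zero_le_two, ← ENNReal.ofReal_add (by norm_num) (by linarith)]
          refine ENNReal.ofReal_le_ofReal ?_
          simp only [totalDensity, pressure]
          linarith
      _ ≤ ENNReal.ofReal 4 * volume Ω + ENNReal.ofReal 2 * E₀ := by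
          rw [lintegral_add_left measurable_const, lintegral_const, Measure.restrict_apply_univ,
            lintegral_const_mul' _ _ ENNReal.ofReal_ne_top]
          gcongr
      _ = ENNReal.ofReal (4 * volume.real Ω + 2 * E₀) := by
          rw [ENNReal.ofReal_add (by positivity) (by positivity), ENNReal.ofReal_mul (by norm_num),
            ENNReal.ofReal_mul (by norm_num), hVr, ENNReal.ofReal_coe_nnreal]
      _ ≤ _ := ENNReal.ofReal_le_ofReal (by unfold aprioriConst; linarith)
  · calc ∫⁻ z in spaceTime Ω T, ENNReal.ofReal (∑ i, ∑ j, |stress ν₁ ν₂ (Du z.1 z.2) i j|)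
        ≤ ∫⁻ z in spaceTime Ω T, (ENNReal.ofReal 4 + ENNReal.ofReal
          (∑ i, ∑ j, stress ν₁ ν₂ (Du z.1 z.2) i j ^ 2)) := by
          refine lintegral_mono fun z => ?_
          rw [← ENNReal.ofReal_add (by norm_num) (by positivity)]
          refine ENNReal.ofReal_le_ofReal ?_
          have h1 : ∀ r : ℝ, |r| ≤ 1 + r ^ 2 := fun r => by
            rw [← sq_abs]; nlinarith [sq_nonneg (|r| - 1), abs_nonneg r]
          simp only [Fin.sum_univ_two]
          linarith [h1 (stress ν₁ ν₂ (Du z.1 z.2) 0 0), h1 (stress ν₁ ν₂ (Du z.1 z.2) 0 1),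
            h1 (stress ν₁ ν₂ (Du z.1 z.2) 1 0), h1 (stress ν₁ ν₂ (Du z.1 z.2) 1 1)]
      _ ≤ ENNReal.ofReal 4 * (ENNReal.ofReal T * volume Ω)
          + ENNReal.ofReal (8 * (ν₁ ^ 2 + ν₂ ^ 2) * E₀) := by
          rw [lintegral_add_left measurable_const, lintegral_const, Measure.restrict_apply_univ,
            spaceTime, Measure.volume_eq_prod, Measure.prod_prod, Real.volume_Ioo, sub_zero]
          gcongr
          exact lintegral_stress_sq_le h
      _ = ENNReal.ofReal (4 * (T * volume.real Ω) + 8 * (ν₁ ^ 2 + ν₂ ^ 2) * E₀) := by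
          rw [ENNReal.ofReal_add (by positivity) hC,
            ENNReal.ofReal_mul (p := 4) (by norm_num), ENNReal.ofReal_mul hT.le, hVr]
      _ ≤ _ := ENNReal.ofReal_le_ofReal (by unfold aprioriConst; linarith)
  · exact (lintegral_stress_sq_le h).trans
      (ENNReal.ofReal_le_ofReal (by unfold aprioriConst; linarith))
  · calc ∫⁻ x in Ω, ‖ρ₀ x‖ₑ ≤ ∫⁻ _ in Ω, (R : ℝ≥0∞) := lintegral_mono_ae hρ₀
      _ = ENNReal.ofReal (R * volume.real Ω) := by
          rw [lintegral_const, Measure.restrict_apply_univ, ENNReal.ofReal_mul hR0, hVr,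
            ENNReal.ofReal_coe_nnreal]
      _ ≤ _ := ENNReal.ofReal_le_ofReal (by unfold aprioriConst; linarith)
  · calc ∫⁻ x in Ω, ‖ρ₀ x‖ₑ * ‖u₀ x‖ₑ
        ≤ ∫⁻ x in Ω, (R : ℝ≥0∞) * (1 + ‖u₀ x‖ₑ ^ 2) := by
          refine lintegral_mono_ae ?_
          filter_upwards [hρ₀] with x hx
          gcongr
          rcases le_total ‖u₀ x‖ₑ 1 with h1 | h1
          · exact h1.trans le_self_add
          · exact (le_self_pow₀ h1 two_ne_zero).trans le_add_self
      _ ≤ R * (volume Ω + (U : ℝ≥0∞) ^ 2) := by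
          rw [lintegral_const_mul' _ _ ENNReal.coe_ne_top, lintegral_add_left measurable_const,
            lintegral_one, Measure.restrict_apply_univ, ← eLpNorm_two_sq]
          gcongr
      _ = ENNReal.ofReal (R * (volume.real Ω + U ^ 2)) := by
          rw [ENNReal.ofReal_mul hR0, ENNReal.ofReal_add hV0 (by positivity), hVr,
            ENNReal.ofReal_pow U.coe_nonneg, ENNReal.ofReal_coe_nnreal, ENNReal.ofReal_coe_nnreal]
      _ ≤ _ := ENNReal.ofReal_le_ofReal (by unfold aprioriConst; linarith)

/-- At almost every time the density belongs to `L²`, because of the artificial pressure. The bound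
degenerates as `ε → 0` and serves only to give a meaning to the products. -/
lemma IsRegularizedSolution.ae_memLp_density (hΩ : IsFlowDomain Ω) (hε : 0 < ε) (hγ : 6 ≤ γ)
    (h : IsRegularizedSolution Ω T ν₁ ν₂ ε γ ρ₀ u₀ f E₀ ρ u Du) :
    ∀ᵐ t ∂(volume.restrict (Ioo 0 T)), MemLp (ρ t) 2 (volume.restrict Ω) := by
  have hm := h.density_measurable
  rw [volume_restrict_spaceTime] at hm
  filter_upwards [h.ae_energy_le, h.ae_ae_density_nonneg, hm.prodMk_left] with t ht htn htm
  refine ⟨htm, ?_⟩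
  have h1 : eLpNorm (ρ t) 2 (volume.restrict Ω) ^ 2 < ⊤ := by
    rw [eLpNorm_two_sq]
    calc ∫⁻ x in Ω, ‖ρ t x‖ₑ ^ 2
        ≤ ∫⁻ x in Ω, (1 + ENNReal.ofReal ε⁻¹ * ENNReal.ofReal
          (ρ t x * ‖u t x‖ ^ 2 + ρ t x * Real.log (1 + ρ t x) + ε * ρ t x ^ γ)) := by
          refine lintegral_mono_ae ?_
          filter_upwards [htn] with x hx
          have h2 : 0 ≤ ρ t x * ‖u t x‖ ^ 2 := by positivity
          have h3 : 0 ≤ ρ t x ^ γ := Real.rpow_nonneg hx _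
          have h4 : 0 ≤ ρ t x * Real.log (1 + ρ t x) :=
            mul_nonneg hx (Real.log_nonneg (by linarith))
          have h5 : 0 ≤ ρ t x * ‖u t x‖ ^ 2 + ρ t x * Real.log (1 + ρ t x) + ε * ρ t x ^ γ := by
            have := mul_nonneg hε.le h3
            linarith
          rw [← ofReal_norm, Real.norm_of_nonneg hx, ← ENNReal.ofReal_pow hx,
            ← ENNReal.ofReal_mul (by positivity), ← ENNReal.ofReal_one,
            ← ENNReal.ofReal_add zero_le_one (by positivity)]
          refine ENNReal.ofReal_le_ofReal ?_
          have h6 : ρ t x ^ 2 ≤ 1 + ρ t x ^ γ := by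
            rcases le_total (ρ t x) 1 with h7 | h7
            · have := pow_le_one₀ (n := 2) hx h7
              linarith
            · have := Real.rpow_le_rpow_of_exponent_le h7 (show (2 : ℝ) ≤ γ by linarith)
              rw [Real.rpow_two] at this
              linarith
          have h8 : ρ t x ^ γ ≤ ε⁻¹ * (ρ t x * ‖u t x‖ ^ 2 + ρ t x * Real.log (1 + ρ t x)
              + ε * ρ t x ^ γ) := by
            rw [inv_mul_eq_div, le_div_iff₀ hε]
            linarith
          linarith
      _ ≤ volume Ω + ENNReal.ofReal ε⁻¹ * E₀ := by
          rw [lintegral_add_left measurable_const, lintegral_one, Measure.restrict_apply_univ,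
            lintegral_const_mul' _ _ ENNReal.ofReal_ne_top]
          gcongr
      _ < ⊤ := by
          have := hΩ.volume_ne_top
          finiteness
  exact (ENNReal.pow_lt_top_iff (n := 2)).1 h1 |>.resolve_right two_ne_zero

lemma IsCutoff.exists_cutoffBound (hζ : IsCutoff Ω ζ) : ∃ κ, CutoffBound ζ κ := by
  obtain ⟨C, hC⟩ := hζ.compact.exists_bound_of_continuous hζ.smooth.continuous
  have hD : ∀ j, ∃ D, ∀ x, ‖pderiv j ζ x‖ ≤ D := fun j => by
    refine HasCompactSupport.exists_bound_of_continuous ?_ (hζ.continuous_pderiv j)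
    exact (hζ.compact.fderiv (𝕜 := ℝ)).comp_left
      (g := fun L : Plane →L[ℝ] ℝ => L (EuclideanSpace.single j 1)) rfl
  choose D hD using hD
  obtain ⟨r, hr⟩ := hζ.compact.isBounded.exists_norm_le
  have hC0 : 0 ≤ C := (norm_nonneg _).trans (hC 0)
  have hD0 : ∀ j, 0 ≤ D j := fun j => (norm_nonneg _).trans (hD j 0)
  have hr0 : 0 ≤ |r| := abs_nonneg r
  refine ⟨1 + C + D 0 + D 1 + |r|, ?_, fun x => ?_, fun j x => ?_, fun x hx => ?_⟩
  · linarith [hD0 0, hD0 1]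
  · have := hC x
    rw [Real.norm_eq_abs] at this
    linarith [hD0 0, hD0 1]
  · have := hD j x
    rw [Real.norm_eq_abs] at this
    have hDj : ∀ j, D j ≤ D 0 + D 1 :=
      Fin.forall_fin_two.2 ⟨by linarith [hD0 1], by linarith [hD0 0]⟩
    linarith [hDj j]
  · have := hr x (subset_tsupport _ hx)
    linarith [hD0 0, hD0 1, le_abs_self r]

open Classical in
/-- A common bound for a cutoff function, its first derivatives and the size of its support. -/
noncomputable def cutoffConst (ζ : Plane → ℝ) : ℝ :=
  if h : ∃ κ, CutoffBound ζ κ then h.choose else 1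

lemma IsCutoff.cutoffBound (hζ : IsCutoff Ω ζ) : CutoffBound ζ (cutoffConst ζ) := by
  have h := hζ.exists_cutoffBound
  rw [cutoffConst, dif_pos h]
  exact h.choose_spec

end EnergyBounds

/-! ### Bochner norms and vector fields -/

section Bochner

variable {V : Type*} [NormedAddCommGroup V] [NormedSpace ℂ V]

/-- The weak measurability in the definition of the Bochner norm follows from joint measurability
and integrability. -/
lemma bochnerSobolevNorm_eq {p : ℝ≥0∞} {T σ : ℝ} {g : ℝ → Plane → V} {G : ℝ × Plane → V}
    (hG : AEStronglyMeasurable G) (hg : ∀ t ∈ Ioo 0 T, ∀ x, g t x = G (t, x)) :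
    bochnerSobolevNorm p T σ g
      = eLpNorm (fun t => sobolevNorm σ fun x => G (t, x)) p (volume.restrict (Ioo 0 T)) := by
  have hgt : ∀ t ∈ Ioo 0 T, g t = fun x => G (t, x) := fun t ht => funext (hg t ht)
  rw [bochnerSobolevNorm, if_pos]
  · refine eLpNorm_congr_ae ?_
    filter_upwards [ae_restrict_mem measurableSet_Ioo] with t ht
    rw [hgt t ht]
  · intro φ
    rw [Measure.volume_eq_prod] at hG
    have h1 : AEStronglyMeasurable (fun z : ℝ × Plane => φ z.2 • G z)
        ((volume : Measure ℝ).prod (volume : Measure Plane)) :=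
      (φ.continuous.comp continuous_snd).aestronglyMeasurable.smul hG
    refine (h1.integral_prod_right'.restrict (s := Ioo 0 T)).congr ?_
    filter_upwards [ae_restrict_mem measurableSet_Ioo] with t ht
    rw [hgt t ht]

lemma planeFourier_apply {G : Plane → CPlane} (hG : Integrable G) (ξ : Plane) (i : Fin 2) :
    planeFourier G ξ i = planeFourier (fun x => G x i) ξ := by
  have h := (EuclideanSpace.proj (𝕜 := ℂ) i : CPlane →L[ℂ] ℂ).integral_comp_comm
    (integrable_cexp_smul hG ξ)
  simp only [map_smul] at h
  rw [planeFourier, planeFourier, PiLp.smul_apply]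
  exact congrArg _ h.symm

lemma norm_le_norm_add_norm (v : CPlane) : ‖v‖ ≤ ‖v 0‖ + ‖v 1‖ := by
  rw [EuclideanSpace.norm_eq, Fin.sum_univ_two]
  refine Real.sqrt_le_iff.2 ⟨by positivity, ?_⟩
  nlinarith [mul_nonneg (norm_nonneg (v 0)) (norm_nonneg (v 1))]

lemma sobolevNorm_le_add {σ : ℝ} {G : Plane → CPlane} (hG : Integrable G) :
    sobolevNorm σ G ≤ sobolevNorm σ (fun x => G x 0) + sobolevNorm σ fun x => G x 1 := by
  have hi : ∀ i, Integrable fun x => G x i := fun i =>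
    (EuclideanSpace.proj (𝕜 := ℂ) i : CPlane →L[ℂ] ℂ).integrable_comp hG
  rw [sobolevNorm, sobolevNorm, sobolevNorm, if_pos hG, if_pos (hi 0), if_pos (hi 1)]
  set W : Plane → ℂ := fun ξ => (((1 + ‖ξ‖ ^ 2) ^ (σ / 2) : ℝ) : ℂ) with hW
  have hWc : Continuous W := by
    refine Complex.continuous_ofReal.comp (Continuous.rpow_const (by fun_prop) fun ξ => Or.inl ?_)
    positivity
  have hm : ∀ i, AEStronglyMeasurable (fun ξ => W ξ • planeFourier (fun x => G x i) ξ) volume :=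
    fun i => (hWc.smul (continuous_planeFourier (hi i))).aestronglyMeasurable
  calc eLpNorm (fun ξ => W ξ • planeFourier G ξ) 2 volume
      ≤ eLpNorm (fun ξ => ‖W ξ • planeFourier (fun x => G x 0) ξ‖
          + ‖W ξ • planeFourier (fun x => G x 1) ξ‖) 2 volume := by
        refine eLpNorm_mono_real fun ξ => ?_
        refine (norm_le_norm_add_norm _).trans_eq ?_
        simp only [PiLp.smul_apply, planeFourier_apply hG]
    _ ≤ _ := by
        refine (eLpNorm_add_le (hm 0).norm (hm 1).norm one_le_two).trans_eq ?_
        rw [eLpNorm_norm, eLpNorm_norm]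

lemma continuous_complexify : Continuous complexify := by
  unfold complexify
  fun_prop

lemma integrable_complexify {g : Plane → Plane} (hg : Integrable fun x => g x 0)
    (hg' : Integrable fun x => g x 1) : Integrable fun x => complexify (g x) := by
  have hm : AEStronglyMeasurable g volume := by
    have h : AEStronglyMeasurable (fun x => (!₂[g x 0, g x 1] : Plane)) volume :=
      (by fun_prop : Continuous fun p : ℝ × ℝ => (!₂[p.1, p.2] : Plane)).comp_aestronglyMeasurable
        (hg.aestronglyMeasurable.prodMk hg'.aestronglyMeasurable)
    refine h.congr (ae_of_all _ fun x => ?_)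
    ext i
    fin_cases i <;> rfl
  refine (hg.norm.add hg'.norm).mono' (continuous_complexify.comp_aestronglyMeasurable hm)
    (ae_of_all _ fun x => ?_)
  refine (norm_le_norm_add_norm _).trans_eq ?_
  simp [complexify]

end Bochner

/-! ### The estimates of `ζ ϱ` and `ζ ϱ u` -/

section Estimates

variable {Ω : Set Plane} {T ν₁ ν₂ ε γ s : ℝ} {R U F E₀ : ℝ≥0} {ρ₀ : Plane → ℝ}
  {u₀ : Plane → Plane} {f : ℝ → Plane → Plane} {ρ : ℝ → Plane → ℝ} {u : ℝ → Plane → Plane}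
  {Du : ℝ → Plane → Fin 2 → Fin 2 → ℝ} {ζ : Plane → ℝ}

/-- The localized momentum `ζ ϱ u`, extended by zero, as a complex vector field. -/
noncomputable def cutMomentumField (Ω : Set Plane) (T : ℝ) (ζ : Plane → ℝ) (ρ : ℝ → Plane → ℝ)
    (u : ℝ → Plane → Plane) (z : ℝ × Plane) : CPlane :=
  complexify ((spaceTime Ω T).indicator (fun z => (ζ z.2 * ρ z.1 z.2) • u z.1 z.2) z)

lemma cutMomentumField_apply (z : ℝ × Plane) (i : Fin 2) :
    cutMomentumField Ω T ζ ρ u z i = ((cutDensity Ω T ζ ρ z * u z.1 z.2 i : ℝ) : ℂ) := by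
  by_cases hz : z ∈ spaceTime Ω T <;> simp [cutMomentumField, complexify, cutDensity, hz]

lemma IsCutoff.cutDensity_eq (hζ : IsCutoff Ω ζ) {t : ℝ} (ht : t ∈ Ioo 0 T) (x : Plane) :
    cutDensity Ω T ζ ρ (t, x) = ζ x * ρ t x := by
  by_cases hx : x ∈ Ω
  · exact indicator_of_mem (show (t, x) ∈ spaceTime Ω T from ⟨ht, hx⟩) _
  · rw [cutDensity, indicator_of_notMem fun h => hx h.2, hζ.eq_zero_of_notMem hx, zero_mul]

lemma IsCutoff.cutMomentumField_eq (hζ : IsCutoff Ω ζ) {t : ℝ} (ht : t ∈ Ioo 0 T) (x : Plane) :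
    cutMomentumField Ω T ζ ρ u (t, x) = complexify ((ζ x * ρ t x) • u t x) := by
  ext i
  rw [cutMomentumField_apply, hζ.cutDensity_eq ht]
  rfl

/-- A form of the arithmetic-geometric mean inequality in `[0, ∞]`. -/
lemma le_mul_add_of_sq_le {a x y p : ℝ≥0∞} (hp : 1 ≤ p) (h : a ^ 2 ≤ p * x * y) :
    a ≤ p * (x + y) := by
  have h1 : p ≤ p ^ 2 := le_self_pow₀ hp two_ne_zero
  have h2 : a ^ 2 ≤ (p * (x + y)) ^ 2 := by
    calc a ^ 2 ≤ p * x * y := h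
      _ ≤ p ^ 2 * (x + y) * (x + y) := by
        gcongr
        · exact le_self_add
        · exact le_add_self
      _ = _ := by ring
  exact (ENNReal.pow_le_pow_left_iff two_ne_zero).1 h2

/-- The momentum at a fixed time, by the product estimate. -/
lemma sobolevNorm_cutMomentumField_le (hΩ : IsFlowDomain Ω) (hζ : IsCutoff Ω ζ) (hs : 1 / 2 < s)
    {t : ℝ} (ht : t ∈ Ioo 0 T) (hρ : MemLp (ρ t) 2 (volume.restrict Ω))
    (hu : ∀ i, MemW120 Ω (fun x => u t x i) fun j x => Du t x i j) :
    sobolevNorm (-s) (fun x => cutMomentumField Ω T ζ ρ u (t, x))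
      ≤ (productConst s + 1) *
        (2 * sobolevNorm (-(1 / 2)) (fun x => (cutDensity Ω T ζ ρ (t, x) : ℂ)) ^ 2
          + (1 + poincareConst Ω) * ∫⁻ x in Ω, ENNReal.ofReal (∑ i, ∑ j, Du t x i j ^ 2)) := by
  have hΩm := hΩ.isOpen.measurableSet
  have hV := hΩ.volume_ne_top
  set a : Plane → ℝ := fun x => cutDensity Ω T ζ ρ (t, x) with ha
  set X := sobolevNorm (-(1 / 2)) (fun x => (a x : ℂ)) with hX
  have ha0 : ∀ x, x ∉ Ω → a x = 0 := fun x hx => indicator_of_notMem (fun h => hx h.2) _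
  have haΩ : Ω.indicator a = a := by
    ext x
    by_cases hx : x ∈ Ω
    · exact indicator_of_mem hx _
    · rw [indicator_of_notMem hx, ha0 x hx]
  have ha2 : MemLp a 2 := by
    rw [← haΩ, memLp_indicator_iff_restrict hΩm]
    have hb := hζ.cutoffBound.abs_le
    refine (hρ.const_mul (cutoffConst ζ)).mono
      ((hζ.smooth.continuous.aestronglyMeasurable.mul hρ.aestronglyMeasurable).congr
        (ae_of_all _ fun x => (hζ.cutDensity_eq ht x).symm)) (ae_of_all _ fun x => ?_)
    rw [ha]
    dsimp only
    rw [hζ.cutDensity_eq ht, norm_mul, norm_mul]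
    refine mul_le_mul_of_nonneg_right ((hb x).trans (le_abs_self _)) (norm_nonneg _)
  have ha1 : Integrable a := by
    rw [← haΩ, integrable_indicator_iff hΩm]
    have : IsFiniteMeasure (volume.restrict Ω) := ⟨by simpa using hV.lt_top⟩
    exact memLp_one_iff_integrable.1 ((ha2.restrict Ω).mono_exponent one_le_two)
  have hp : 1 ≤ productConst s + 1 := le_add_self
  -- the product estimate needs a finite norm; otherwise the right-hand side is infinite
  by_cases hfin : X = ⊤
  · rw [hfin, ENNReal.top_pow two_ne_zero, ENNReal.mul_top two_ne_zero, top_add,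
      ENNReal.mul_top (zero_lt_one.trans_le hp).ne']
    exact le_top
  have hcomp := fun i => sobolevNorm_mul_sq_le hΩm hV hs ha1 ha2 ha0 hfin (hu i)
  have hle : ∀ i, sobolevNorm (-s) (fun x => ((a x * u t x i : ℝ) : ℂ))
      ≤ (productConst s + 1) * (X ^ 2 + (1 + poincareConst Ω)
        * ∑ j, eLpNorm (fun x => Du t x i j) 2 (volume.restrict Ω) ^ 2) := fun i => by
    refine le_mul_add_of_sq_le hp ((hcomp i).2.trans ?_)
    gcongr
    exact le_self_add
  have hint : Integrable fun x => cutMomentumField Ω T ζ ρ u (t, x) := by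
    have h1 : (fun x => cutMomentumField Ω T ζ ρ u (t, x))
        = fun x => complexify (WithLp.toLp 2 fun i => a x * u t x i) := by
      ext x i
      rw [cutMomentumField_apply]
      rfl
    rw [h1]
    exact integrable_complexify (hcomp 0).1 (hcomp 1).1
  have hD : ∑ i, ∑ j, eLpNorm (fun x => Du t x i j) 2 (volume.restrict Ω) ^ 2
      = ∫⁻ x in Ω, ENNReal.ofReal (∑ i, ∑ j, Du t x i j ^ 2) := by
    have hm : ∀ i j, AEMeasurable (fun x => ‖Du t x i j‖ₑ ^ 2) (volume.restrict Ω) := fun i j =>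
      ((hu i).2.1 j).aestronglyMeasurable.enorm.pow_const 2
    simp_rw [eLpNorm_two_sq]
    simp_rw [← lintegral_finsetSum' _ fun j _ => hm _ j]
    rw [← lintegral_finsetSum' _ fun i _ => Finset.aemeasurable_fun_sum _ fun j _ => hm i j]
    refine lintegral_congr fun x => ?_
    rw [ENNReal.ofReal_sum_of_nonneg fun i _ => Finset.sum_nonneg fun j _ => sq_nonneg _]
    refine Finset.sum_congr rfl fun i _ => ?_
    rw [ENNReal.ofReal_sum_of_nonneg fun j _ => sq_nonneg _]
    refine Finset.sum_congr rfl fun j _ => ?_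
    rw [← ofReal_norm, ← ENNReal.ofReal_pow (norm_nonneg _), Real.norm_eq_abs, sq_abs]
  refine (sobolevNorm_le_add hint).trans ?_
  simp only [cutMomentumField_apply]
  refine (add_le_add (hle 0) (hle 1)).trans_eq ?_
  rw [← hD]
  simp only [Fin.sum_univ_two]
  ring

/-- The estimate of the momentum. -/
lemma lintegral_sobolevNorm_cutMomentumField_le (hΩ : IsFlowDomain Ω) (hε : 0 < ε) (hγ : 6 ≤ γ)
    (h : IsRegularizedSolution Ω T ν₁ ν₂ ε γ ρ₀ u₀ f E₀ ρ u Du) (hζ : IsCutoff Ω ζ)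
    (hs : 1 / 2 < s) :
    ∫⁻ t in Ioo 0 T, sobolevNorm (-s) (fun x => cutMomentumField Ω T ζ ρ u (t, x))
      ≤ (productConst s + 1) * (2 * (∫⁻ t in Ioo 0 T,
          sobolevNorm (-(1 / 2)) (fun x => (cutDensity Ω T ζ ρ (t, x) : ℂ)) ^ 2)
        + (1 + poincareConst Ω) * E₀) := by
  have hP : 1 + poincareConst Ω ≠ ⊤ :=
    ENNReal.add_ne_top.2 ⟨ENNReal.one_ne_top, poincareConst_ne_top hΩ.volume_ne_top⟩
  have hC : productConst s + 1 ≠ ⊤ :=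
    ENNReal.add_ne_top.2 ⟨productConst_ne_top hs, ENNReal.one_ne_top⟩
  have hDm : AEMeasurable (fun z : ℝ × Plane => ENNReal.ofReal (∑ i, ∑ j, Du z.1 z.2 i j ^ 2))
      (((volume : Measure ℝ).restrict (Ioo 0 T)).prod ((volume : Measure Plane).restrict Ω)) := by
    rw [← volume_restrict_spaceTime]
    refine AEMeasurable.ennreal_ofReal ?_
    exact Finset.aemeasurable_fun_sum _ fun i _ => Finset.aemeasurable_fun_sum _ fun j _ =>
      (h.gradient_memLp i j).aestronglyMeasurable.aemeasurable.pow_const 2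
  have hD := h.lintegral_gradient_le
  rw [volume_restrict_spaceTime, lintegral_prod _ hDm] at hD
  calc _ ≤ ∫⁻ t in Ioo 0 T, (productConst s + 1) *
        (2 * sobolevNorm (-(1 / 2)) (fun x => (cutDensity Ω T ζ ρ (t, x) : ℂ)) ^ 2
          + (1 + poincareConst Ω) * ∫⁻ x in Ω, ENNReal.ofReal (∑ i, ∑ j, Du t x i j ^ 2)) := by
        refine lintegral_mono_ae ?_
        filter_upwards [ae_restrict_mem measurableSet_Ioo, h.ae_memLp_density hΩ hε hγ,
          h.velocity_sobolev] with t ht hρ hu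
        exact sobolevNorm_cutMomentumField_le hΩ hζ hs ht hρ hu
    _ ≤ _ := by
        rw [lintegral_const_mul' _ _ hC,
          lintegral_add_right' _ (hDm.lintegral_prod_right'.const_mul _),
          lintegral_const_mul' _ _ ENNReal.ofNat_ne_top, lintegral_const_mul' _ _ hP]
        gcongr

end Estimates

theorem proposition5p1 :
    ∃ (c : (Plane → ℝ) → ℝ≥0) (c' : ℝ → ℝ≥0),
      ∀ (Ω : Set Plane) (T ν₁ ν₂ : ℝ) (R U F E₀ : ℝ≥0),
        IsFlowDomain Ω → 0 < T → 0 < ν₁ → 0 ≤ ν₁ + ν₂ →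
      ∃ E : ℝ≥0,
        ∀ (ρ₀ : Plane → ℝ) (u₀ : Plane → Plane) (f : ℝ → Plane → Plane),
          IsFlowData Ω T ρ₀ u₀ f →
          eLpNorm ρ₀ ∞ (volume.restrict Ω) ≤ R →
          eLpNorm u₀ 2 (volume.restrict Ω) ≤ U →
          eLpNorm (fun z : ℝ × Plane => f z.1 z.2) ∞ (volume.restrict (spaceTime Ω T)) ≤ F →
        ∀ (ε γ : ℝ), 0 < ε → ε ≤ 1 → 6 ≤ γ →
        ∀ (ρ : ℝ → Plane → ℝ) (u : ℝ → Plane → Plane) (Du : ℝ → Plane → Fin 2 → Fin 2 → ℝ),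
          IsRegularizedSolution Ω T ν₁ ν₂ ε γ ρ₀ u₀ f E₀ ρ u Du →
        ∀ ζ : Plane → ℝ, IsCutoff Ω ζ →
          bochnerSobolevNorm 2 T (-(1 / 2)) (fun t x => ((ζ x * ρ t x : ℝ) : ℂ))
              ≤ (c ζ : ℝ≥0∞) * E ∧
          ∀ s : ℝ, 1 / 2 < s →
            bochnerSobolevNorm 1 T (-s) (fun t x => complexify ((ζ x * ρ t x) • u t x))
              ≤ (c ζ : ℝ≥0∞) * c' s * E := by
  refine ⟨fun ζ => (cutoffConst ζ).toNNReal ^ 3, fun s => (productConst s).toNNReal + 1, ?_⟩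
  intro Ω T ν₁ ν₂ R U F E₀ hΩ hT _ _
  set N := aprioriConst Ω T ν₁ ν₂ R U F E₀ with hN
  refine ⟨(84 * N ^ 4).toNNReal + (1 + (poincareConst Ω).toNNReal) * E₀, ?_⟩
  intro ρ₀ u₀ f _ hR hU hF ε γ hε _ hγ ρ u Du h ζ hζ
  have A := h.aprioriBound hΩ hT hε hR hU hF
  rw [← hN] at A
  have hN1 := A.one_le
  have hκ := hζ.cutoffBound
  have hκ1 := hκ.one_le
  have hX := A.lintegral_sobolevNorm_cutDensity_le hΩ.isOpen h.momentum h.mass hζ hκ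
  set X : ℝ → ℝ≥0∞ := fun t =>
    sobolevNorm (-(1 / 2)) fun x => (cutDensity Ω T ζ ρ (t, x) : ℂ) with hXd
  set k : ℝ≥0∞ := ENNReal.ofReal (cutoffConst ζ) with hk
  have hk1 : 1 ≤ k := by rw [hk, ← ENNReal.ofReal_one]; exact ENNReal.ofReal_le_ofReal hκ1
  have hN4 : (1 : ℝ) ≤ N ^ 4 := one_le_pow₀ hN1
  have hPc : ((poincareConst Ω).toNNReal : ℝ≥0∞) = poincareConst Ω :=
    ENNReal.coe_toNNReal (poincareConst_ne_top hΩ.volume_ne_top)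
  have hcE : ((((cutoffConst ζ).toNNReal ^ 3 : ℝ≥0)) : ℝ≥0∞) = k ^ 3 := by
    rw [ENNReal.coe_pow]; rfl
  have hE : ((((84 * N ^ 4).toNNReal + (1 + (poincareConst Ω).toNNReal) * E₀ : ℝ≥0)) : ℝ≥0∞)
      = 2 * ENNReal.ofReal (42 * N ^ 4) + (1 + poincareConst Ω) * E₀ := by
    push_cast
    rw [hPc, ← ENNReal.ofReal_ofNat 2, ← ENNReal.ofReal_mul zero_le_two]
    congr 2
    rw [← mul_assoc]
    norm_num
  have hB : ENNReal.ofReal (42 * cutoffConst ζ ^ 3 * N ^ 4) = k ^ 3 * ENNReal.ofReal (42 * N ^ 4) := by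
    rw [hk, ← ENNReal.ofReal_pow (by linarith), ← ENNReal.ofReal_mul (by positivity)]
    congr 1; ring
  rw [hB] at hX
  rw [hcE, hE]
  have hm := A.integrable_cutDensity hΩ.isOpen hζ hκ
  constructor
  · rw [bochnerSobolevNorm_eq (G := fun z => (cutDensity Ω T ζ ρ z : ℂ)) hm.ofReal.aestronglyMeasurable
      fun t ht x => by rw [hζ.cutDensity_eq ht]]
    have h1 : 1 ≤ k ^ 3 * ENNReal.ofReal (42 * N ^ 4) := by
      refine one_le_mul (one_le_pow₀ hk1) ?_
      rw [← ENNReal.ofReal_one]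
      exact ENNReal.ofReal_le_ofReal (by linarith)
    -- the constant is at least `1`, hence dominates its square root
    have h2 : eLpNorm X 2 (volume.restrict (Ioo 0 T)) ^ 2
        ≤ (k ^ 3 * ENNReal.ofReal (42 * N ^ 4)) ^ 2 := by
      rw [eLpNorm_two_sq]
      simp only [enorm_eq_self]
      exact hX.trans (le_self_pow₀ h1 two_ne_zero)
    refine ((ENNReal.pow_le_pow_left_iff two_ne_zero).1 h2).trans ?_
    gcongr
    refine le_trans ?_ le_self_add
    rw [two_mul]
    exact le_self_add
  · intro s hs
    have hvm : AEStronglyMeasurable (cutMomentumField Ω T ζ ρ u) volume := by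
      refine continuous_complexify.comp_aestronglyMeasurable
        ((aestronglyMeasurable_indicator_iff (measurableSet_spaceTime hΩ.isOpen T)).2 ?_)
      exact ((hζ.smooth.continuous.comp continuous_snd).aestronglyMeasurable.mul
        A.density_meas).smul A.velocity_meas
    rw [bochnerSobolevNorm_eq hvm fun t ht x => (hζ.cutMomentumField_eq ht x).symm,
      eLpNorm_one_eq_lintegral_enorm]
    simp only [enorm_eq_self]
    have hQc : (((productConst s).toNNReal + 1 : ℝ≥0) : ℝ≥0∞) = productConst s + 1 := by
      push_cast
      rw [ENNReal.coe_toNNReal (productConst_ne_top hs)]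
    rw [hQc]
    refine (lintegral_sobolevNorm_cutMomentumField_le hΩ hε hγ h hζ hs).trans ?_
    calc (productConst s + 1) * (2 * (∫⁻ t in Ioo 0 T, X t ^ 2) + (1 + poincareConst Ω) * E₀)
        ≤ (productConst s + 1) * (2 * (k ^ 3 * ENNReal.ofReal (42 * N ^ 4))
          + k ^ 3 * ((1 + poincareConst Ω) * E₀)) := by
          have h3 : (1 + poincareConst Ω) * (E₀ : ℝ≥0∞)
              ≤ k ^ 3 * ((1 + poincareConst Ω) * E₀) :=
            le_mul_of_one_le_left zero_le (one_le_pow₀ hk1)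
          gcongr
      _ = _ := by ring
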